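/- **Setting.** Let $f_1,\dots,f_d:\mathbb R^l\to\mathbb R$ ($d\ge 1$) be convex and continuously differentiable, $f=\frac1d\sum_{i=1}^d f_i$, let $\mathcal A:\mathbb R^{m\times n}\to\mathbb R^l$ be linear with adjoint $\mathcal A^*$ (trace inner product), and let $\alpha>0$. Assume that each $f_i\circ\mathcal A$ is $L$-smooth in the Frobenius norm ($L\ge 0$), i.e. its gradient is $L$-Lipschitz on $\mathbb R^{m\times n}$. Consider $$\text{minimize } f(\mathcal A X)\quad\text{subject to } \|X\|_*\le\alpha, \qquad\qquad (1)$$ where $\|\cdot\|_*$ is the nuclear norm. Fix $\delta>0$, a target rank $r\ge 0$, a number $T$ of epochs, and set $$\gamma_k=\tfrac{2}{k+1},\quad m_k=96(k+1),\quad N_t=2^{t+3}-2,\quad \epsilon_k=\tfrac{L(2\alpha)^2}{2}\gamma_k\delta .$$ **Algorithm (sketched stochastic variance-reduced Frank–Wolfe with approximate oracle).** Let $\Phi\in\mathbb R^{(4r+3)\times m}$, $\Psi\in\mathbb R^{n\times(2r+1)}$ have independent standard normal entries. Start from a (possibly random) feasible $X_0$, for instance $X_0=0$, with $x_0=\mathcal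 A X_0$, $Y^C=X_0\Psi$, $Y^R=\Phi X_0$. For $t=1,\dots,T$: put $z_0=x_{t-1}$, and for $k=1,\dots,N_t$, * draw indices $i_1,\dots,i_{m_k}$ independently and uniformly from $\{1,\dots,d\}$, independently of the starting point and of all earlier samples and oracle outputs, and set $\tilde\nabla_k=\frac1{m_k}\sum_{j=1}^{m_k}\big(\nabla f_{i_j}(z_{k-1})-\nabla f_{i_j}(z_0)+\nabla f(z_0)\big)$; * obtain (measurably) $u\in\mathbb R^m$, $v\in\mathbb R^n$ with $\|u\|\,\|v\|\le 1$ and $-\alpha\,\mathrm{tr}\big((\mathcal A^*\tilde\nabla_k)^T uv^T\big)\le\min_{\|X\|_*\le\alpha}\mathrm{tr}\big((\mathcal A^*\tilde\nabla_k)^TX\big)+\epsilon_k$; * update $z_k=(1-\gamma_k)z_{k-1}+\gamma_k\mathcal A(-\alpha uv^T)$, $\;Y^C\leftarrow(1-\gamma_k)Y^C+\gamma_k(-\alpha uv^T)\Psi$, $\;Y^R\leftarrow(1-\gamma_k)Y^R+\gamma_k\Phi(-\alpha uv^T)$. After epoch $t$ put $x_t=z_{N_t}$; the sketches are carried over to the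 next epoch, while $k$ restarts at $1$. The pair $(\Phi,\Psi)$ is independent of the starting point, the samples and the oracle outputs. With $Y^C,Y^R$ the sketches at the end of epoch $t$, let $Y^C=QR$ be a reduced QR factorization ($Q\in\mathbb R^{m\times\min(m,2r+1)}$ with orthonormal columns, computed from $Y^C$ by a fixed measurable routine), $B=(\Phi Q)^\dagger Y^R$ with $\dagger$ the Moore–Penrose pseudoinverse, and $\hat X_t=Q[B]_r$, where $[B]_r$ is any (measurably chosen) best approximation of $B$ of rank at most $r$ in Frobenius norm. **Theorem.** Fix $\kappa>0$ and $\nu\ge1$. Suppose that (1) has a unique solution $X^\star$, that $\operatorname{rank}X^\star\le r$, and that $$f(\mathcal AX)-f(\mathcal AX^\star)\ \ge\ \kappa\,\|X-X^\star\|_F^{\nu}\qquad\text{for all }X\text{ with }\|X\|_*\le\alpha .$$ Then for every $t\in\{1,\dots,T\}$ the random variable $\|\hat X_t-X^\star\|_F$ is integrable and $$\mathbf E\,\|\hat X_t-X^\star\|_F\ \le\ 6\Big(\frac{4\kappa^{-1}L\alpha^2(1+\delta)}{2^{t+1}}\Big)^{1/\nu}.$$ -/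

import Mathlib

open MeasureTheory ProbabilityTheory Set
open scoped Matrix Matrix.Norms.Frobenius Gradient

namespace SSVRF

/-! Matrices carry the Frobenius norm. -/

/-- The linear map between Euclidean spaces given by a matrix. -/
noncomputable def toLin {m n : ℕ} (X : Matrix (Fin m) (Fin n) ℝ) :
    EuclideanSpace ℝ (Fin n) →ₗ[ℝ] EuclideanSpace ℝ (Fin m) :=
  Matrix.toEuclideanLin X

/-- The nuclear norm: the sum of the singular values. -/
noncomputable def nuclearNorm {m n : ℕ} (X : Matrix (Fin m) (Fin n) ℝ) : ℝ :=
  ∑ i ∈ Finset.range (min m n), (toLin X).singularValues i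

/-- The adjoint of a linear map from matrices (with the trace inner product) to a Euclidean
space. Its defining property is `trace_adjointMap`. -/
noncomputable def adjointMap {m n l : ℕ}
    (A : Matrix (Fin m) (Fin n) ℝ →ₗ[ℝ] EuclideanSpace ℝ (Fin l))
    (z : EuclideanSpace ℝ (Fin l)) : Matrix (Fin m) (Fin n) ℝ :=
  Matrix.of fun i j => inner ℝ (A (Matrix.single i j 1)) z

theorem trace_adjointMap {m n l : ℕ}
    (A : Matrix (Fin m) (Fin n) ℝ →ₗ[ℝ] EuclideanSpace ℝ (Fin l))
    (z : EuclideanSpace ℝ (Fin l)) (X : Matrix (Fin m) (Fin n) ℝ) :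
    ((adjointMap A z)ᵀ * X).trace = inner ℝ (A X) z := by
  have hX : A X = ∑ i, ∑ j, X i j • A (Matrix.single i j 1) := by
    conv_lhs => rw [Matrix.matrix_eq_sum_single X]
    simp only [map_sum]
    refine Finset.sum_congr rfl fun i _ => Finset.sum_congr rfl fun j _ => ?_
    rw [← map_smul, Matrix.smul_single, smul_eq_mul, mul_one]
  rw [hX]
  simp only [sum_inner, real_inner_smul_left, Matrix.trace, Matrix.diag_apply, Matrix.mul_apply,
    Matrix.transpose_apply, adjointMap, Matrix.of_apply]
  rw [Finset.sum_comm]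
  exact Finset.sum_congr rfl fun i _ => Finset.sum_congr rfl fun j _ => mul_comm _ _

/-- The gradient of `g` is `L`-Lipschitz. The dual norm of a difference of derivatives is the
Euclidean (here: Frobenius) norm of the difference of the gradients. -/
def IsLSmooth {E : Type*} [NormedAddCommGroup E] [NormedSpace ℝ E] (L : ℝ) (g : E → ℝ) : Prop :=
  0 ≤ L ∧ Differentiable ℝ g ∧ ∀ x y, ‖fderiv ℝ g x - fderiv ℝ g y‖ ≤ L * ‖x - y‖

/-- The average of finitely many functions. -/
noncomputable def avg {d : ℕ} {E : Type*} (f : Fin d → E → ℝ) (z : E) : ℝ :=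
  (1 / (d : ℝ)) * ∑ i, f i z

/-- `Xs` is the unique minimizer of `g` over the nuclear norm ball of radius `α`. -/
def IsUniqueSolution {m n : ℕ} (g : Matrix (Fin m) (Fin n) ℝ → ℝ) (α : ℝ)
    (Xs : Matrix (Fin m) (Fin n) ℝ) : Prop :=
  nuclearNorm Xs ≤ α ∧ (∀ X, nuclearNorm X ≤ α → g Xs ≤ g X) ∧
    ∀ Y, nuclearNorm Y ≤ α → (∀ X, nuclearNorm X ≤ α → g Y ≤ g X) → Y = Xs

/-! ### Parameters of the algorithm -/

/-- Step size. -/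
noncomputable def gam (k : ℕ) : ℝ := 2 / ((k : ℝ) + 1)

/-- Mini-batch size. -/
def batchSize (k : ℕ) : ℕ := 96 * (k + 1)

/-- Length of epoch `t`. -/
def epochLen (t : ℕ) : ℕ := 2 ^ (t + 3) - 2

/-- Tolerance of the linear optimization oracle, with `2 * α` as the diameter. -/
noncomputable def tol (L α δ : ℝ) (k : ℕ) : ℝ := L * (2 * α) ^ 2 / 2 * gam k * δ

/-- `(t, k)` is an inner iteration of a run with `T` epochs. -/
def IsStep (T t k : ℕ) : Prop := 1 ≤ t ∧ t ≤ T ∧ 1 ≤ k ∧ k ≤ epochLen t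

/-! ### The update rule

The same update `x ← (1 - γ_k) x + γ_k h_k` is applied to the dual variable and to both sketches. -/

/-- The inner iterates of one epoch that starts at `x`. -/
noncomputable def innerIter {E : Type*} [AddCommGroup E] [Module ℝ E] (x : E) (h : ℕ → E) : ℕ → E
  | 0 => x
  | k + 1 => (1 - gam (k + 1)) • innerIter x h k + gam (k + 1) • h (k + 1)

/-- The value at the end of epoch `t`; the step counter restarts at `1` in every epoch. -/
noncomputable def epochEnd {E : Type*} [AddCommGroup E] [Module ℝ E] (x₀ : E) (h : ℕ → ℕ → E) :
    ℕ → E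
  | 0 => x₀
  | t + 1 => innerIter (epochEnd x₀ h t) (h (t + 1)) (epochLen (t + 1))

/-- The `k`-th inner iterate of epoch `t ≥ 1`. -/
noncomputable def iterate {E : Type*} [AddCommGroup E] [Module ℝ E] (x₀ : E) (h : ℕ → ℕ → E)
    (t k : ℕ) : E :=
  innerIter (epochEnd x₀ h (t - 1)) (h t) k

/-- The rank-one point `-α u vᵀ`. -/
noncomputable def atom {m n : ℕ} (α : ℝ) (u : EuclideanSpace ℝ (Fin m))
    (v : EuclideanSpace ℝ (Fin n)) : Matrix (Fin m) (Fin n) ℝ :=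
  -(α • Matrix.vecMulVec u.ofLp v.ofLp)

/-- The mini-batch average of the variance-reduced gradients
`∇ f_i z - (∇ f_i z₀ - ∇ f z₀)` over the sampled indices `i = idx 0, …, idx (M - 1)`. -/
noncomputable def vrGrad {d l : ℕ} (f : Fin d → EuclideanSpace ℝ (Fin l) → ℝ)
    (M : ℕ) (idx : ℕ → Fin d) (z z₀ : EuclideanSpace ℝ (Fin l)) : EuclideanSpace ℝ (Fin l) :=
  (1 / (M : ℝ)) • ∑ j ∈ Finset.range M,
    (∇ (f (idx j)) z - (∇ (f (idx j)) z₀ - ∇ (avg f) z₀))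

/-! ### Reconstruction from the sketch -/

/-- `P` is the Moore–Penrose pseudoinverse of `M`. -/
def IsPseudoinverse {a b : ℕ} (M : Matrix (Fin a) (Fin b) ℝ) (P : Matrix (Fin b) (Fin a) ℝ) :
    Prop :=
  M * P * M = M ∧ P * M * P = P ∧ (M * P)ᵀ = M * P ∧ (P * M)ᵀ = P * M

/-- `C` is a best approximation of `B` of rank at most `r` in Frobenius norm. -/
def IsBestRankApprox {a b : ℕ} (r : ℕ) (B C : Matrix (Fin a) (Fin b) ℝ) : Prop :=
  C.rank ≤ r ∧ ∀ C' : Matrix (Fin a) (Fin b) ℝ, C'.rank ≤ r → ‖B - C‖ ≤ ‖B - C'‖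

/-- `Y = Q * R` is a reduced `QR` factorization: `Q` has orthonormal columns and `R` is upper
triangular (upper trapezoidal if `a < b`). -/
def IsQR {a b : ℕ} (Y : Matrix (Fin a) (Fin b) ℝ) (Q : Matrix (Fin a) (Fin (min a b)) ℝ)
    (R : Matrix (Fin (min a b)) (Fin b) ℝ) : Prop :=
  Qᵀ * Q = 1 ∧ (∀ (i : Fin (min a b)) (j : Fin b), (j : ℕ) < (i : ℕ) → R i j = 0) ∧ Y = Q * R

/-- A deterministic measurable routine that returns the factor `Q` of a reduced `QR`
factorization of every matrix. -/
def IsQRRoutine {a b : ℕ}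
    (qr : (Fin a → Fin b → ℝ) → Matrix (Fin a) (Fin (min a b)) ℝ) : Prop :=
  (∀ i j, Measurable fun Y => qr Y i j) ∧ ∀ Y, ∃ R, IsQR (Matrix.of Y) (qr Y) R

/-- `Xhat = Q [(Φ Q)† YR]_r`. -/
def IsReconstruction {m n c s : ℕ} (r : ℕ) (Q : Matrix (Fin m) (Fin c) ℝ)
    (Φ : Matrix (Fin s) (Fin m) ℝ) (YR : Matrix (Fin s) (Fin n) ℝ)
    (Xhat : Matrix (Fin m) (Fin n) ℝ) : Prop :=
  ∃ P B, IsPseudoinverse (Φ * Q) P ∧ IsBestRankApprox r (P * YR) B ∧ Xhat = Q * B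

/-! ### Randomness -/

/-- The σ-algebra generated by the starting point and by the sampled indices and oracle outputs of
the inner iterations in `S`. -/
@[reducible] def sigmaRun {Ω : Type*} {m n d : ℕ} (T : ℕ) (X₀ : Ω → Matrix (Fin m) (Fin n) ℝ)
    (ξ : ℕ → ℕ → ℕ → Ω → Fin d) (u : ℕ → ℕ → Ω → EuclideanSpace ℝ (Fin m))
    (v : ℕ → ℕ → Ω → EuclideanSpace ℝ (Fin n)) (S : Set (ℕ × ℕ)) : MeasurableSpace Ω :=
  (⨆ (i : Fin m) (j : Fin n), MeasurableSpace.comap (fun ω => X₀ ω i j) inferInstance) ⊔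
  ⨆ (p : ℕ × ℕ) (_ : p ∈ S ∧ IsStep T p.1 p.2),
    (MeasurableSpace.comap (u p.1 p.2) inferInstance ⊔
      MeasurableSpace.comap (v p.1 p.2) inferInstance ⊔
      ⨆ j : Fin (batchSize p.2), MeasurableSpace.comap (ξ p.1 p.2 j) inferInstance)

/-- The inner iterations that precede `(t, k)`. -/
def before (t k : ℕ) : Set (ℕ × ℕ) := {p | p.1 < t ∨ (p.1 = t ∧ p.2 < k)}

/-- The entries of the two test matrices, as one family of random variables. -/
def sketchEntry {Ω : Type*} {m n s q : ℕ} (Φ : Ω → Matrix (Fin s) (Fin m) ℝ)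
    (Ψ : Ω → Matrix (Fin n) (Fin q) ℝ) : (Fin s × Fin m) ⊕ (Fin n × Fin q) → Ω → ℝ :=
  Sum.elim (fun p ω => Φ ω p.1 p.2) (fun p ω => Ψ ω p.1 p.2)

/-- A run with `T` epochs of the sketched stochastic variance-reduced Frank–Wolfe method with
approximate oracle for minimizing `avg f (A X)` over `nuclearNorm X ≤ α`: starting point `X₀`,
sampled indices `ξ t k j`, oracle outputs `u t k`, `v t k`, test matrices `Φ`, `Ψ`, and
reconstructions `Xhat t`. -/
structure IsRun {Ω : Type*} [MeasurableSpace Ω] (μ : Measure Ω) {m n l d : ℕ}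
    (f : Fin d → EuclideanSpace ℝ (Fin l) → ℝ)
    (A : Matrix (Fin m) (Fin n) ℝ →ₗ[ℝ] EuclideanSpace ℝ (Fin l))
    (α L δ : ℝ) (r T : ℕ)
    (qr : (Fin m → Fin (2 * r + 1) → ℝ) → Matrix (Fin m) (Fin (min m (2 * r + 1))) ℝ)
    (X₀ : Ω → Matrix (Fin m) (Fin n) ℝ) (ξ : ℕ → ℕ → ℕ → Ω → Fin d)
    (u : ℕ → ℕ → Ω → EuclideanSpace ℝ (Fin m)) (v : ℕ → ℕ → Ω → EuclideanSpace ℝ (Fin n))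
    (Φ : Ω → Matrix (Fin (4 * r + 3)) (Fin m) ℝ) (Ψ : Ω → Matrix (Fin n) (Fin (2 * r + 1)) ℝ)
    (Xhat : ℕ → Ω → Matrix (Fin m) (Fin n) ℝ) : Prop where
  measurable_start : ∀ i j, Measurable fun ω => X₀ ω i j
  feasible_start : ∀ ω, nuclearNorm (X₀ ω) ≤ α
  /-- The sampled indices are uniform, the samples of one batch are independent, and the batch is
  independent of everything that happened before. -/
  measurable_sample : ∀ t k, IsStep T t k → ∀ j < batchSize k, Measurable (ξ t k j)
  uniform_sample : ∀ t k, IsStep T t k → ∀ j < batchSize k, ∀ i : Fin d,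
    μ.real {ω | ξ t k j ω = i} = 1 / (d : ℝ)
  indep_batch : ∀ t k, IsStep T t k → iIndepFun (fun j : Fin (batchSize k) => ξ t k j) μ
  indep_past : ∀ t k, IsStep T t k →
    Indep (⨆ j : Fin (batchSize k), MeasurableSpace.comap (ξ t k j) inferInstance)
      (sigmaRun T X₀ ξ u v (before t k)) μ
  /-- The oracle, queried at the dual iterate `z (k - 1)` with snapshot `z 0` of epoch `t`, returns
  a feasible point `-α u vᵀ` that minimizes the linear function given by the current stochastic
  gradient up to the tolerance. -/
  measurable_left : ∀ t k, IsStep T t k → Measurable (u t k)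
  measurable_right : ∀ t k, IsStep T t k → Measurable (v t k)
  feasible_oracle : ∀ t k, IsStep T t k → ∀ ω, ‖u t k ω‖ * ‖v t k ω‖ ≤ 1
  oracle : ∀ t k, IsStep T t k → ∀ ω,
    let z := iterate (A (X₀ ω)) (fun t k => A (atom α (u t k ω) (v t k ω))) t
    let G := adjointMap A (vrGrad f (batchSize k) (fun j => ξ t k j ω) (z (k - 1)) (z 0))
    ∀ X, nuclearNorm X ≤ α →
      (Gᵀ * atom α (u t k ω) (v t k ω)).trace ≤ (Gᵀ * X).trace + tol L α δ k
  /-- The test matrices have independent standard normal entries and are independent of the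
  samples and of the oracle. -/
  measurable_sketch : ∀ e, Measurable (sketchEntry Φ Ψ e)
  law_sketch : ∀ e, μ.map (sketchEntry Φ Ψ e) = gaussianReal 0 1
  indep_sketch : iIndepFun (sketchEntry Φ Ψ) μ
  indep_sketch_run : Indep
    (⨆ e, MeasurableSpace.comap (sketchEntry Φ Ψ e) inferInstance)
    (sigmaRun T X₀ ξ u v univ) μ
  /-- `Xhat t` is reconstructed from the two sketches at the end of epoch `t`. -/
  measurable_reconstruction : ∀ t, 1 ≤ t → t ≤ T → ∀ i j, AEMeasurable (fun ω => Xhat t ω i j) μ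
  reconstruction : ∀ t, 1 ≤ t → t ≤ T → ∀ ω,
    let YC := epochEnd (X₀ ω * Ψ ω) (fun t k => atom α (u t k ω) (v t k ω) * Ψ ω) t
    let YR := epochEnd (Φ ω * X₀ ω) (fun t k => Φ ω * atom α (u t k ω) (v t k ω)) t
    IsReconstruction r (qr YC) (Φ ω) YR (Xhat t ω)

end SSVRF

/-! The proof follows matrices X_{t,k} (`primal`) that the algorithm never stores: the update rule
applied to X₀ and the atoms. The update is an affine combination, so it commutes with linear maps
(`map_iterate`, `map_epochEnd`); thus z = 𝒜X, Y^C = XΨ and Y^R = ΦX throughout. The error of the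
reconstruction is then controlled by the distance of X_t to X⋆ and by the sketching error at X_t.

Optimization. Put D = 2α, which bounds the Frobenius diameter of the nuclear norm ball, and C =
LD²(1+δ). A Frank–Wolfe step with gradient error e turns a gap a into at most (1-γ)a + γ(ε + D‖e‖) +
Lγ²D²/2 (`avg_step_le`). The batch is independent of the past, so E‖e‖² is a variance divided by the
batch size (`integral_norm_sq_sample_mean`), and co-coercivity bounds that variance by 4L times the
sum of the expected gaps at the current point and at the snapshot. With the given parameters the
expected gap after k ≥ 1 steps of an epoch is at most 4C/(k+2). At the last step this is C/2^(t+1),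
exactly the quality of the snapshot that the next epoch needs (`IsRun.integral_gap_le`). The growth
condition and Jensen's inequality convert the gap into E‖X_t - X⋆‖
(`IsRun.integral_norm_primal_sub_le`).

Reconstruction, for a fixed X. Let G be Gaussian with q rows, S have p orthonormal columns and SᵀZ =
0. Then GS and GZ are independent and E‖(GS)†GZ‖² ≤ p/(q-p-1)·‖Z‖²
(`lintegral_norm_pinv_mul_sq_le`), because the norm of a row of the pseudoinverse is the inverse
distance of a column of GS to the span of the others, and the inverse square of such a distance has
mean 1/(q-p-1). With G = Ψᵀ and S a basis of the row space of X⋆ this gives E‖X - QQᵀX‖² ≤ 2‖X -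
X⋆‖²; with G = Φ and S = Q the sketch costs one more factor 2. So the untruncated approximation has
mean error at most 2‖X - X⋆‖.

Truncation is compared with X⋆, which has rank at most r. It doubles the sketching error and adds
2‖X - X⋆‖, whence 2·2 + 2 = 6. Since (Φ,Ψ) is independent of the run, X_t may be treated as fixed
(`IsRun.lintegral_norm_sub_le`). -/

namespace SSVRF

/-! ### The nuclear norm -/

section NuclearNorm

variable {ι : Type*} [Fintype ι] {E F : Type*} [NormedAddCommGroup E] [InnerProductSpace ℝ E]
  [NormedAddCommGroup F] [InnerProductSpace ℝ F]

/-- Bessel's inequality for orthogonal families of vectors of norm at most one. -/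
theorem sum_sq_inner_le_of_orthogonal {u : ι → F} (hu : ∀ i j, i ≠ j → inner ℝ (u i) (u j) = 0)
    (hu1 : ∀ i, ‖u i‖ ≤ 1) (x : F) : ∑ i, inner ℝ x (u i) ^ 2 ≤ ‖x‖ ^ 2 := by
  set S := ∑ i, inner ℝ x (u i) ^ 2 with hS
  set y := ∑ i, inner ℝ x (u i) • u i with hy
  have hxy : inner ℝ x y = S := by
    simp [hy, hS, inner_sum, real_inner_smul_right, sq]
  have hyy : ‖y‖ ^ 2 ≤ S := by
    have hi : ∀ i, inner ℝ (u i) y = inner ℝ x (u i) * ‖u i‖ ^ 2 := by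
      intro i
      rw [hy, inner_sum, Finset.sum_eq_single i]
      · rw [real_inner_smul_right, real_inner_self_eq_norm_sq]
      · intro j _ hj
        rw [real_inner_smul_right, hu i j hj.symm, mul_zero]
      · simp
    rw [← real_inner_self_eq_norm_sq]
    conv_lhs => rw [hy, sum_inner]
    refine Finset.sum_le_sum fun i _ => ?_
    rw [real_inner_smul_left, hi]
    have := pow_le_one₀ (n := 2) (norm_nonneg (u i)) (hu1 i)
    nlinarith [sq_nonneg (inner ℝ x (u i))]
  have hS0 : 0 ≤ S := Finset.sum_nonneg fun i _ => sq_nonneg _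
  have hcs := abs_real_inner_le_norm x y
  rw [hxy, abs_of_nonneg hS0] at hcs
  -- If S > ‖x‖², then S > 0, and S² ≤ ‖x‖²‖y‖² ≤ ‖x‖²S is a contradiction.
  by_contra! h
  have hpos : 0 < S := lt_of_le_of_lt (sq_nonneg _) h
  have h1 : S ^ 2 ≤ ‖x‖ ^ 2 * ‖y‖ ^ 2 := by
    rw [← mul_pow]; exact pow_le_pow_left₀ hS0 hcs 2
  nlinarith [sq_nonneg ‖x‖]

/-- The pairing of a linear map with an orthonormal basis and an orthogonal family is at most the
sum of the norms of the images of any orthonormal basis. -/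
theorem sum_inner_map_le {κ : Type*} [Fintype κ] (T : E →ₗ[ℝ] F) (v : OrthonormalBasis ι ℝ E)
    (w : OrthonormalBasis κ ℝ E) {u : ι → F} (hu : ∀ i j, i ≠ j → inner ℝ (u i) (u j) = 0)
    (hu1 : ∀ i, ‖u i‖ ≤ 1) : ∑ i, inner ℝ (T (v i)) (u i) ≤ ∑ j, ‖T (w j)‖ := by
  have h1 : ∀ i, inner ℝ (T (v i)) (u i) =
      ∑ j, inner ℝ (w j) (v i) * inner ℝ (T (w j)) (u i) := by
    intro i
    conv_lhs => rw [← w.sum_repr' (v i)]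
    simp [map_sum, sum_inner, real_inner_smul_left]
  simp_rw [h1]
  rw [Finset.sum_comm]
  refine Finset.sum_le_sum fun j _ => ?_
  refine (Real.sum_mul_le_sqrt_mul_sqrt _ _ _).trans ?_
  have h2 : ∑ i, inner ℝ (w j) (v i) ^ 2 = 1 := by
    have := v.sum_sq_norm_inner_left (w j)
    simpa using this
  rw [h2, Real.sqrt_one, one_mul]
  exact Real.sqrt_le_iff.mpr ⟨norm_nonneg _, sum_sq_inner_le_of_orthogonal hu hu1 _⟩

variable {m n : ℕ}

/-- The nuclear norm is the sum of the norms of the images of a right singular basis, whose images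
are orthogonal. -/
theorem exists_basis_nuclearNorm (X : Matrix (Fin m) (Fin n) ℝ) :
    ∃ v : OrthonormalBasis (Fin n) ℝ (EuclideanSpace ℝ (Fin n)),
      nuclearNorm X = ∑ i, ‖toLin X (v i)‖ ∧
      ∀ i j, i ≠ j → inner ℝ (toLin X (v i)) (toLin X (v j)) = 0 := by
  have hT := (toLin X).isSymmetric_adjoint_comp_self
  have hn : Module.finrank ℝ (EuclideanSpace ℝ (Fin n)) = n := by simp
  have hin : ∀ i j, inner ℝ (toLin X (hT.eigenvectorBasis hn i)) (toLin X (hT.eigenvectorBasis hn j))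
      = hT.eigenvalues hn j * inner ℝ (hT.eigenvectorBasis hn i) (hT.eigenvectorBasis hn j) := by
    intro i j
    rw [← LinearMap.adjoint_inner_right, ← LinearMap.comp_apply, hT.apply_eigenvectorBasis hn j,
      inner_smul_right]
    rfl
  refine ⟨hT.eigenvectorBasis hn, ?_, ?_⟩
  · have h1 : nuclearNorm X = ∑ i ∈ Finset.range n, (toLin X).singularValues i := by
      -- The added indices are at least m, hence beyond the rank, and their singular values vanish.
      refine Finset.sum_subset (Finset.range_subset_range.mpr (min_le_right _ _)) ?_
      intro i hi hi'
      rw [Finset.mem_range] at hi hi'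
      rw [LinearMap.singularValues_eq_zero_iff_le_finrank_range]
      have := (LinearMap.range (toLin X)).finrank_le
      rw [finrank_euclideanSpace_fin] at this
      omega
    rw [h1, Finset.sum_range]
    refine Finset.sum_congr rfl fun i _ => ?_
    rw [LinearMap.singularValues_fin _ hn i, Real.sqrt_eq_iff_mul_self_eq
      ((toLin X).isPositive_adjoint_comp_self.nonneg_eigenvalues hn i) (norm_nonneg _),
      ← real_inner_self_eq_norm_mul_norm, hin i i]
    simp
  · intro i j hij
    rw [hin, (hT.eigenvectorBasis hn).orthonormal.2 hij, mul_zero]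

/-- Normalizing the images of a right singular basis attains the bound of `sum_inner_map_le`.
Vanishing images stay zero, which is why the dual family is only orthogonal with norms at most one.
Together the two results write the nuclear norm as a maximum of functionals linear in the matrix, so
sublinearity follows. -/
theorem nuclearNorm_le_sum_norm (X : Matrix (Fin m) (Fin n) ℝ) :
    ∃ (v : OrthonormalBasis (Fin n) ℝ (EuclideanSpace ℝ (Fin n)))
      (u : Fin n → EuclideanSpace ℝ (Fin m)), (∀ i j, i ≠ j → inner ℝ (u i) (u j) = 0) ∧
      (∀ i, ‖u i‖ ≤ 1) ∧ nuclearNorm X = ∑ i, inner ℝ (toLin X (v i)) (u i) := by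
  obtain ⟨v, hv, hort⟩ := exists_basis_nuclearNorm X
  refine ⟨v, fun i => (‖toLin X (v i)‖)⁻¹ • toLin X (v i), ?_, ?_, ?_⟩
  · intro i j hij
    rw [real_inner_smul_left, real_inner_smul_right, hort i j hij, mul_zero, mul_zero]
  · intro i
    rw [norm_smul, norm_inv, norm_norm]
    exact inv_mul_le_one
  · rw [hv]
    refine Finset.sum_congr rfl fun i _ => ?_
    rw [real_inner_smul_right, real_inner_self_eq_norm_sq]
    by_cases h : ‖toLin X (v i)‖ = 0
    · simp [h]
    · field_simp

theorem nuclearNorm_add_le (X Y : Matrix (Fin m) (Fin n) ℝ) :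
    nuclearNorm (X + Y) ≤ nuclearNorm X + nuclearNorm Y := by
  obtain ⟨v, u, hu, hu1, h⟩ := nuclearNorm_le_sum_norm (X + Y)
  obtain ⟨vX, hX, -⟩ := exists_basis_nuclearNorm X
  obtain ⟨vY, hY, -⟩ := exists_basis_nuclearNorm Y
  have hadd : toLin (X + Y) = toLin X + toLin Y := by simp [toLin]
  rw [h, hX, hY]
  simp only [hadd, LinearMap.add_apply, inner_add_left, Finset.sum_add_distrib]
  exact add_le_add (sum_inner_map_le _ v vX hu hu1) (sum_inner_map_le _ v vY hu hu1)

theorem nuclearNorm_smul_le {c : ℝ} (hc : 0 ≤ c) (X : Matrix (Fin m) (Fin n) ℝ) :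
    nuclearNorm (c • X) ≤ c * nuclearNorm X := by
  obtain ⟨v, u, hu, hu1, h⟩ := nuclearNorm_le_sum_norm (c • X)
  obtain ⟨vX, hX, -⟩ := exists_basis_nuclearNorm X
  have hs : toLin (c • X) = c • toLin X := by simp [toLin]
  rw [h, hX]
  simp only [hs, LinearMap.smul_apply, real_inner_smul_left, ← Finset.mul_sum]
  exact mul_le_mul_of_nonneg_left (sum_inner_map_le _ v vX hu hu1) hc

theorem nuclearNorm_convex_combination_le {X Y : Matrix (Fin m) (Fin n) ℝ} {α c : ℝ}
    (hX : nuclearNorm X ≤ α) (hY : nuclearNorm Y ≤ α) (hc0 : 0 ≤ c) (hc1 : c ≤ 1) :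
    nuclearNorm ((1 - c) • X + c • Y) ≤ α := by
  refine (nuclearNorm_add_le _ _).trans ?_
  have h1 := nuclearNorm_smul_le (sub_nonneg.mpr hc1) X
  have h2 := nuclearNorm_smul_le hc0 Y
  nlinarith

/-- In the dual formula the atom contributes -α ∑ ⟨v, bᵢ⟩⟨u, wᵢ⟩. Cauchy–Schwarz, with Parseval for
v and Bessel for u, bounds the sum by ‖u‖‖v‖. -/
theorem nuclearNorm_atom_le {α : ℝ} (hα : 0 ≤ α) {u : EuclideanSpace ℝ (Fin m)}
    {v : EuclideanSpace ℝ (Fin n)} (huv : ‖u‖ * ‖v‖ ≤ 1) : nuclearNorm (atom α u v) ≤ α := by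
  obtain ⟨b, w, hw, hw1, h⟩ := nuclearNorm_le_sum_norm (atom α u v)
  have hap : ∀ x, toLin (atom α u v) x = (-(α * inner ℝ v x)) • u := by
    intro x
    ext i
    simp only [toLin, atom, Matrix.toLpLin_apply, Matrix.neg_mulVec, Matrix.smul_mulVec,
      Matrix.vecMulVec_mulVec]
    simp [EuclideanSpace.inner_eq_star_dotProduct, dotProduct_comm]
    ring
  have hterm : ∀ i, inner ℝ (toLin (atom α u v) (b i)) (w i) =
      (-α) * (inner ℝ v (b i) * inner ℝ u (w i)) := by
    intro i
    rw [hap, real_inner_smul_left]; ring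
  simp_rw [hterm, ← Finset.mul_sum] at h
  have hcs : |∑ i, inner ℝ v (b i) * inner ℝ u (w i)| ≤ 1 := by
    have h1 : (∑ i, inner ℝ v (b i) * inner ℝ u (w i)) ^ 2 ≤ (‖u‖ * ‖v‖) ^ 2 := by
      refine (Finset.sum_mul_sq_le_sq_mul_sq _ _ _).trans ?_
      have h2 : ∑ i, inner ℝ v (b i) ^ 2 = ‖v‖ ^ 2 := by
        have := b.sum_sq_norm_inner_left v
        simpa using this
      have h3 := sum_sq_inner_le_of_orthogonal hw hw1 u
      rw [h2]
      nlinarith [sq_nonneg ‖v‖]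
    exact (abs_le_of_sq_le_sq h1 (by positivity)).trans huv |> fun h => by simpa using h
  rw [h]
  have := abs_le.mp hcs
  nlinarith

theorem frobenius_norm_sq (X : Matrix (Fin m) (Fin n) ℝ) : ‖X‖ ^ 2 = ∑ i, ∑ j, X i j ^ 2 := by
  rw [Matrix.frobenius_norm_def]
  rw [← Real.sqrt_eq_rpow, Real.sq_sqrt (by positivity)]
  simp

theorem frobenius_norm_sq_eq_sum (X : Matrix (Fin m) (Fin n) ℝ)
    (v : OrthonormalBasis (Fin n) ℝ (EuclideanSpace ℝ (Fin n))) :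
    ‖X‖ ^ 2 = ∑ i, ‖toLin X (v i)‖ ^ 2 := by
  rw [frobenius_norm_sq]
  have h1 : ∀ i, ‖toLin X (v i)‖ ^ 2 = ∑ a : Fin m, inner ℝ (WithLp.toLp 2 (X a)) (v i) ^ 2 := by
    intro i
    rw [EuclideanSpace.norm_sq_eq]
    refine Finset.sum_congr rfl fun a _ => ?_
    simp [toLin, Matrix.toLpLin_apply, Matrix.mulVec, EuclideanSpace.inner_eq_star_dotProduct,
      dotProduct_comm]
  simp_rw [h1]
  conv_rhs => rw [Finset.sum_comm]
  refine Finset.sum_congr rfl fun a _ => ?_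
  have := v.sum_sq_norm_inner_left (WithLp.toLp 2 (X a))
  simp only [Real.norm_eq_abs, sq_abs] at this
  rw [this, EuclideanSpace.norm_sq_eq]
  simp

/-- Both norms are read off from a right singular basis, as the ℓ² and the ℓ¹ norm of the lengths of
the images. This yields the diameter bound 2α. -/
theorem norm_le_nuclearNorm (X : Matrix (Fin m) (Fin n) ℝ) : ‖X‖ ≤ nuclearNorm X := by
  obtain ⟨v, hv, -⟩ := exists_basis_nuclearNorm X
  have h0 : 0 ≤ nuclearNorm X := by rw [hv]; positivity
  refine abs_le_of_sq_le_sq' ?_ h0 |>.2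
  rw [frobenius_norm_sq_eq_sum X v, hv]
  exact Finset.sum_sq_le_sq_sum_of_nonneg fun i _ => norm_nonneg _

theorem norm_sub_le_of_nuclearNorm_le {X Y : Matrix (Fin m) (Fin n) ℝ} {α : ℝ}
    (hX : nuclearNorm X ≤ α) (hY : nuclearNorm Y ≤ α) : ‖X - Y‖ ≤ 2 * α := by
  have h1 := norm_le_nuclearNorm X
  have h2 := norm_le_nuclearNorm Y
  linarith [norm_sub_le X Y]

end NuclearNorm

/-! ### Smooth convex functions -/

section Smooth

variable {E : Type*} [NormedAddCommGroup E] [InnerProductSpace ℝ E] [CompleteSpace E]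
  {F : E → ℝ} {L : ℝ}

theorem hasDerivAt_comp_line (hF : Differentiable ℝ F) (x d : E) (s : ℝ) :
    HasDerivAt (fun s : ℝ => F (x + s • d)) (inner ℝ (∇ F (x + s • d)) d) s := by
  have h1 : HasDerivAt (fun s : ℝ => x + s • d) d s := by
    simpa using ((hasDerivAt_id s).smul_const d).const_add x
  have h2 := (hF (x + s • d)).hasGradientAt.hasFDerivAt.comp_hasDerivAt s h1
  rw [InnerProductSpace.toDual_apply_apply] at h2
  exact h2

/-- The quadratic upper bound for functions with Lipschitz gradient. -/
theorem le_add_inner_gradient_add_sq (hF : Differentiable ℝ F)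
    (hL : ∀ x y, ‖∇ F x - ∇ F y‖ ≤ L * ‖x - y‖) (x y : E) :
    F y ≤ F x + inner ℝ (∇ F x) (y - x) + L / 2 * ‖y - x‖ ^ 2 := by
  set d := y - x with hd
  -- Up to a constant, g is F along the segment minus its quadratic majorant; the claim is g 1 ≤ g
  -- 0.
  let g : ℝ → ℝ := fun s => F (x + s • d) - s * inner ℝ (∇ F x) d - L / 2 * ‖d‖ ^ 2 * s ^ 2
  have hg : ∀ s, HasDerivAt g (inner ℝ (∇ F (x + s • d)) d - inner ℝ (∇ F x) d
      - L / 2 * ‖d‖ ^ 2 * (2 * s)) s := by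
    intro s
    have h2 := (hasDerivAt_id s).mul_const (inner ℝ (∇ F x) d)
    have h3 := (hasDerivAt_pow 2 s).const_mul (L / 2 * ‖d‖ ^ 2)
    have h4 := ((hasDerivAt_comp_line hF x d s).sub h2).sub h3
    rw [one_mul, Nat.cast_ofNat, Nat.add_one_sub_one, pow_one] at h4
    exact h4
  have hanti : AntitoneOn g (Icc 0 1) := by
    refine antitoneOn_of_deriv_nonpos (convex_Icc 0 1)
      (fun s _ => (hg s).continuousAt.continuousWithinAt)
      (fun s _ => (hg s).differentiableAt.differentiableWithinAt) ?_
    intro s hs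
    rw [interior_Icc] at hs
    rw [(hg s).deriv, ← inner_sub_left]
    have h1 := real_inner_le_norm (∇ F (x + s • d) - ∇ F x) d
    have h2 := hL (x + s • d) x
    rw [add_sub_cancel_left, norm_smul, Real.norm_of_nonneg hs.1.le] at h2
    have h3 := mul_le_mul_of_nonneg_right h2 (norm_nonneg d)
    nlinarith
  have h := hanti (left_mem_Icc.mpr zero_le_one) (right_mem_Icc.mpr zero_le_one) zero_le_one
  simp only [g, hd, one_smul, add_sub_cancel, zero_smul, add_zero] at h
  linarith

theorem add_inner_gradient_le (hF : Differentiable ℝ F) (hc : ConvexOn ℝ univ F) (x y : E) :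
    F x + inner ℝ (∇ F x) (y - x) ≤ F y := by
  have hg : ConvexOn ℝ univ (fun s : ℝ => F (x + s • (y - x))) := by
    have := hc.comp_affineMap (AffineMap.lineMap x y : ℝ →ᵃ[ℝ] E)
    rw [preimage_univ] at this
    refine this.congr fun s _ => ?_
    simp [AffineMap.lineMap_apply, add_comm]
  have h := hg.le_slope_of_hasDerivAt (mem_univ 0) (mem_univ 1) zero_lt_one
    (hasDerivAt_comp_line hF x (y - x) 0)
  rw [slope_def_field, zero_smul, one_smul, add_zero, add_sub_cancel, sub_zero, div_one] at h
  linarith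

/-- Co-coercivity of the gradient of a smooth convex function. -/
theorem norm_gradient_sub_sq_le (hF : Differentiable ℝ F) (hc : ConvexOn ℝ univ F) (hL0 : 0 ≤ L)
    (hL : ∀ x y, ‖∇ F x - ∇ F y‖ ≤ L * ‖x - y‖) (x y : E) :
    ‖∇ F x - ∇ F y‖ ^ 2 ≤ 2 * L * (F x - F y - inner ℝ (∇ F y) (x - y)) := by
  set g := ∇ F x - ∇ F y with hg
  rcases hL0.eq_or_lt with h0 | hpos
  · have := hL x y
    rw [← h0, zero_mul] at this
    rw [← h0, le_antisymm this (norm_nonneg _)]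
    simp
  -- The quadratic upper bound from x and the tangent lower bound from y are compared at one point:
  -- the step of length 1/L from x along -g, which is the best choice for the upper bound.
  have h1 := le_add_inner_gradient_add_sq hF hL x (x - (1 / L) • g)
  have h2 := add_inner_gradient_le hF hc y (x - (1 / L) • g)
  have e1 : x - (1 / L) • g - x = -((1 / L) • g) := by abel
  have e2 : x - (1 / L) • g - y = (x - y) - (1 / L) • g := by abel
  rw [e1, norm_neg, norm_smul, inner_neg_right, real_inner_smul_right, Real.norm_of_nonneg
    (by positivity)] at h1
  rw [e2, inner_sub_right, real_inner_smul_right] at h2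
  have h3 : inner ℝ (∇ F x) g - inner ℝ (∇ F y) g = ‖g‖ ^ 2 := by
    rw [← inner_sub_left, ← hg, real_inner_self_eq_norm_sq]
  have h4 : L / 2 * (1 / L * ‖g‖) ^ 2 = 1 / L * ‖g‖ ^ 2 / 2 := by field_simp
  have h5 : 1 / L * ‖g‖ ^ 2 / 2 ≤ F x - F y - inner ℝ (∇ F y) (x - y) := by
    rw [h4] at h1
    have : 1 / L * inner ℝ (∇ F x) g - 1 / L * inner ℝ (∇ F y) g = 1 / L * ‖g‖ ^ 2 := by
      rw [← mul_sub, h3]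
    linarith
  calc ‖g‖ ^ 2 = 2 * L * (1 / L * ‖g‖ ^ 2 / 2) := by field_simp
    _ ≤ _ := by gcongr

end Smooth

/-! ### Sampling independently of the past -/

section Sampling

variable {Ω : Type*} {𝓜 : MeasurableSpace Ω} {mΩ : MeasurableSpace Ω} {μ : Measure Ω}
  [IsProbabilityMeasure μ]

/-- The expectation of a random function of an independent index with finitely many values. -/
theorem integral_comp_index {κ : Type*} [Fintype κ] [MeasurableSpace κ]
    [MeasurableSingletonClass κ] {K : Ω → κ}
    (hK : Measurable K) (hind : Indep (MeasurableSpace.comap K inferInstance) 𝓜 μ)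
    {φ : κ → Ω → ℝ} (hφ : ∀ k, Measurable[𝓜] (φ k)) (hφi : ∀ k, Integrable (φ k) μ) :
    Integrable (fun ω => φ (K ω) ω) μ ∧
      ∫ ω, φ (K ω) ω ∂μ = ∑ k, μ.real {ω | K ω = k} * ∫ ω, φ k ω ∂μ := by
  classical
  have hset : ∀ k, MeasurableSet {ω | K ω = k} := fun k => hK (measurableSet_singleton k)
  have hdecomp : (fun ω => φ (K ω) ω) =
      fun ω => ∑ k, ({ω | K ω = k}.indicator (fun _ => (1 : ℝ)) * φ k) ω := by
    ext ω
    rw [Finset.sum_eq_single (K ω)]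
    · simp
    · intro k _ hk
      simp [Set.indicator, hk.symm]
    · simp
  have hterm : ∀ k, Integrable ({ω | K ω = k}.indicator (fun _ => (1 : ℝ)) * φ k) μ ∧
      ∫ ω, ({ω | K ω = k}.indicator (fun _ => (1 : ℝ)) * φ k) ω ∂μ =
        μ.real {ω | K ω = k} * ∫ ω, φ k ω ∂μ := by
    intro k
    have hm : Measurable[MeasurableSpace.comap K inferInstance]
        ({ω | K ω = k}.indicator (fun _ => (1 : ℝ))) :=
      Measurable.indicator measurable_const ⟨{k}, measurableSet_singleton k, rfl⟩
    have hI : IndepFun ({ω | K ω = k}.indicator (fun _ => (1 : ℝ))) (φ k) μ :=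
      indep_of_indep_of_le_left (indep_of_indep_of_le_right hind (hφ k).comap_le) hm.comap_le
    have h1 : Integrable ({ω | K ω = k}.indicator (fun _ => (1 : ℝ))) μ :=
      (integrable_const 1).indicator (hset k)
    refine ⟨hI.integrable_mul h1 (hφi k), ?_⟩
    rw [hI.integral_mul_eq_mul_integral h1.aestronglyMeasurable (hφi k).aestronglyMeasurable,
      integral_indicator_const _ (hset k), smul_eq_mul, mul_one]
  rw [hdecomp]
  refine ⟨integrable_finsetSum _ fun k _ => (hterm k).1, ?_⟩
  rw [integral_finsetSum _ fun k _ => (hterm k).1]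
  exact Finset.sum_congr rfl fun k _ => (hterm k).2

/-- The mean square of the average of independent uniform samples from a centered family. -/
theorem integral_norm_sq_sample_mean {E : Type*} [NormedAddCommGroup E] [InnerProductSpace ℝ E]
    [MeasurableSpace E] [BorelSpace E] [SecondCountableTopology E] {M d : ℕ} (hM : 0 < M)
    (h𝓜 : 𝓜 ≤ mΩ) {ξ : Fin M → Ω → Fin d}
    (hξ : ∀ j, Measurable (ξ j)) (hunif : ∀ j i, μ.real {ω | ξ j ω = i} = 1 / (d : ℝ))
    (hiind : iIndepFun ξ μ)
    (hpast : Indep (⨆ j, MeasurableSpace.comap (ξ j) inferInstance) 𝓜 μ)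
    {g : Fin d → Ω → E} (hg : ∀ i, Measurable[𝓜] (g i)) {B : ℝ} (hB : ∀ i ω, ‖g i ω‖ ≤ B)
    (hsum : ∀ ω, ∑ i, g i ω = 0) :
    Integrable (fun ω => ‖(1 / (M : ℝ)) • ∑ j, g (ξ j ω) ω‖ ^ 2) μ ∧
    ∫ ω, ‖(1 / (M : ℝ)) • ∑ j, g (ξ j ω) ω‖ ^ 2 ∂μ =
      1 / (M : ℝ) * ∫ ω, 1 / (d : ℝ) * ∑ i, ‖g i ω‖ ^ 2 ∂μ := by
  have hmeas : ∀ i i', Measurable[𝓜] fun ω => inner ℝ (g i ω) (g i' ω) :=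
    fun i i' => Measurable.inner (hg i) (hg i')
  have hint : ∀ i i', Integrable (fun ω => inner ℝ (g i ω) (g i' ω)) μ := by
    intro i i'
    refine Integrable.of_bound ((hmeas i i').mono h𝓜 le_rfl).aestronglyMeasurable (B * B)
      (Filter.Eventually.of_forall fun ω => ?_)
    exact (norm_inner_le_norm _ _).trans (mul_le_mul (hB i ω) (hB i' ω) (norm_nonneg _)
      ((norm_nonneg _).trans (hB i ω)))
  have hterm : ∀ j j', Integrable (fun ω => inner ℝ (g (ξ j ω) ω) (g (ξ j' ω) ω)) μ ∧
      ∫ ω, inner ℝ (g (ξ j ω) ω) (g (ξ j' ω) ω) ∂μ =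
        if j = j' then ∫ ω, 1 / (d : ℝ) * ∑ i, ‖g i ω‖ ^ 2 ∂μ else 0 := by
    intro j j'
    by_cases hj : j = j'
    · subst hj
      have h := integral_comp_index (hξ j) (indep_of_indep_of_le_left hpast
        (le_iSup (fun j => MeasurableSpace.comap (ξ j) inferInstance) j))
        (φ := fun i ω => inner ℝ (g i ω) (g i ω)) (fun i => hmeas i i) (fun i => hint i i)
      refine ⟨h.1, ?_⟩
      rw [if_pos rfl, h.2, integral_const_mul, integral_finsetSum, Finset.mul_sum]
      · simp only [hunif, real_inner_self_eq_norm_sq]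
      · intro i _
        simpa only [real_inner_self_eq_norm_sq] using hint i i
    · rw [if_neg hj]
      have hle : MeasurableSpace.comap (fun ω => (ξ j ω, ξ j' ω)) inferInstance ≤
          ⨆ j, MeasurableSpace.comap (ξ j) inferInstance := by
        refine Measurable.comap_le (Measurable.prodMk ?_ ?_)
        · exact measurable_iff_comap_le.mpr
            (le_iSup (fun j => MeasurableSpace.comap (ξ j) inferInstance) j)
        · exact measurable_iff_comap_le.mpr
            (le_iSup (fun j => MeasurableSpace.comap (ξ j) inferInstance) j')
      have h := integral_comp_index ((hξ j).prodMk (hξ j'))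
        (indep_of_indep_of_le_left hpast hle)
        (φ := fun p ω => inner ℝ (g p.1 ω) (g p.2 ω)) (fun p => hmeas p.1 p.2)
        (fun p => hint p.1 p.2)
      refine ⟨h.1, h.2.trans ?_⟩
      have hprob : ∀ p : Fin d × Fin d, μ.real {ω | (ξ j ω, ξ j' ω) = p} =
          1 / (d : ℝ) * (1 / (d : ℝ)) := by
        intro p
        have h1 := (hiind.indepFun hj).measure_inter_preimage_eq_mul {p.1} {p.2}
          (measurableSet_singleton _) (measurableSet_singleton _)
        have h2 : {ω | (ξ j ω, ξ j' ω) = p} = ξ j ⁻¹' {p.1} ∩ ξ j' ⁻¹' {p.2} := by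
          ext ω; simp [Prod.ext_iff]
        rw [measureReal_def, h2, h1, ENNReal.toReal_mul]
        exact congrArg₂ _ (hunif j p.1) (hunif j' p.2)
      simp_rw [hprob]
      rw [← Finset.mul_sum, ← integral_finsetSum _ fun p _ => hint p.1 p.2]
      -- For distinct samples the pair of indices is uniform on all pairs, so the cross term is a
      -- multiple of the integral of ‖∑ᵢ gᵢ‖², which is zero for a centered family.
      have h0 : ∀ ω, ∑ p : Fin d × Fin d, inner ℝ (g p.1 ω) (g p.2 ω) = 0 := by
        intro ω
        rw [Fintype.sum_prod_type]
        simp only [← inner_sum, hsum, inner_zero_right, Finset.sum_const_zero]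
      simp [h0]
  have hexp : (fun ω => ‖(1 / (M : ℝ)) • ∑ j, g (ξ j ω) ω‖ ^ 2) = fun ω =>
      (1 / (M : ℝ)) ^ 2 * ∑ j, ∑ j', inner ℝ (g (ξ j ω) ω) (g (ξ j' ω) ω) := by
    ext ω
    rw [norm_smul, mul_pow, ← real_inner_self_eq_norm_sq (∑ j, g (ξ j ω) ω), sum_inner]
    simp only [inner_sum, Real.norm_eq_abs, sq_abs]
  rw [hexp]
  have hi2 : ∀ j, Integrable (fun ω => ∑ j', inner ℝ (g (ξ j ω) ω) (g (ξ j' ω) ω)) μ :=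
    fun j => integrable_finsetSum _ fun j' _ => (hterm j j').1
  refine ⟨(integrable_finsetSum _ fun j _ => hi2 j).const_mul _, ?_⟩
  rw [integral_const_mul, integral_finsetSum _ fun j _ => hi2 j]
  have h3 : ∀ j, ∫ ω, ∑ j', inner ℝ (g (ξ j ω) ω) (g (ξ j' ω) ω) ∂μ =
      ∫ ω, 1 / (d : ℝ) * ∑ i, ‖g i ω‖ ^ 2 ∂μ := by
    intro j
    rw [integral_finsetSum _ fun j' _ => (hterm j j').1]
    simp [(hterm j _).2]
  have hM' : (M : ℝ) ≠ 0 := by positivity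
  simp_rw [h3]
  rw [Finset.sum_const, Finset.card_univ, Fintype.card_fin, nsmul_eq_mul]
  field_simp

/-- Nonnegativity of the variance: (E f)² ≤ E f². -/
theorem integral_le_of_integral_sq_le {f : Ω → ℝ} (hf : AEStronglyMeasurable f μ)
    (hf2 : Integrable (fun ω => f ω ^ 2) μ) {b : ℝ} (hb : 0 ≤ b)
    (h : ∫ ω, f ω ^ 2 ∂μ ≤ b ^ 2) : Integrable f μ ∧ ∫ ω, f ω ∂μ ≤ b := by
  have hm : MemLp f 2 μ := (memLp_two_iff_integrable_sq hf).mpr hf2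
  refine ⟨hm.integrable one_le_two, ?_⟩
  have hv := variance_nonneg f μ
  rw [variance_eq_sub hm] at hv
  refine (abs_le_of_sq_le_sq' ?_ hb).2
  have : ∫ ω, (f ^ 2) ω ∂μ = ∫ ω, f ω ^ 2 ∂μ := rfl
  linarith

end Sampling

/-! ### One step of the variance-reduced method -/

section Step

variable {E : Type*} [NormedAddCommGroup E] [InnerProductSpace ℝ E] {d : ℕ}
  {F : Fin d → E → ℝ} {L : ℝ}

theorem differentiable_avg (hF : ∀ i, Differentiable ℝ (F i)) : Differentiable ℝ (avg F) := by
  unfold avg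
  exact (Differentiable.fun_sum fun i _ => hF i).const_mul _

theorem convexOn_avg (hc : ∀ i, ConvexOn ℝ univ (F i)) : ConvexOn ℝ univ (avg F) := by
  refine ⟨convex_univ, fun x _ y _ a b ha hb hab => ?_⟩
  simp only [avg, smul_eq_mul]
  have h : ∑ i, F i (a • x + b • y) ≤ ∑ i, (a * F i x + b * F i y) :=
    Finset.sum_le_sum fun i _ => (hc i).2 (mem_univ x) (mem_univ y) ha hb hab
  rw [Finset.sum_add_distrib, ← Finset.mul_sum, ← Finset.mul_sum] at h
  have := mul_le_mul_of_nonneg_left h (show 0 ≤ 1 / (d : ℝ) by positivity)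
  linarith

/-- The centered mean square is at most the mean square. -/
theorem sum_norm_sub_mean_sq_le (hd : 0 < d) (a : Fin d → E) :
    ∑ i, ‖a i - (1 / (d : ℝ)) • ∑ j, a j‖ ^ 2 ≤ ∑ i, ‖a i‖ ^ 2 := by
  have hd' : (0 : ℝ) < d := by exact_mod_cast hd
  set b := (1 / (d : ℝ)) • ∑ j, a j with hb
  have hsum : ∑ i, a i = (d : ℝ) • b := by
    rw [hb, smul_smul, mul_one_div_cancel hd'.ne', one_smul]
  have h : ∑ i, ‖a i - b‖ ^ 2 = ∑ i, ‖a i‖ ^ 2 - d * ‖b‖ ^ 2 := by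
    simp only [norm_sub_sq_real, Finset.sum_add_distrib, Finset.sum_sub_distrib, ← Finset.mul_sum,
      ← sum_inner, hsum, real_inner_smul_left, real_inner_self_eq_norm_sq, Finset.sum_const,
      Finset.card_univ, Fintype.card_fin, nsmul_eq_mul]
    ring
  rw [h]
  have : 0 ≤ d * ‖b‖ ^ 2 := by positivity
  linarith

variable [CompleteSpace E]

theorem gradient_avg (hF : ∀ i, Differentiable ℝ (F i)) (x : E) :
    ∇ (avg F) x = (1 / (d : ℝ)) • ∑ i, ∇ (F i) x := by
  refine HasGradientAt.gradient ?_
  rw [hasGradientAt_iff_hasFDerivAt]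
  have h : HasFDerivAt (fun z => ∑ i, F i z) (∑ i, fderiv ℝ (F i) x) x :=
    HasFDerivAt.fun_sum fun i _ => (hF i x).hasFDerivAt
  have h' := h.const_mul (1 / (d : ℝ))
  have e : InnerProductSpace.toDual ℝ E ((1 / (d : ℝ)) • ∑ i, ∇ (F i) x) =
      (1 / (d : ℝ)) • ∑ i, fderiv ℝ (F i) x := by
    ext y
    simp
  rw [e]
  exact h'

theorem norm_gradient_avg_sub_le (hd : 0 < d) (hF : ∀ i, Differentiable ℝ (F i))
    (hL : ∀ i x y, ‖∇ (F i) x - ∇ (F i) y‖ ≤ L * ‖x - y‖) (x y : E) :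
    ‖∇ (avg F) x - ∇ (avg F) y‖ ≤ L * ‖x - y‖ := by
  have hd' : (0 : ℝ) < d := by exact_mod_cast hd
  rw [gradient_avg hF, gradient_avg hF, ← smul_sub, ← Finset.sum_sub_distrib, norm_smul,
    Real.norm_of_nonneg (by positivity)]
  have h : ‖∑ i, (∇ (F i) x - ∇ (F i) y)‖ ≤ ∑ _i : Fin d, L * ‖x - y‖ :=
    norm_sum_le_of_le _ fun i _ => hL i x y
  rw [Finset.sum_const, Finset.card_univ, Fintype.card_fin, nsmul_eq_mul] at h
  calc 1 / (d : ℝ) * _ ≤ 1 / (d : ℝ) * (d * (L * ‖x - y‖)) := by gcongr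
    _ = L * ‖x - y‖ := by field_simp

/-- First-order optimality over a convex set. -/
theorem inner_gradient_nonneg_of_isMin {G : E → ℝ} (hG : Differentiable ℝ G)
    (hL : ∀ x y, ‖∇ G x - ∇ G y‖ ≤ L * ‖x - y‖) {K : Set E} (hK : Convex ℝ K) {xs : E}
    (hxs : xs ∈ K) (hmin : ∀ x ∈ K, G xs ≤ G x) {x : E} (hx : x ∈ K) :
    0 ≤ inner ℝ (∇ G xs) (x - xs) := by
  have hs : ∀ s ∈ Ioc (0 : ℝ) 1, 0 ≤ inner ℝ (∇ G xs) (x - xs) + L / 2 * ‖x - xs‖ ^ 2 * s := by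
    intro s hs
    have h1 := le_add_inner_gradient_add_sq hG hL xs (xs + s • (x - xs))
    have h2 := hmin _ (hK.add_smul_sub_mem hxs hx ⟨hs.1.le, hs.2⟩)
    rw [add_sub_cancel_left, real_inner_smul_right, norm_smul, Real.norm_of_nonneg hs.1.le] at h1
    have h3 : 0 ≤ s * (inner ℝ (∇ G xs) (x - xs) + L / 2 * ‖x - xs‖ ^ 2 * s) := by nlinarith
    exact nonneg_of_mul_nonneg_right h3 hs.1
  have hlim : Filter.Tendsto (fun s : ℝ => inner ℝ (∇ G xs) (x - xs) + L / 2 * ‖x - xs‖ ^ 2 * s)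
      (nhdsWithin 0 (Ioi 0)) (nhds (inner ℝ (∇ G xs) (x - xs) + L / 2 * ‖x - xs‖ ^ 2 * 0)) :=
    (Continuous.tendsto (by fun_prop) 0).mono_left nhdsWithin_le_nhds
  rw [mul_zero, add_zero] at hlim
  refine ge_of_tendsto hlim ?_
  filter_upwards [Ioc_mem_nhdsGT zero_lt_one] with s hs' using hs s hs'

/-- Averaging co-coercivity over i leaves the linear term ⟨∇(avg F)(xs), x - xs⟩, which first-order
optimality makes nonnegative. Individual gradients need not vanish at the minimizer, yet their
deviations there are controlled by the gap alone; this is what reduces the variance. -/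
theorem mean_norm_gradient_sub_sq_le (hd : 0 < d) (hF : ∀ i, Differentiable ℝ (F i))
    (hc : ∀ i, ConvexOn ℝ univ (F i)) (hL0 : 0 ≤ L)
    (hL : ∀ i x y, ‖∇ (F i) x - ∇ (F i) y‖ ≤ L * ‖x - y‖) {K : Set E} (hK : Convex ℝ K) {xs : E}
    (hxs : xs ∈ K) (hmin : ∀ x ∈ K, avg F xs ≤ avg F x) {x : E} (hx : x ∈ K) :
    1 / (d : ℝ) * ∑ i, ‖∇ (F i) x - ∇ (F i) xs‖ ^ 2 ≤ 2 * L * (avg F x - avg F xs) := by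
  have hd' : (0 : ℝ) < d := by exact_mod_cast hd
  have h1 : ∑ i, ‖∇ (F i) x - ∇ (F i) xs‖ ^ 2 ≤
      ∑ i, 2 * L * (F i x - F i xs - inner ℝ (∇ (F i) xs) (x - xs)) :=
    Finset.sum_le_sum fun i _ => norm_gradient_sub_sq_le (hF i) (hc i) hL0 (hL i) x xs
  have h2 := inner_gradient_nonneg_of_isMin (differentiable_avg hF)
    (norm_gradient_avg_sub_le hd hF hL) hK hxs hmin hx
  rw [gradient_avg hF, real_inner_smul_left, sum_inner] at h2
  rw [← Finset.mul_sum, Finset.sum_sub_distrib, Finset.sum_sub_distrib] at h1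
  calc _ ≤ 1 / (d : ℝ) * _ := mul_le_mul_of_nonneg_left h1 (by positivity)
    _ = 2 * L * (avg F x - avg F xs - 1 / (d : ℝ) * ∑ i, inner ℝ (∇ (F i) xs) (x - xs)) := by
      simp only [avg]; ring
    _ ≤ _ := by
      have : 0 ≤ 2 * L * (1 / (d : ℝ) * ∑ i, inner ℝ (∇ (F i) xs) (x - xs)) := by positivity
      linarith

/-- One Frank–Wolfe step with an inexact gradient `g` and an inexact oracle. -/
theorem avg_step_le (hd : 0 < d) (hF : ∀ i, Differentiable ℝ (F i))
    (hc : ∀ i, ConvexOn ℝ univ (F i)) (hL0 : 0 ≤ L)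
    (hL : ∀ i x y, ‖∇ (F i) x - ∇ (F i) y‖ ≤ L * ‖x - y‖) {x s xs g : E} {D γ ε : ℝ}
    (hγ : 0 ≤ γ) (hsx : ‖s - x‖ ≤ D) (hsxs : ‖xs - s‖ ≤ D)
    (horacle : inner ℝ g s ≤ inner ℝ g xs + ε) :
    avg F ((1 - γ) • x + γ • s) - avg F xs ≤
      (1 - γ) * (avg F x - avg F xs) + γ * (ε + D * ‖g - ∇ (avg F) x‖) + L * γ ^ 2 * D ^ 2 / 2 := by
  have h1 := le_add_inner_gradient_add_sq (differentiable_avg hF)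
    (norm_gradient_avg_sub_le hd hF hL) x ((1 - γ) • x + γ • s)
  have h2 := add_inner_gradient_le (differentiable_avg hF) (convexOn_avg hc) x xs
  have e : (1 - γ) • x + γ • s - x = γ • (s - x) := by module
  rw [e, real_inner_smul_right, norm_smul, Real.norm_of_nonneg hγ] at h1
  have h3 := (real_inner_le_norm (g - ∇ (avg F) x) (xs - s)).trans
    (mul_le_mul_of_nonneg_left hsxs (norm_nonneg _))
  have h4 : L / 2 * (γ * ‖s - x‖) ^ 2 ≤ L / 2 * (γ * D) ^ 2 := by gcongr
  -- The true gradient is exchanged for g when passing from s to xs: the first term is bounded by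
  -- convexity, the second by the gradient error, the third by the oracle.
  have h5 : inner ℝ (∇ (avg F) x) (s - x) =
      inner ℝ (∇ (avg F) x) (xs - x) + inner ℝ (g - ∇ (avg F) x) (xs - s)
        + (inner ℝ g s - inner ℝ g xs) := by
    simp only [inner_sub_left, inner_sub_right]; ring
  have h6 : inner ℝ (∇ (avg F) x) (s - x) ≤
      avg F xs - avg F x + D * ‖g - ∇ (avg F) x‖ + ε := by linarith
  have h7 := mul_le_mul_of_nonneg_left h6 hγ
  nlinarith

/-- A crude uniform bound of the gap on the feasible set, from which integrability of the random
gaps follows. -/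
theorem abs_avg_le (hd : 0 < d) (hF : ∀ i, Differentiable ℝ (F i)) (hL0 : 0 ≤ L)
    (hL : ∀ i x y, ‖∇ (F i) x - ∇ (F i) y‖ ≤ L * ‖x - y‖) {x xs : E} {D : ℝ}
    (hx : ‖x - xs‖ ≤ D) (hmin : avg F xs ≤ avg F x) :
    |avg F x - avg F xs| ≤ ‖∇ (avg F) xs‖ * D + L / 2 * D ^ 2 := by
  rw [abs_of_nonneg (sub_nonneg.mpr hmin)]
  have h1 := le_add_inner_gradient_add_sq (differentiable_avg hF)
    (norm_gradient_avg_sub_le hd hF hL) xs x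
  have h2 := (real_inner_le_norm (∇ (avg F) xs) (x - xs)).trans
    (mul_le_mul_of_nonneg_left hx (norm_nonneg _))
  have h3 : L / 2 * ‖x - xs‖ ^ 2 ≤ L / 2 * D ^ 2 := by gcongr
  linarith

variable {Ω : Type*} {𝓜 : MeasurableSpace Ω} {mΩ : MeasurableSpace Ω} {μ : Measure Ω}
  [IsProbabilityMeasure μ] [MeasurableSpace E] [BorelSpace E]

theorem integrable_avg_comp (hd : 0 < d) (hF : ∀ i, Differentiable ℝ (F i)) (hL0 : 0 ≤ L)
    (hL : ∀ i x y, ‖∇ (F i) x - ∇ (F i) y‖ ≤ L * ‖x - y‖) {K : Set E} {D : ℝ}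
    (hD : ∀ x ∈ K, ∀ y ∈ K, ‖x - y‖ ≤ D) {xs : E} (hxs : xs ∈ K)
    (hmin : ∀ x ∈ K, avg F xs ≤ avg F x) {x : Ω → E} (hx : Measurable x) (hxK : ∀ ω, x ω ∈ K) :
    Integrable (fun ω => avg F (x ω) - avg F xs) μ := by
  refine Integrable.of_bound (Measurable.aestronglyMeasurable ?_)
    (‖∇ (avg F) xs‖ * D + L / 2 * D ^ 2) (Filter.Eventually.of_forall fun ω => ?_)
  · exact ((differentiable_avg hF).continuous.measurable.comp hx).sub_const _
  · exact abs_avg_le hd hF hL0 hL (hD _ (hxK ω) _ hxs) (hmin _ (hxK ω))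

/-- One step of the variance-reduced method, in expectation. -/
theorem integral_avg_step_le [SecondCountableTopology E] (hd : 0 < d)
    (hF : ∀ i, Differentiable ℝ (F i))
    (hc : ∀ i, ConvexOn ℝ univ (F i)) (hL0 : 0 ≤ L)
    (hL : ∀ i x y, ‖∇ (F i) x - ∇ (F i) y‖ ≤ L * ‖x - y‖) {K : Set E} (hK : Convex ℝ K) {D : ℝ}
    (hD : ∀ x ∈ K, ∀ y ∈ K, ‖x - y‖ ≤ D) {xs : E} (hxs : xs ∈ K)
    (hmin : ∀ x ∈ K, avg F xs ≤ avg F x) {M : ℕ} (hM : 0 < M)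
    (h𝓜 : 𝓜 ≤ mΩ) {ξ : Fin M → Ω → Fin d}
    (hξ : ∀ j, Measurable (ξ j)) (hunif : ∀ j i, μ.real {ω | ξ j ω = i} = 1 / (d : ℝ))
    (hiind : iIndepFun ξ μ)
    (hpast : Indep (⨆ j, MeasurableSpace.comap (ξ j) inferInstance) 𝓜 μ)
    {x x₀ s : Ω → E} (hx : Measurable[𝓜] x) (hx₀ : Measurable[𝓜] x₀) (hs : Measurable s)
    (hxK : ∀ ω, x ω ∈ K) (hx₀K : ∀ ω, x₀ ω ∈ K) (hsK : ∀ ω, s ω ∈ K) {γ ε : ℝ} (hγ0 : 0 ≤ γ)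
    (hγ1 : γ ≤ 1)
    (horacle : ∀ ω, let g := (1 / (M : ℝ)) • ∑ j,
        (∇ (F (ξ j ω)) (x ω) - (∇ (F (ξ j ω)) (x₀ ω) - ∇ (avg F) (x₀ ω)))
      inner ℝ g (s ω) ≤ inner ℝ g xs + ε) {b : ℝ} (hb : 0 ≤ b)
    (hb2 : L ^ 2 * D ^ 2 / M ≤ b ^ 2 ∨ 4 * L / M * (∫ ω, (avg F (x ω) - avg F xs) ∂μ
      + ∫ ω, (avg F (x₀ ω) - avg F xs) ∂μ) ≤ b ^ 2) :
    ∫ ω, (avg F ((1 - γ) • x ω + γ • s ω) - avg F xs) ∂μ ≤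
      (1 - γ) * ∫ ω, (avg F (x ω) - avg F xs) ∂μ + γ * (ε + D * b) + L * γ ^ 2 * D ^ 2 / 2 := by
  have hd' : (0 : ℝ) < d := by exact_mod_cast hd
  have hM' : (0 : ℝ) < M := by exact_mod_cast hM
  have hD0 : 0 ≤ D := (norm_nonneg _).trans (hD _ hxs _ hxs)
  have hcont : ∀ i, Continuous (∇ (F i)) := fun i =>
    (LipschitzWith.of_dist_le_mul (K := ⟨L, hL0⟩) fun a b => by
      rw [dist_eq_norm, dist_eq_norm]; exact hL i a b).continuous
  have hxm : Measurable x := hx.mono h𝓜 le_rfl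
  have hx₀m : Measurable x₀ := hx₀.mono h𝓜 le_rfl
  set a : Fin d → Ω → E := fun i ω => ∇ (F i) (x ω) - ∇ (F i) (x₀ ω) with ha
  set g : Fin d → Ω → E := fun i ω => a i ω - (1 / (d : ℝ)) • ∑ j, a j ω with hg
  have ham : ∀ i, Measurable[𝓜] (a i) := fun i =>
    ((hcont i).measurable.comp hx).sub ((hcont i).measurable.comp hx₀)
  have hgm : ∀ i, Measurable[𝓜] (g i) := fun i =>
    (ham i).sub ((Finset.measurable_fun_sum _ fun j _ => ham j).const_smul _)
  have haB : ∀ i ω, ‖a i ω‖ ≤ L * D := fun i ω => (hL i _ _).trans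
    (mul_le_mul_of_nonneg_left (hD _ (hxK ω) _ (hx₀K ω)) hL0)
  have hgB : ∀ i ω, ‖g i ω‖ ≤ L * D + 1 / (d : ℝ) * (d * (L * D)) := by
    intro i ω
    refine (norm_sub_le _ _).trans (add_le_add (haB i ω) ?_)
    rw [norm_smul, Real.norm_of_nonneg (by positivity)]
    gcongr
    refine (norm_sum_le_of_le _ fun j _ => haB j ω).trans ?_
    simp
  have hgsum : ∀ ω, ∑ i, g i ω = 0 := by
    intro ω
    simp only [hg, Finset.sum_sub_distrib, Finset.sum_const, Finset.card_univ, Fintype.card_fin]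
    rw [← Nat.cast_smul_eq_nsmul ℝ, smul_smul, mul_one_div_cancel hd'.ne', one_smul, sub_self]
  set e : Ω → E := fun ω => (1 / (M : ℝ)) • ∑ j, g (ξ j ω) ω with he
  have hvar := integral_norm_sq_sample_mean (μ := μ) hM h𝓜 hξ hunif hiind hpast hgm hgB hgsum
  -- The snapshot gradient cancels the mean of the differences, so the error of the estimator is the
  -- sample mean of the centered family g.
  have herr : ∀ ω, (1 / (M : ℝ)) • ∑ j,
      (∇ (F (ξ j ω)) (x ω) - (∇ (F (ξ j ω)) (x₀ ω) - ∇ (avg F) (x₀ ω))) - ∇ (avg F) (x ω)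
        = e ω := by
    intro ω
    have h1 : ∀ j, ∇ (F (ξ j ω)) (x ω) - (∇ (F (ξ j ω)) (x₀ ω) - ∇ (avg F) (x₀ ω)) =
        g (ξ j ω) ω + ∇ (avg F) (x ω) := by
      intro j
      simp only [hg, ha, gradient_avg hF, Finset.sum_sub_distrib, smul_sub]
      abel
    simp only [h1, Finset.sum_add_distrib, Finset.sum_const, Finset.card_univ, Fintype.card_fin,
      smul_add, he]
    rw [← Nat.cast_smul_eq_nsmul ℝ, smul_smul (1 / (M : ℝ)), one_div_mul_cancel hM'.ne', one_smul,
      add_sub_cancel_right]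
  have hix := integrable_avg_comp (μ := μ) hd hF hL0 hL hD hxs hmin hxm hxK
  have hix₀ := integrable_avg_comp (μ := μ) hd hF hL0 hL hD hxs hmin hx₀m hx₀K
  have hgi : Integrable (fun ω => 1 / (d : ℝ) * ∑ i, ‖g i ω‖ ^ 2) μ := by
    refine (integrable_finsetSum _ fun i _ => ?_).const_mul _
    refine Integrable.of_bound
      (((hgm i).mono h𝓜 le_rfl).norm.pow_const 2).aestronglyMeasurable
      ((L * D + 1 / (d : ℝ) * (d * (L * D))) ^ 2) (Filter.Eventually.of_forall fun ω => ?_)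
    rw [Real.norm_of_nonneg (by positivity)]
    exact pow_le_pow_left₀ (norm_nonneg _) (hgB i ω) 2
  have hga : ∀ ω, 1 / (d : ℝ) * ∑ i, ‖g i ω‖ ^ 2 ≤ 1 / (d : ℝ) * ∑ i, ‖a i ω‖ ^ 2 := fun ω =>
    mul_le_mul_of_nonneg_left (sum_norm_sub_mean_sq_le hd fun i => a i ω) (by positivity)
  have hE2 : ∫ ω, ‖e ω‖ ^ 2 ∂μ ≤ b ^ 2 := by
    rw [hvar.2]
    -- In the first alternative the variance is bounded only through Lipschitz continuity and the
    -- diameter; in the second, through the gaps at x and at the snapshot, routed via xs.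
    rcases hb2 with h | h
    · refine le_trans ?_ h
      have : ∫ ω, 1 / (d : ℝ) * ∑ i, ‖g i ω‖ ^ 2 ∂μ ≤ ∫ _ω, L ^ 2 * D ^ 2 ∂μ := by
        refine integral_mono hgi (integrable_const _) fun ω => (hga ω).trans ?_
        have h1 : ∑ i, ‖a i ω‖ ^ 2 ≤ ∑ _i : Fin d, L ^ 2 * D ^ 2 :=
          Finset.sum_le_sum fun i _ => by
            rw [← mul_pow]; exact pow_le_pow_left₀ (norm_nonneg _) (haB i ω) 2
        rw [Finset.sum_const, Finset.card_univ, Fintype.card_fin, nsmul_eq_mul] at h1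
        calc _ ≤ 1 / (d : ℝ) * (d * (L ^ 2 * D ^ 2)) := by gcongr
          _ = _ := by field_simp
      rw [integral_const, probReal_univ, one_smul] at this
      rw [one_div, mul_comm, ← div_eq_mul_inv]
      gcongr
    · refine le_trans ?_ h
      have : ∫ ω, 1 / (d : ℝ) * ∑ i, ‖g i ω‖ ^ 2 ∂μ ≤
          ∫ ω, 4 * L * ((avg F (x ω) - avg F xs) + (avg F (x₀ ω) - avg F xs)) ∂μ := by
        refine integral_mono hgi ((hix.add hix₀).const_mul _) fun ω => (hga ω).trans ?_
        have h1 := mean_norm_gradient_sub_sq_le hd hF hc hL0 hL hK hxs hmin (hxK ω)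
        have h2 := mean_norm_gradient_sub_sq_le hd hF hc hL0 hL hK hxs hmin (hx₀K ω)
        have h3 : ∑ i, ‖a i ω‖ ^ 2 ≤ ∑ i, (2 * ‖∇ (F i) (x ω) - ∇ (F i) xs‖ ^ 2 +
            2 * ‖∇ (F i) (x₀ ω) - ∇ (F i) xs‖ ^ 2) := by
          refine Finset.sum_le_sum fun i _ => ?_
          have h4 : a i ω = (∇ (F i) (x ω) - ∇ (F i) xs) - (∇ (F i) (x₀ ω) - ∇ (F i) xs) := by
            simp only [ha]; abel
          rw [h4]
          have h5 := norm_sub_le (∇ (F i) (x ω) - ∇ (F i) xs) (∇ (F i) (x₀ ω) - ∇ (F i) xs)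
          have h6 := pow_le_pow_left₀ (norm_nonneg _) h5 2
          nlinarith [sq_nonneg (‖∇ (F i) (x ω) - ∇ (F i) xs‖ - ‖∇ (F i) (x₀ ω) - ∇ (F i) xs‖)]
        rw [Finset.sum_add_distrib, ← Finset.mul_sum, ← Finset.mul_sum] at h3
        have h7 := mul_le_mul_of_nonneg_left h3 (show 0 ≤ 1 / (d : ℝ) by positivity)
        linarith
      rw [integral_const_mul (4 * L), integral_add hix hix₀] at this
      calc _ ≤ 1 / (M : ℝ) * _ := mul_le_mul_of_nonneg_left this (by positivity)
        _ = _ := by ring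
  have hem : AEStronglyMeasurable (fun ω => ‖e ω‖) μ := by
    have h1 := (Real.continuous_sqrt.measurable.comp_aemeasurable
      hvar.1.aestronglyMeasurable.aemeasurable).aestronglyMeasurable
    refine h1.congr (Filter.Eventually.of_forall fun ω => ?_)
    exact Real.sqrt_sq (norm_nonneg _)
  have hE1 := integral_le_of_integral_sq_le hem hvar.1 hb hE2
  have hpt : ∀ ω, avg F ((1 - γ) • x ω + γ • s ω) - avg F xs ≤
      (1 - γ) * (avg F (x ω) - avg F xs) + γ * D * ‖e ω‖ + (γ * ε + L * γ ^ 2 * D ^ 2 / 2) := by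
    intro ω
    have h := avg_step_le hd hF hc hL0 hL hγ0 (hD _ (hsK ω) _ (hxK ω)) (hD _ hxs _ (hsK ω))
      (horacle ω)
    rw [herr ω] at h
    linarith
  have hyK : ∀ ω, (1 - γ) • x ω + γ • s ω ∈ K := fun ω =>
    hK (hxK ω) (hsK ω) (sub_nonneg.mpr hγ1) hγ0 (sub_add_cancel _ _)
  have hiy := integrable_avg_comp (μ := μ) hd hF hL0 hL hD hxs hmin
    ((hxm.const_smul (1 - γ)).add (hs.const_smul γ)) hyK
  have h := integral_mono hiy (((hix.const_mul (1 - γ)).add (hE1.1.const_mul (γ * D))).add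
    (integrable_const (γ * ε + L * γ ^ 2 * D ^ 2 / 2))) hpt
  refine h.trans ?_
  rw [integral_add' ((hix.const_mul (1 - γ)).add (hE1.1.const_mul (γ * D))) (integrable_const _),
    integral_add' (hix.const_mul (1 - γ)) (hE1.1.const_mul (γ * D)), integral_const_mul,
    integral_const_mul, integral_const, probReal_univ, one_smul]
  have := mul_le_mul_of_nonneg_left hE1.2 (mul_nonneg hγ0 hD0)
  linarith

end Step

/-! ### Iterates -/

section Iterates

theorem gam_nonneg (k : ℕ) : 0 ≤ gam k := by unfold gam; positivity

theorem gam_le_one {k : ℕ} (hk : 1 ≤ k) : gam k ≤ 1 := by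
  have : (1 : ℝ) ≤ k := by exact_mod_cast hk
  rw [gam, div_le_one (by positivity)]
  linarith

variable {E E' : Type*} [AddCommGroup E] [Module ℝ E] [AddCommGroup E'] [Module ℝ E']

/-- The update is linear in the starting value and the increments jointly. The same fact serves the
dual variable, both sketches, single entries and evaluation at ω. -/
theorem map_innerIter (φ : E →ₗ[ℝ] E') (x : E) (h : ℕ → E) (k : ℕ) :
    φ (innerIter x h k) = innerIter (φ x) (fun k => φ (h k)) k := by
  induction k with
  | zero => rfl
  | succ k ih => simp only [innerIter, map_add, map_smul, ih]

theorem map_epochEnd (φ : E →ₗ[ℝ] E') (x : E) (h : ℕ → ℕ → E) (t : ℕ) :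
    φ (epochEnd x h t) = epochEnd (φ x) (fun t k => φ (h t k)) t := by
  induction t with
  | zero => rfl
  | succ t ih => simp only [epochEnd, map_innerIter, ih]

theorem map_iterate (φ : E →ₗ[ℝ] E') (x : E) (h : ℕ → ℕ → E) (t k : ℕ) :
    φ (iterate x h t k) = iterate (φ x) (fun t k => φ (h t k)) t k := by
  simp only [iterate, map_innerIter, map_epochEnd]

theorem innerIter_induction (P : E → Prop) {x : E} {h : ℕ → E}
    (hstep : ∀ k, 1 ≤ k → ∀ x y, P x → P y → P ((1 - gam k) • x + gam k • y)) (hx : P x) {k : ℕ}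
    (hh : ∀ k', 1 ≤ k' → k' ≤ k → P (h k')) : P (innerIter x h k) := by
  induction k with
  | zero => exact hx
  | succ k ih =>
    exact hstep _ (by omega) _ _ (ih fun k' h1 h2 => hh k' h1 (by omega))
      (hh _ (by omega) le_rfl)

theorem epochEnd_induction (P : E → Prop) {x : E} {h : ℕ → ℕ → E}
    (hstep : ∀ k, 1 ≤ k → ∀ x y, P x → P y → P ((1 - gam k) • x + gam k • y)) (hx : P x) {t : ℕ}
    (hh : ∀ t' k', 1 ≤ t' → 1 ≤ k' → t' ≤ t → k' ≤ epochLen t' → P (h t' k')) :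
    P (epochEnd x h t) := by
  induction t with
  | zero => exact hx
  | succ t ih =>
    exact innerIter_induction P hstep (ih fun t' k' h1 h2 h3 h4 => hh t' k' h1 h2 (by omega) h4)
      fun k' h1 h2 => hh _ _ (by omega) h1 le_rfl h2

/-- Any property stable under the convex update passes to the iterates; it is used for feasibility
and for measurability. The condition on (t', k') lists exactly the steps already performed, so that
measurability holds with respect to the past. -/
theorem iterate_induction (P : E → Prop) {x : E} {h : ℕ → ℕ → E}
    (hstep : ∀ k, 1 ≤ k → ∀ x y, P x → P y → P ((1 - gam k) • x + gam k • y)) (hx : P x) {t k : ℕ}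
    (ht : 1 ≤ t) (hh : ∀ t' k', 1 ≤ t' → 1 ≤ k' →
      (t' < t ∧ k' ≤ epochLen t' ∨ t' = t ∧ k' ≤ k) → P (h t' k')) : P (iterate x h t k) :=
  innerIter_induction P hstep
    (epochEnd_induction P hstep hx fun t' k' h1 h2 h3 h4 => hh t' k' h1 h2 (Or.inl ⟨by omega, h4⟩))
    fun k' h1 h2 => hh t k' ht h1 (Or.inr ⟨rfl, h2⟩)

end Iterates

/-! ### Recursion of one epoch -/

section Recursion

variable {L D δ a : ℝ} {k : ℕ}

/-- With γ = 2/(k+2), oracle tolerance, gradient error and curvature add up to exactly 4C/(k+2)²,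
where C = LD²(1+δ), and the recursion closes because (k+1)(k+3) ≤ (k+2)². For k = 0 the factor 1 - γ
vanishes, so no bound on the starting gap is required. -/
theorem epoch_step_le (hL : 0 ≤ L) (hδ : 0 ≤ δ)
    (ha : k = 0 ∨ a ≤ 4 * (L * D ^ 2 * (1 + δ)) / (k + 2)) :
    (1 - gam (k + 1)) * a + gam (k + 1) * (L * D ^ 2 / 2 * gam (k + 1) * δ
      + D * (L * D * (1 + δ) / (k + 2))) + L * gam (k + 1) ^ 2 * D ^ 2 / 2 ≤
      4 * (L * D ^ 2 * (1 + δ)) / (((k + 1 : ℕ) : ℝ) + 2) := by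
  set C := L * D ^ 2 * (1 + δ) with hC
  have hC0 : 0 ≤ C := by positivity
  have hk : (0 : ℝ) ≤ k := k.cast_nonneg
  have hg : gam (k + 1) = 2 / ((k : ℝ) + 2) := by
    rw [gam]; push_cast; congr 1; ring
  have h1 : (1 - gam (k + 1)) * a ≤ k / ((k : ℝ) + 2) * (4 * C / (k + 2)) := by
    have e : 1 - gam (k + 1) = k / ((k : ℝ) + 2) := by rw [hg]; field_simp; ring
    rw [e]
    rcases ha with rfl | ha
    · simp
    · gcongr
  have h2 : gam (k + 1) * (L * D ^ 2 / 2 * gam (k + 1) * δ + D * (L * D * (1 + δ) / (k + 2)))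
      + L * gam (k + 1) ^ 2 * D ^ 2 / 2 = 4 * C / ((k : ℝ) + 2) ^ 2 := by
    rw [hg, hC]; field_simp; ring
  have h3 : k / ((k : ℝ) + 2) * (4 * C / (k + 2)) + 4 * C / ((k : ℝ) + 2) ^ 2
      = 4 * C * ((k + 1) / ((k : ℝ) + 2) ^ 2) := by field_simp
  have h4 : (k + 1) / ((k : ℝ) + 2) ^ 2 ≤ 1 / (k + 3) := by
    rw [div_le_div_iff₀ (by positivity) (by positivity)]; nlinarith
  have h5 := mul_le_mul_of_nonneg_left h4 (show 0 ≤ 4 * C by positivity)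
  calc _ ≤ 4 * C * ((k + 1) / ((k : ℝ) + 2) ^ 2) := by linarith
    _ ≤ _ := h5
    _ = _ := by push_cast; ring

/-- The first epoch has 14 steps, so k + 2 ≤ 15 ≤ 96 and the batch size 96(k+2) dominates (k+2)².
The Lipschitz bound of the variance thus suffices before any bound of the snapshot gap is known. -/
theorem first_epoch_variance_le (hδ : 0 ≤ δ) (hk : k + 1 ≤ epochLen 1) :
    L ^ 2 * D ^ 2 / (batchSize (k + 1) : ℝ) ≤ (L * D * (1 + δ) / (k + 2)) ^ 2 := by
  have hk' : (k : ℝ) ≤ 13 := by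
    have : k ≤ 13 := by simp [epochLen] at hk; omega
    exact_mod_cast this
  have hk0 : (0 : ℝ) ≤ k := k.cast_nonneg
  have e : (batchSize (k + 1) : ℝ) = 96 * ((k : ℝ) + 2) := by
    simp [batchSize]; ring
  rw [e, div_pow, mul_pow, mul_pow]
  have h1 : 1 / (96 * ((k : ℝ) + 2)) ≤ 1 / ((k : ℝ) + 2) ^ 2 := by
    apply one_div_le_one_div_of_le (by positivity)
    nlinarith
  have h2 : (1 : ℝ) ≤ (1 + δ) ^ 2 := one_le_pow₀ (by linarith)
  calc L ^ 2 * D ^ 2 / (96 * ((k : ℝ) + 2)) = L ^ 2 * D ^ 2 * (1 / (96 * ((k : ℝ) + 2))) := by ring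
    _ ≤ L ^ 2 * D ^ 2 * (1 / ((k : ℝ) + 2) ^ 2) := by gcongr
    _ ≤ L ^ 2 * D ^ 2 * (1 / ((k : ℝ) + 2) ^ 2) * (1 + δ) ^ 2 :=
      le_mul_of_one_le_right (by positivity) h2
    _ = _ := by ring

/-- Within epoch t one has k + 2 ≤ 8·2^t, so the snapshot gap is at most 8C/(k+2). The two gaps then
sum to at most 12C/(k+2), and 4·12/96 = 1/2 leaves room to spare. -/
theorem later_epoch_variance_le {t : ℕ} {a₀ : ℝ} (hL : 0 ≤ L) (hδ : 0 ≤ δ)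
    (ha : a ≤ 4 * (L * D ^ 2 * (1 + δ)) / (k + 2))
    (ha₀ : a₀ ≤ L * D ^ 2 * (1 + δ) / 2 ^ t) (hk : k + 1 ≤ epochLen t) :
    4 * L / (batchSize (k + 1) : ℝ) * (a + a₀) ≤ (L * D * (1 + δ) / (k + 2)) ^ 2 := by
  set C := L * D ^ 2 * (1 + δ) with hC
  have hC0 : 0 ≤ C := by positivity
  have hk0 : (0 : ℝ) ≤ k := k.cast_nonneg
  have e : (batchSize (k + 1) : ℝ) = 96 * ((k : ℝ) + 2) := by
    simp [batchSize]; ring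
  have hk' : ((k : ℝ) + 2) / 8 ≤ 2 ^ t := by
    have h1 : k + 2 ≤ 8 * 2 ^ t := by
      simp only [epochLen, pow_add] at hk; omega
    have : (k : ℝ) + 2 ≤ 8 * 2 ^ t := by exact_mod_cast h1
    linarith
  have h0 : a₀ ≤ 8 * C / (k + 2) := by
    refine ha₀.trans ?_
    calc C / 2 ^ t ≤ C / (((k : ℝ) + 2) / 8) := by gcongr
      _ = _ := by field_simp
  have h2 : (1 : ℝ) ≤ 1 + δ := by linarith
  rw [e]
  calc 4 * L / (96 * ((k : ℝ) + 2)) * (a + a₀)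
      ≤ 4 * L / (96 * ((k : ℝ) + 2)) * (4 * C / (k + 2) + 8 * C / (k + 2)) := by gcongr
    _ = 1 / 2 * (L ^ 2 * D ^ 2 * (1 + δ) / (k + 2) ^ 2) := by rw [hC]; field_simp; ring
    _ ≤ 1 * (L ^ 2 * D ^ 2 * (1 + δ) / (k + 2) ^ 2) := by gcongr; norm_num
    _ ≤ (1 + δ) * (L ^ 2 * D ^ 2 * (1 + δ) / (k + 2) ^ 2) := by gcongr
    _ = _ := by rw [div_pow]; ring

/-- The 2 subtracted in the epoch length absorbs the shift in 4C/(k+2): the final bound is C/2^(t+1)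
without loss. -/
theorem epochLen_add_two (t : ℕ) : (epochLen t : ℝ) + 2 = 8 * 2 ^ t := by
  have h : epochLen t + 2 = 8 * 2 ^ t := by
    have := Nat.one_le_two_pow (n := t)
    simp only [epochLen, pow_add]; omega
  exact_mod_cast h

theorem one_le_epochLen (t : ℕ) : 1 ≤ epochLen t := by
  have := Nat.one_le_two_pow (n := t)
  simp only [epochLen, pow_add]; omega

end Recursion

/-! ### Matrices as a Euclidean space -/

section Vec

variable {m n l d : ℕ}

/-- Matrices with the Frobenius norm as a Euclidean space. -/
noncomputable def vec : Matrix (Fin m) (Fin n) ℝ ≃ₗᵢ[ℝ] EuclideanSpace ℝ (Fin m × Fin n) where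
  toFun X := WithLp.toLp 2 fun p => X p.1 p.2
  invFun x := Matrix.of fun i j => x (i, j)
  left_inv X := rfl
  right_inv x := rfl
  map_add' X Y := rfl
  map_smul' c X := rfl
  norm_map' X := by
    have h : ‖(WithLp.toLp 2 fun p => X p.1 p.2 : EuclideanSpace ℝ (Fin m × Fin n))‖ ^ 2
        = ‖X‖ ^ 2 := by
      rw [EuclideanSpace.norm_sq_eq, frobenius_norm_sq, Fintype.sum_prod_type]
      simp
    exact (sq_eq_sq₀ (norm_nonneg _) (norm_nonneg _)).mp h

theorem measurable_vec {Ω : Type*} {mΩ : MeasurableSpace Ω} {X : Ω → Matrix (Fin m) (Fin n) ℝ}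
    (hX : ∀ i j, Measurable fun ω => X ω i j) : Measurable fun ω => vec (X ω) :=
  (WithLp.measurable_toLp 2 _).comp (measurable_pi_lambda _ fun p => hX p.1 p.2)

/-- A linear map on matrices as a continuous linear map on the Euclidean space. -/
noncomputable def vecMap (A : Matrix (Fin m) (Fin n) ℝ →ₗ[ℝ] EuclideanSpace ℝ (Fin l)) :
    EuclideanSpace ℝ (Fin m × Fin n) →L[ℝ] EuclideanSpace ℝ (Fin l) :=
  LinearMap.toContinuousLinearMap (A ∘ₗ vec.symm.toLinearEquiv.toLinearMap)

theorem vecMap_vec (A : Matrix (Fin m) (Fin n) ℝ →ₗ[ℝ] EuclideanSpace ℝ (Fin l))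
    (X : Matrix (Fin m) (Fin n) ℝ) : vecMap A (vec X) = A X := by
  simp [vecMap]

/-- The chain rule tested against y. It identifies the gradients of the lifted functions with the
adjoint image of the dual gradients, which is what the oracle is queried with. -/
theorem inner_gradient_comp_vecMap (A : Matrix (Fin m) (Fin n) ℝ →ₗ[ℝ] EuclideanSpace ℝ (Fin l))
    {f : EuclideanSpace ℝ (Fin l) → ℝ} (hf : Differentiable ℝ f)
    (x y : EuclideanSpace ℝ (Fin m × Fin n)) :
    inner ℝ (∇ (fun x => f (vecMap A x)) x) y = inner ℝ (∇ f (vecMap A x)) (vecMap A y) := by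
  have h : HasFDerivAt (fun x => f (vecMap A x)) ((fderiv ℝ f (vecMap A x)).comp (vecMap A)) x :=
    (hf _).hasFDerivAt.comp x (vecMap A).hasFDerivAt
  rw [gradient, h.fderiv, InnerProductSpace.toDual_symm_apply, gradient,
    InnerProductSpace.toDual_symm_apply]
  rfl

theorem IsLSmooth.norm_gradient_comp_isometry_sub_le {E E' : Type*} [NormedAddCommGroup E]
    [NormedSpace ℝ E] [NormedAddCommGroup E'] [InnerProductSpace ℝ E'] [CompleteSpace E'] {L : ℝ}
    {g : E → ℝ} (h : IsLSmooth L g) (e : E' →ₗᵢ[ℝ] E) (x y : E') :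
    ‖∇ (fun x => g (e x)) x - ∇ (fun x => g (e x)) y‖ ≤ L * ‖x - y‖ := by
  have hfd : ∀ z, fderiv ℝ (fun x => g (e x)) z =
      (fderiv ℝ g (e z)).comp e.toContinuousLinearMap := fun z =>
    ((h.2.1 (e z)).hasFDerivAt.comp z e.toContinuousLinearMap.hasFDerivAt).fderiv
  rw [gradient, gradient, ← map_sub, LinearIsometryEquiv.norm_map, hfd, hfd,
    ← ContinuousLinearMap.sub_comp]
  refine (ContinuousLinearMap.opNorm_comp_le _ _).trans ?_
  have h1 := h.2.2 (e x) (e y)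
  rw [← map_sub, LinearIsometry.norm_map] at h1
  exact (mul_le_of_le_one_right (norm_nonneg _) e.norm_toContinuousLinearMap_le).trans h1

end Vec

/-! ### Convergence of the iterates -/

section Convergence

variable {Ω : Type*} {m n l d : ℕ}

/-- The primal iterates. -/
noncomputable def primal (α : ℝ) (X₀ : Ω → Matrix (Fin m) (Fin n) ℝ)
    (u : ℕ → ℕ → Ω → EuclideanSpace ℝ (Fin m)) (v : ℕ → ℕ → Ω → EuclideanSpace ℝ (Fin n))
    (t k : ℕ) (ω : Ω) : Matrix (Fin m) (Fin n) ℝ :=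
  iterate (X₀ ω) (fun t k => atom α (u t k ω) (v t k ω)) t k

variable {α : ℝ} {X₀ : Ω → Matrix (Fin m) (Fin n) ℝ} {ξ : ℕ → ℕ → ℕ → Ω → Fin d}
  {u : ℕ → ℕ → Ω → EuclideanSpace ℝ (Fin m)} {v : ℕ → ℕ → Ω → EuclideanSpace ℝ (Fin n)}

theorem atom_apply (α : ℝ) (u : EuclideanSpace ℝ (Fin m)) (v : EuclideanSpace ℝ (Fin n))
    (i : Fin m) (j : Fin n) : atom α u v i j = -(α * (u i * v j)) := by
  simp [atom, Matrix.vecMulVec_apply]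

theorem measurable_primal {𝓜 : MeasurableSpace Ω} (h₀ : ∀ i j, Measurable fun ω => X₀ ω i j)
    {t k : ℕ} (ht : 1 ≤ t) (huv : ∀ t' k', 1 ≤ t' → 1 ≤ k' →
      (t' < t ∧ k' ≤ epochLen t' ∨ t' = t ∧ k' ≤ k) → Measurable (u t' k') ∧ Measurable (v t' k'))
    (i : Fin m) (j : Fin n) : Measurable fun ω => primal α X₀ u v t k ω i j := by
  -- As a function of ω, an entry is itself an iterate in the vector space of real functions on Ω,
  -- so the induction can be run on the property of being measurable.
  have e : (fun ω => primal α X₀ u v t k ω i j) = iterate (fun ω => X₀ ω i j)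
      (fun t k ω => atom α (u t k ω) (v t k ω) i j) t k := by
    ext ω
    have h1 := map_iterate (Matrix.entryLinearMap ℝ ℝ i j) (X₀ ω)
      (fun t k => atom α (u t k ω) (v t k ω)) t k
    have h2 := map_iterate (LinearMap.proj ω : (Ω → ℝ) →ₗ[ℝ] ℝ) (fun ω => X₀ ω i j)
      (fun t k ω => atom α (u t k ω) (v t k ω) i j) t k
    exact h1.trans h2.symm
  rw [e]
  refine iterate_induction (P := fun g : Ω → ℝ => Measurable g) ?_ (h₀ i j) ht ?_
  · intro k _ x y hx hy
    exact (hx.const_smul _).add (hy.const_smul _)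
  · intro t' k' h1 h2 h3
    obtain ⟨hu, hv⟩ := huv t' k' h1 h2 h3
    simp only [atom_apply]
    have h4 : Measurable fun ω => u t' k' ω i :=
      (EuclideanSpace.proj i : EuclideanSpace ℝ (Fin m) →L[ℝ] ℝ).measurable.comp hu
    have h5 : Measurable fun ω => v t' k' ω j :=
      (EuclideanSpace.proj j : EuclideanSpace ℝ (Fin n) →L[ℝ] ℝ).measurable.comp hv
    exact ((h4.mul h5).const_mul α).neg

theorem nuclearNorm_primal_le (hα : 0 ≤ α) {ω : Ω} (h₀ : nuclearNorm (X₀ ω) ≤ α) {t k : ℕ}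
    (ht : 1 ≤ t) (huv : ∀ t' k', 1 ≤ t' → 1 ≤ k' →
      (t' < t ∧ k' ≤ epochLen t' ∨ t' = t ∧ k' ≤ k) → ‖u t' k' ω‖ * ‖v t' k' ω‖ ≤ 1) :
    nuclearNorm (primal α X₀ u v t k ω) ≤ α :=
  iterate_induction (fun X => nuclearNorm X ≤ α)
    (fun k hk _ _ hx hy => nuclearNorm_convex_combination_le hx hy (gam_nonneg k) (gam_le_one hk))
    h₀ ht fun t' k' h1 h2 h3 => nuclearNorm_atom_le hα (huv t' k' h1 h2 h3)

theorem measurable_sigmaRun {T : ℕ} {S : Set (ℕ × ℕ)} {t k : ℕ} (hS : (t, k) ∈ S)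
    (hstep : IsStep T t k) : Measurable[sigmaRun T X₀ ξ u v S] (u t k) ∧
      Measurable[sigmaRun T X₀ ξ u v S] (v t k) := by
  have h := le_iSup₂_of_le (f := fun (p : ℕ × ℕ) (_ : p ∈ S ∧ IsStep T p.1 p.2) =>
    (MeasurableSpace.comap (u p.1 p.2) inferInstance ⊔
      MeasurableSpace.comap (v p.1 p.2) inferInstance ⊔
      ⨆ j : Fin (batchSize p.2), MeasurableSpace.comap (ξ p.1 p.2 j) inferInstance))
    (t, k) ⟨hS, hstep⟩ le_rfl
  constructor
  · exact measurable_iff_comap_le.mpr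
      (((le_sup_left.trans le_sup_left).trans h).trans le_sup_right)
  · exact measurable_iff_comap_le.mpr
      (((le_sup_right.trans le_sup_left).trans h).trans le_sup_right)

theorem measurable_start_sigmaRun {T : ℕ} {S : Set (ℕ × ℕ)} (i : Fin m) (j : Fin n) :
    Measurable[sigmaRun T X₀ ξ u v S] fun ω => X₀ ω i j :=
  measurable_iff_comap_le.mpr <| (le_iSup₂_of_le (f := fun (i : Fin m) (j : Fin n) =>
    MeasurableSpace.comap (fun ω => X₀ ω i j) inferInstance) i j le_rfl).trans le_sup_left

theorem measurable_primal_sigmaRun {T : ℕ} {S : Set (ℕ × ℕ)} {t k : ℕ} (ht : 1 ≤ t) (htT : t ≤ T)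
    (hk : k ≤ epochLen t)
    (hS : ∀ t' k', (t' < t ∨ t' = t ∧ k' ≤ k) → (t', k') ∈ S) (i : Fin m) (j : Fin n) :
    Measurable[sigmaRun T X₀ ξ u v S] fun ω => primal α X₀ u v t k ω i j := by
  refine measurable_primal (measurable_start_sigmaRun) ht (fun t' k' h1 h2 h3 => ?_) i j
  rcases h3 with h3 | h3
  · exact measurable_sigmaRun (hS t' k' (Or.inl h3.1)) ⟨h1, by omega, h2, h3.2⟩
  · obtain ⟨rfl, h4⟩ := h3
    exact measurable_sigmaRun (hS t' k' (Or.inr ⟨rfl, h4⟩)) ⟨h1, htT, h2, h4.trans hk⟩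

variable [mΩ : MeasurableSpace Ω] {μ : Measure Ω} [IsProbabilityMeasure μ]
  {f : Fin d → EuclideanSpace ℝ (Fin l) → ℝ}
  {A : Matrix (Fin m) (Fin n) ℝ →ₗ[ℝ] EuclideanSpace ℝ (Fin l)} {L δ : ℝ} {r T : ℕ}
  {qr : (Fin m → Fin (2 * r + 1) → ℝ) → Matrix (Fin m) (Fin (min m (2 * r + 1))) ℝ}
  {Φ : Ω → Matrix (Fin (4 * r + 3)) (Fin m) ℝ} {Ψ : Ω → Matrix (Fin n) (Fin (2 * r + 1)) ℝ}
  {Xhat : ℕ → Ω → Matrix (Fin m) (Fin n) ℝ}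

omit [IsProbabilityMeasure μ] in
theorem IsRun.sigmaRun_le (hrun : IsRun μ f A α L δ r T qr X₀ ξ u v Φ Ψ Xhat) (S : Set (ℕ × ℕ)) :
    sigmaRun T X₀ ξ u v S ≤ mΩ := by
  refine sup_le (iSup₂_le fun i j => (hrun.measurable_start i j).comap_le) ?_
  refine iSup₂_le fun p hp => sup_le (sup_le ?_ ?_) (iSup_le fun j => ?_)
  · exact (hrun.measurable_left _ _ hp.2).comap_le
  · exact (hrun.measurable_right _ _ hp.2).comap_le
  · exact (hrun.measurable_sample _ _ hp.2 j j.2).comap_le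

omit [IsProbabilityMeasure μ] in
theorem IsRun.nuclearNorm_primal_le (hrun : IsRun μ f A α L δ r T qr X₀ ξ u v Φ Ψ Xhat)
    (hα : 0 ≤ α) {t k : ℕ} (ht : 1 ≤ t) (htT : t ≤ T) (hk : k ≤ epochLen t) (ω : Ω) :
    nuclearNorm (primal α X₀ u v t k ω) ≤ α := by
  refine SSVRF.nuclearNorm_primal_le hα (hrun.feasible_start ω) ht fun t' k' h1 h2 h3 => ?_
  rcases h3 with h3 | h3
  · exact hrun.feasible_oracle t' k' ⟨h1, by omega, h2, h3.2⟩ ω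
  · obtain ⟨rfl, h4⟩ := h3
    exact hrun.feasible_oracle t' k' ⟨h1, htT, h2, h4.trans hk⟩ ω

omit [IsProbabilityMeasure μ] in
theorem IsRun.oracle_vec (hrun : IsRun μ f A α L δ r T qr X₀ ξ u v Φ Ψ Xhat)
    (hdiff : ∀ i, Differentiable ℝ (f i)) {t k : ℕ} (hstep : IsStep T t (k + 1))
    {X : Matrix (Fin m) (Fin n) ℝ} (hX : nuclearNorm X ≤ α) (ω : Ω) :
    let F : Fin d → EuclideanSpace ℝ (Fin m × Fin n) → ℝ := fun i y => f i (vecMap A y)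
    let g := (1 / (batchSize (k + 1) : ℝ)) • ∑ j : Fin (batchSize (k + 1)),
      (∇ (F (ξ t (k + 1) j ω)) (vec (primal α X₀ u v t k ω)) -
        (∇ (F (ξ t (k + 1) j ω)) (vec (primal α X₀ u v t 0 ω)) -
          ∇ (avg F) (vec (primal α X₀ u v t 0 ω))))
    inner ℝ g (vec (atom α (u t (k + 1) ω) (v t (k + 1) ω))) ≤
      inner ℝ g (vec X) + tol L α δ (k + 1) := by
  intro F g
  have h := hrun.oracle t (k + 1) hstep ω X hX
  set z := iterate (A (X₀ ω)) (fun t k => A (atom α (u t k ω) (v t k ω))) t with hz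
  have hzA : ∀ k, z k = vecMap A (vec (primal α X₀ u v t k ω)) := by
    intro k
    rw [vecMap_vec, hz, primal, map_iterate]
  have hFd : ∀ i, Differentiable ℝ (F i) := fun i => (hdiff i).comp (vecMap A).differentiable
  have hg : ∀ Y : Matrix (Fin m) (Fin n) ℝ, inner ℝ g (vec Y) =
      inner ℝ (vrGrad f (batchSize (k + 1)) (fun j => ξ t (k + 1) j ω) (z k) (z 0)) (A Y) := by
    intro Y
    rw [← vecMap_vec A Y, vrGrad, Finset.sum_range]
    simp only [g, real_inner_smul_left, sum_inner, inner_sub_left, F, gradient_avg hFd,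
      gradient_avg hdiff, inner_gradient_comp_vecMap A (hdiff _), hzA]
  simp only [Nat.add_sub_cancel] at h
  rw [trace_adjointMap] at h
  rw [hg, hg, real_inner_comm, real_inner_comm (A X), ← trace_adjointMap A _ X]
  exact h

/-- The expected optimality gap at the end of each epoch. -/
theorem IsRun.integral_gap_le (hrun : IsRun μ f A α L δ r T qr X₀ ξ u v Φ Ψ Xhat)
    (hd : 0 < d) (hα : 0 ≤ α) (hδ : 0 ≤ δ) (hconv : ∀ i, ConvexOn ℝ univ (f i))
    (hdiff : ∀ i, Differentiable ℝ (f i)) (hsmooth : ∀ i, IsLSmooth L fun X => f i (A X))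
    {Xs : Matrix (Fin m) (Fin n) ℝ} (hXs : nuclearNorm Xs ≤ α)
    (hmin : ∀ X, nuclearNorm X ≤ α → avg f (A Xs) ≤ avg f (A X)) {t : ℕ} (ht : 1 ≤ t)
    (htT : t ≤ T) :
    Integrable (fun ω => avg f (A (primal α X₀ u v t (epochLen t) ω)) - avg f (A Xs)) μ ∧
    ∫ ω, (avg f (A (primal α X₀ u v t (epochLen t) ω)) - avg f (A Xs)) ∂μ ≤
      L * (2 * α) ^ 2 * (1 + δ) / 2 ^ (t + 1) := by
  have hL0 : 0 ≤ L := (hsmooth ⟨0, hd⟩).1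
  set F : Fin d → EuclideanSpace ℝ (Fin m × Fin n) → ℝ := fun i y => f i (vecMap A y) with hFdef
  have hFA : ∀ X, avg F (vec X) = avg f (A X) := by
    intro X; simp only [avg, hFdef, vecMap_vec]
  have hFd : ∀ i, Differentiable ℝ (F i) := fun i => (hdiff i).comp (vecMap A).differentiable
  have hFc : ∀ i, ConvexOn ℝ univ (F i) := fun i =>
    (hconv i).comp_linearMap (vecMap A).toLinearMap
  have hFL : ∀ i x y, ‖∇ (F i) x - ∇ (F i) y‖ ≤ L * ‖x - y‖ := fun i =>
    (hsmooth i).norm_gradient_comp_isometry_sub_le vec.symm.toLinearIsometry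
  set K : Set (EuclideanSpace ℝ (Fin m × Fin n)) := {y | nuclearNorm (vec.symm y) ≤ α} with hKdef
  have hvK : ∀ {X : Matrix (Fin m) (Fin n) ℝ}, nuclearNorm X ≤ α → vec X ∈ K := by
    intro X hX; simpa [hKdef] using hX
  have hK : Convex ℝ K := by
    intro x hx y hy a b ha hb hab
    have h := nuclearNorm_convex_combination_le hx hy hb (by linarith : b ≤ 1)
    rw [← eq_sub_iff_add_eq.mpr hab, ← map_smul, ← map_smul, ← map_add] at h
    exact h
  have hKD : ∀ x ∈ K, ∀ y ∈ K, ‖x - y‖ ≤ 2 * α := by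
    intro x hx y hy
    have h := norm_sub_le_of_nuclearNorm_le hx hy
    rwa [← map_sub, LinearIsometryEquiv.norm_map] at h
  have hKmin : ∀ x ∈ K, avg F (vec Xs) ≤ avg F x := by
    intro x hx
    have h := hmin _ hx
    rwa [← hFA, ← hFA, LinearIsometryEquiv.apply_symm_apply] at h
  have hmeas : ∀ {t k}, 1 ≤ t → t ≤ T → k ≤ epochLen t →
      Measurable fun ω => vec (primal α X₀ u v t k ω) := fun h1 h2 h3 =>
    measurable_vec fun i j => (measurable_primal_sigmaRun (S := univ) (ξ := ξ) h1 h2 h3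
      (fun _ _ _ => mem_univ _) i j).mono (hrun.sigmaRun_le univ) le_rfl
  have hPK : ∀ {t k}, 1 ≤ t → t ≤ T → k ≤ epochLen t → ∀ ω,
      vec (primal α X₀ u v t k ω) ∈ K := fun h1 h2 h3 ω =>
    hvK (hrun.nuclearNorm_primal_le hα h1 h2 h3 ω)
  set a : ℕ → ℕ → ℝ := fun t k => ∫ ω, (avg F (vec (primal α X₀ u v t k ω)) - avg F (vec Xs)) ∂μ
    with ha
  -- Two bounds may be missing: that of the snapshot gap in the first epoch, and that of the current
  -- gap at k = 0. The disjunctions in the hypotheses record these cases.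
  have hstep : ∀ t k, 1 ≤ t → t ≤ T → k + 1 ≤ epochLen t →
      (t = 1 ∨ a t 0 ≤ L * (2 * α) ^ 2 * (1 + δ) / 2 ^ t) →
      (k = 0 ∨ a t k ≤ 4 * (L * (2 * α) ^ 2 * (1 + δ)) / ((k : ℝ) + 2)) →
      a t (k + 1) ≤ 4 * (L * (2 * α) ^ 2 * (1 + δ)) / (((k + 1 : ℕ) : ℝ) + 2) := by
    intro t k ht htT hk h0 hak
    have hs : IsStep T t (k + 1) := ⟨ht, htT, by omega, hk⟩
    have hm : ∀ k', k' ≤ k → Measurable[sigmaRun T X₀ ξ u v (before t (k + 1))]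
        fun ω => vec (primal α X₀ u v t k' ω) := fun k' hk' =>
      measurable_vec fun i j => measurable_primal_sigmaRun ht htT (by omega) (fun t' k'' h => by
        rcases h with h | ⟨h, h'⟩
        · exact Or.inl h
        · exact Or.inr ⟨h, by simp only; omega⟩) i j
    have hb2 : L ^ 2 * (2 * α) ^ 2 / (batchSize (k + 1) : ℝ) ≤
          (L * (2 * α) * (1 + δ) / ((k : ℝ) + 2)) ^ 2 ∨
        4 * L / (batchSize (k + 1) : ℝ) * (a t k + a t 0) ≤
          (L * (2 * α) * (1 + δ) / ((k : ℝ) + 2)) ^ 2 := by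
      rcases h0 with rfl | h0
      · exact Or.inl (first_epoch_variance_le hδ hk)
      · refine Or.inr (later_epoch_variance_le hL0 hδ ?_ h0 hk)
        -- At k = 0 the current point is the snapshot, and C/2^t ≤ C/2 ≤ 2C = 4C/(0+2).
        rcases hak with rfl | hak
        · refine h0.trans ?_
          have : (2 : ℝ) ^ 1 ≤ 2 ^ t := pow_le_pow_right₀ one_le_two ht
          rw [div_le_div_iff₀ (by positivity) (by positivity)]
          have hC : 0 ≤ L * (2 * α) ^ 2 * (1 + δ) := by positivity
          push_cast
          nlinarith
        · exact hak
    have h := integral_avg_step_le (μ := μ) hd hFd hFc hL0 hFL hK hKD (hvK hXs) hKmin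
      (M := batchSize (k + 1)) (by simp [batchSize]) (hrun.sigmaRun_le (before t (k + 1)))
      (ξ := fun j => ξ t (k + 1) j)
      (fun j => hrun.measurable_sample t (k + 1) hs j j.2)
      (fun j => hrun.uniform_sample t (k + 1) hs j j.2)
      (hrun.indep_batch t (k + 1) hs) (hrun.indep_past t (k + 1) hs) (hm k le_rfl)
      (hm 0 (Nat.zero_le _))
      (s := fun ω => vec (atom α (u t (k + 1) ω) (v t (k + 1) ω)))
      (measurable_vec fun i j => by
        simp only [atom_apply]
        have h4 : Measurable fun ω => u t (k + 1) ω i :=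
          (EuclideanSpace.proj i : EuclideanSpace ℝ (Fin m) →L[ℝ] ℝ).measurable.comp
            (hrun.measurable_left _ _ hs)
        have h5 : Measurable fun ω => v t (k + 1) ω j :=
          (EuclideanSpace.proj j : EuclideanSpace ℝ (Fin n) →L[ℝ] ℝ).measurable.comp
            (hrun.measurable_right _ _ hs)
        exact ((h4.mul h5).const_mul α).neg)
      (hPK ht htT (by omega)) (hPK ht htT (Nat.zero_le _))
      (fun ω => hvK (nuclearNorm_atom_le hα (hrun.feasible_oracle t (k + 1) hs ω)))
      (gam_nonneg (k + 1)) (gam_le_one (by omega))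
      (hrun.oracle_vec hdiff hs hXs) (by positivity) hb2
    exact h.trans (epoch_step_le hL0 hδ hak)
  have hepoch : ∀ t, 1 ≤ t → t ≤ T →
      (t = 1 ∨ a t 0 ≤ L * (2 * α) ^ 2 * (1 + δ) / 2 ^ t) → ∀ k, k + 1 ≤ epochLen t →
      a t (k + 1) ≤ 4 * (L * (2 * α) ^ 2 * (1 + δ)) / (((k + 1 : ℕ) : ℝ) + 2) := by
    intro t ht htT h0 k
    induction k with
    | zero =>
      intro hk
      exact hstep t 0 ht htT hk h0 (Or.inl rfl)
    | succ k ih =>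
      intro hk
      exact hstep t (k + 1) ht htT hk h0 (Or.inr (ih (by omega)))
  have hmain : ∀ t, 1 ≤ t → t ≤ T →
      a t (epochLen t) ≤ L * (2 * α) ^ 2 * (1 + δ) / 2 ^ (t + 1) := by
    have hend : ∀ t, 1 ≤ t → t ≤ T →
        (t = 1 ∨ a t 0 ≤ L * (2 * α) ^ 2 * (1 + δ) / 2 ^ t) →
        a t (epochLen t) ≤ L * (2 * α) ^ 2 * (1 + δ) / 2 ^ (t + 1) := by
      intro t ht htT h0
      obtain ⟨N, hN⟩ := Nat.exists_eq_add_of_le' (one_le_epochLen t)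
      have h := hepoch t ht htT h0 N hN.ge
      rw [← hN, epochLen_add_two] at h
      refine h.trans_eq ?_
      rw [pow_succ]; field_simp; ring
    intro t ht
    induction t, ht using Nat.le_induction with
    | base => exact fun hT => hend 1 le_rfl hT (Or.inl rfl)
    | succ t ht ih =>
      intro hT
      refine hend (t + 1) (by omega) hT (Or.inr ?_)
      have h := ih (by omega)
      -- With t written as a successor, the last point of one epoch and the first point of the next
      -- agree by definition.
      obtain ⟨s, rfl⟩ := Nat.exists_eq_add_of_le' ht
      exact h
  constructor
  · have := integrable_avg_comp (μ := μ) hd hFd hL0 hFL hKD (hvK hXs) hKmin (hmeas ht htT le_rfl)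
      (hPK ht htT le_rfl)
    simpa only [hFA] using this
  · have := hmain t ht htT
    simpa only [ha, hFA] using this

end Convergence

/-! ### Standard Gaussian vectors -/

section Gaussian

open scoped ENNReal

theorem integral_exp_neg_mul_sq_gaussianReal {c : ℝ} (hc : 0 ≤ c) :
    ∫ x, Real.exp (-c * x ^ 2) ∂gaussianReal 0 1 = (1 + 2 * c) ^ (-(1 / 2 : ℝ)) := by
  rw [integral_gaussianReal_eq_integral_smul one_ne_zero]
  have h : ∀ x : ℝ, gaussianPDFReal 0 1 x • Real.exp (-c * x ^ 2) =
      (√(2 * Real.pi))⁻¹ * Real.exp (-(1 / 2 + c) * x ^ 2) := by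
    intro x
    rw [gaussianPDFReal, smul_eq_mul, mul_assoc, ← Real.exp_add]
    congr 2
    · simp
    · simp; ring
  simp_rw [h]
  rw [integral_const_mul, integral_gaussian, ← Real.sqrt_inv, ← Real.sqrt_mul (by positivity),
    Real.rpow_neg (by positivity), ← Real.sqrt_eq_rpow, ← Real.sqrt_inv]
  congr 1
  have := Real.pi_pos
  field_simp

theorem lintegral_exp_neg_mul_sum_sq {ι : Type*} [Fintype ι] {c : ℝ} (hc : 0 ≤ c) :
    ∫⁻ x, ENNReal.ofReal (Real.exp (-c * ∑ i, x i ^ 2))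
      ∂(Measure.pi fun _ : ι => gaussianReal 0 1) =
      ENNReal.ofReal ((1 + 2 * c) ^ (-(Fintype.card ι / 2 : ℝ))) := by
  have hint : Integrable (fun x : ι → ℝ => Real.exp (-c * ∑ i, x i ^ 2))
      (Measure.pi fun _ : ι => gaussianReal 0 1) := by
    refine Integrable.of_bound (Measurable.aestronglyMeasurable (by fun_prop)) 1
      (Filter.Eventually.of_forall fun x => ?_)
    rw [Real.norm_of_nonneg (Real.exp_nonneg _), Real.exp_le_one_iff]
    have : 0 ≤ ∑ i, x i ^ 2 := Finset.sum_nonneg fun i _ => sq_nonneg _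
    nlinarith
  rw [← ofReal_integral_eq_lintegral_ofReal hint
    (Filter.Eventually.of_forall fun x => Real.exp_nonneg _)]
  congr 1
  have h : ∀ x : ι → ℝ, Real.exp (-c * ∑ i, x i ^ 2) = ∏ i, Real.exp (-c * x i ^ 2) := by
    intro x
    rw [Finset.mul_sum, Real.exp_sum]
  simp_rw [h]
  rw [integral_fintype_prod_eq_prod (f := fun (_ : ι) (y : ℝ) => Real.exp (-c * y ^ 2))]
  simp_rw [integral_exp_neg_mul_sq_gaussianReal hc]
  rw [Finset.prod_const, Finset.card_univ, ← Real.rpow_natCast, ← Real.rpow_mul (by positivity)]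
  congr 1
  ring

/-- An integral representation of 1/y that decouples the coordinates when y is a sum of squares. For
y = 0 both sides are infinite. -/
theorem ofReal_inv_le_lintegral_exp {y : ℝ} (hy : 0 ≤ y) :
    (ENNReal.ofReal y)⁻¹ ≤ ∫⁻ c in Ioi (0 : ℝ), ENNReal.ofReal (Real.exp (-c * y)) := by
  rcases hy.eq_or_lt with rfl | hy
  · simp
  · have hint : IntegrableOn (fun c : ℝ => Real.exp (-c * y)) (Ioi 0) := by
      have := integrableOn_exp_mul_Ioi (a := -y) (by linarith) 0
      refine this.congr_fun (fun c _ => ?_) measurableSet_Ioi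
      simp only; congr 1; ring
    rw [← ofReal_integral_eq_lintegral_ofReal hint
      (Filter.Eventually.of_forall fun x => Real.exp_nonneg _)]
    have h1 : ∫ c in Ioi (0 : ℝ), Real.exp (-c * y) = y⁻¹ := by
      have := integral_exp_mul_Ioi (a := -y) (by linarith) 0
      simp only [mul_zero, Real.exp_zero] at this
      rw [show (-1 : ℝ) / -y = y⁻¹ by rw [neg_div_neg_eq, one_div]] at this
      rw [← this]
      congr 1 with c
      congr 1; ring
    rw [h1, ENNReal.ofReal_inv_of_pos hy]

theorem lintegral_rpow_Ioi {s : ℝ} (hs : 2 < s) :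
    ∫⁻ c in Ioi (0 : ℝ), ENNReal.ofReal ((1 + 2 * c) ^ (-(s / 2))) =
      ENNReal.ofReal (1 / (s - 2)) := by
  have hd : ∀ c ∈ Ici (0 : ℝ), HasDerivAt (fun c : ℝ => -(1 / (s - 2)) * (1 + 2 * c) ^ (1 - s / 2))
      ((1 + 2 * c) ^ (-(s / 2))) c := by
    intro c hc
    have hpos : (0 : ℝ) < 1 + 2 * c := by linarith [mem_Ici.mp hc]
    have h1 : HasDerivAt (fun c : ℝ => 1 + 2 * c) 2 c := by
      simpa using ((hasDerivAt_id c).const_mul 2).const_add 1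
    have h2 := (h1.rpow_const (p := 1 - s / 2) (Or.inl hpos.ne')).const_mul (-(1 / (s - 2)))
    have h3 : (1 : ℝ) - s / 2 - 1 = -(s / 2) := by ring
    have h4 : s - 2 ≠ 0 := by linarith
    have h5 : -(1 / (s - 2)) * (2 * (1 - s / 2) * (1 + 2 * c) ^ (1 - s / 2 - 1)) =
        (1 + 2 * c) ^ (-(s / 2)) := by
      rw [h3]; field_simp; ring
    rwa [h5] at h2
  have hnn : ∀ c ∈ Ioi (0 : ℝ), 0 ≤ (1 + 2 * c) ^ (-(s / 2)) := fun c hc =>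
    Real.rpow_nonneg (by linarith [mem_Ioi.mp hc]) _
  have hlim : Filter.Tendsto (fun c : ℝ => -(1 / (s - 2)) * (1 + 2 * c) ^ (1 - s / 2))
      Filter.atTop (nhds 0) := by
    have h1 : Filter.Tendsto (fun c : ℝ => 1 + 2 * c) Filter.atTop Filter.atTop :=
      Filter.tendsto_atTop_add_const_left _ _
        (Filter.Tendsto.const_mul_atTop two_pos Filter.tendsto_id)
    have h2 := (tendsto_rpow_neg_atTop (y := s / 2 - 1) (by linarith)).comp h1
    have h3 := h2.const_mul (-(1 / (s - 2)))
    rw [mul_zero] at h3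
    refine h3.congr fun c => ?_
    simp only [Function.comp_apply, neg_sub]
  have hint := integrableOn_Ioi_deriv_of_nonneg' hd hnn hlim
  rw [← ofReal_integral_eq_lintegral_ofReal hint, integral_Ioi_of_hasDerivAt_of_nonneg' hd hnn hlim]
  · simp
  · filter_upwards [ae_restrict_mem measurableSet_Ioi] with c hc using hnn c hc

/-- Write the inverse as an integral of exp(-c∑xᵢ²) over c > 0 and exchange the integrals. The
Laplace transform factorizes to (1+2c)^(-s/2), where s is the number of coordinates; for s > 2 its
integral is 1/(s-2). -/
theorem lintegral_inv_sum_sq_le {ι : Type*} [Fintype ι] (hι : 2 < Fintype.card ι) :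
    ∫⁻ x, (ENNReal.ofReal (∑ i, x i ^ 2))⁻¹ ∂(Measure.pi fun _ : ι => gaussianReal 0 1) ≤
      ENNReal.ofReal (1 / (Fintype.card ι - 2)) := by
  calc _ ≤ ∫⁻ x : ι → ℝ, (∫⁻ c in Ioi (0 : ℝ), ENNReal.ofReal (Real.exp (-c * ∑ i, x i ^ 2)))
        ∂(Measure.pi fun _ : ι => gaussianReal 0 1) :=
        lintegral_mono fun x => ofReal_inv_le_lintegral_exp
          (Finset.sum_nonneg fun i _ => sq_nonneg _)
    _ = ∫⁻ c in Ioi (0 : ℝ), ∫⁻ x, ENNReal.ofReal (Real.exp (-c * ∑ i, x i ^ 2))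
        ∂(Measure.pi fun _ : ι => gaussianReal 0 1) :=
        lintegral_lintegral_swap (Measurable.aemeasurable (by unfold Function.uncurry; fun_prop))
    _ = ∫⁻ c in Ioi (0 : ℝ), ENNReal.ofReal ((1 + 2 * c) ^ (-(Fintype.card ι / 2 : ℝ))) :=
        setLIntegral_congr_fun measurableSet_Ioi fun c hc =>
          lintegral_exp_neg_mul_sum_sq (le_of_lt hc)
    _ = _ := lintegral_rpow_Ioi (by exact_mod_cast hι)

variable {E : Type*} [NormedAddCommGroup E] [InnerProductSpace ℝ E] [FiniteDimensional ℝ E]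
  [MeasurableSpace E] [BorelSpace E]

theorem lintegral_inv_norm_sq_stdGaussian_le (hE : 2 < Module.finrank ℝ E) :
    ∫⁻ x, (ENNReal.ofReal (‖x‖ ^ 2))⁻¹ ∂(stdGaussian E) ≤
      ENNReal.ofReal (1 / (Module.finrank ℝ E - 2)) := by
  rw [stdGaussian, lintegral_map (by fun_prop) (by fun_prop)]
  have h : ∀ x : Fin (Module.finrank ℝ E) → ℝ, ‖∑ i, x i • stdOrthonormalBasis ℝ E i‖ ^ 2 =
      ∑ i, x i ^ 2 := by
    intro x
    rw [← (stdOrthonormalBasis ℝ E).sum_sq_norm_inner_right]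
    refine Finset.sum_congr rfl fun i _ => ?_
    rw [(stdOrthonormalBasis ℝ E).orthonormal.inner_right_fintype, Real.norm_eq_abs, sq_abs]
  simp_rw [h]
  have := lintegral_inv_sum_sq_le (ι := Fin (Module.finrank ℝ E)) (by simpa using hE)
  simpa using this

theorem map_orthogonalProjection_stdGaussian (S : Submodule ℝ E) :
    (stdGaussian E).map S.orthogonalProjectionOnto = stdGaussian S := by
  refine Measure.ext_of_charFun ?_
  ext t
  rw [charFun_stdGaussian, charFun_apply, integral_map (by fun_prop) (by fun_prop)]
  have h := charFun_stdGaussian (t : E)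
  rw [charFun_apply] at h
  rw [← S.coe_norm] at h
  rw [← h]
  refine integral_congr_ae (Filter.Eventually.of_forall fun x => ?_)
  simp only
  rw [Submodule.inner_orthogonalProjectionOnto_eq_of_mem_right]

/-- The component orthogonal to S is a standard Gaussian vector of dimension dim E - dim S, so this
is the inverse moment in that dimension. -/
theorem lintegral_inv_dist_sq_le (S : Submodule ℝ E)
    (hS : Module.finrank ℝ S + 2 < Module.finrank ℝ E) :
    ∫⁻ x, (ENNReal.ofReal (‖Sᗮ.orthogonalProjectionOnto x‖ ^ 2))⁻¹ ∂(stdGaussian E) ≤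
      ENNReal.ofReal (1 / (Module.finrank ℝ E - Module.finrank ℝ S - 2)) := by
  have hdim := S.finrank_add_finrank_orthogonal
  have h := lintegral_inv_norm_sq_stdGaussian_le (E := Sᗮ) (by omega)
  rw [← map_orthogonalProjection_stdGaussian, lintegral_map (by fun_prop) (by fun_prop)] at h
  refine h.trans_eq ?_
  rw [← hdim]; push_cast; congr 3; ring

/-- A proper subspace lies in the kernel of ⟨e, ·⟩ for some e ≠ 0, and that functional has a
nondegenerate, hence atomless, Gaussian law. -/
theorem stdGaussian_submodule_eq_zero {S : Submodule ℝ E} (hS : S ≠ ⊤) :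
    stdGaussian E (S : Set E) = 0 := by
  obtain ⟨e, heS, he0⟩ := Submodule.exists_mem_ne_zero_of_ne_bot
    (fun h => hS (Submodule.orthogonal_eq_bot_iff.mp h))
  set ℓ : StrongDual ℝ E := InnerProductSpace.toDual ℝ E e with hℓ
  have hv : Var[ℓ; stdGaussian E].toNNReal ≠ 0 := by
    rw [variance_dual_stdGaussian, hℓ, LinearIsometryEquiv.norm_map]
    simpa using he0
  have hmap : (stdGaussian E).map ℓ {0} = 0 := by
    rw [IsGaussian.map_eq_gaussianReal]
    have := nullSingletonClass_gaussianReal (μ := (stdGaussian E)[ℓ]) hv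
    exact measure_singleton 0
  rw [Measure.map_apply (by fun_prop) (measurableSet_singleton 0)] at hmap
  refine measure_mono_null (fun x hx => ?_) hmap
  simpa [hℓ] using (Submodule.mem_orthogonal' S e).mp heS x hx

/-- The mean square of a linear functional of a standard Gaussian vector. -/
theorem lintegral_inner_sq_stdGaussian (t : E) :
    ∫⁻ x, ENNReal.ofReal (inner ℝ t x ^ 2) ∂(stdGaussian E) = ENNReal.ofReal (‖t‖ ^ 2) := by
  have hv := variance_dual_stdGaussian (InnerProductSpace.toDual ℝ E t)
  have hm : MemLp (InnerProductSpace.toDual ℝ E t) 2 (stdGaussian E) :=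
    IsGaussian.memLp_dual _ _ 2 (by simp)
  rw [variance_eq_sub hm, integral_strongDual_stdGaussian, LinearIsometryEquiv.norm_map] at hv
  rw [← hv, ← ofReal_integral_eq_lintegral_ofReal]
  · simp
  · exact hm.integrable_sq
  · exact Filter.Eventually.of_forall fun x => sq_nonneg _

theorem map_toLp_pi_stdGaussian (ι : Type*) [Fintype ι] :
    (Measure.pi fun _ : ι => stdGaussian E).map (WithLp.toLp 2) =
      stdGaussian (PiLp 2 fun _ : ι => E) := by
  refine Measure.ext_of_charFun ?_
  ext t
  rw [charFun_pi, charFun_stdGaussian]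
  simp_rw [charFun_stdGaussian, ← Complex.exp_sum]
  rw [← Complex.ofReal_pow, PiLp.norm_sq_eq_of_L2]
  simp [← Finset.sum_div]

/-- The mean square of a linear functional of a linear combination of independent standard Gaussian
vectors. -/
theorem lintegral_inner_sum_smul_sq {ι : Type*} [Fintype ι] (t : E) (c : ι → ℝ) :
    ∫⁻ h, ENNReal.ofReal (inner ℝ t (∑ k, c k • h k) ^ 2)
      ∂(Measure.pi fun _ : ι => stdGaussian E) = ENNReal.ofReal (‖t‖ ^ 2 * ∑ k, c k ^ 2) := by
  -- The h k jointly form one standard Gaussian vector, and the functional is its inner product with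
  -- the block vector (c k • t)ₖ.
  have h := lintegral_inner_sq_stdGaussian (E := PiLp 2 fun _ : ι => E)
    (WithLp.toLp 2 fun k => c k • t)
  rw [← map_toLp_pi_stdGaussian, lintegral_map (by fun_prop) (by fun_prop)] at h
  have e : ‖(WithLp.toLp 2 fun k => c k • t : PiLp 2 fun _ : ι => E)‖ ^ 2 =
      ‖t‖ ^ 2 * ∑ k, c k ^ 2 := by
    rw [PiLp.norm_sq_eq_of_L2, Finset.mul_sum]
    refine Finset.sum_congr rfl fun k _ => ?_
    simp [norm_smul, mul_pow, mul_comm]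
  rw [← e, ← h]
  refine lintegral_congr fun x => ?_
  simp [PiLp.inner_apply, inner_sum, real_inner_smul_left, real_inner_smul_right]

end Gaussian

/-! ### The dual family of independent Gaussian vectors -/

section DualFamily

open scoped ENNReal

theorem measurable_det_of_entries {Ω ι : Type*} [MeasurableSpace Ω] [Fintype ι] [DecidableEq ι]
    {M : Ω → Matrix ι ι ℝ} (hM : ∀ i j, Measurable fun ω => M ω i j) :
    Measurable fun ω => (M ω).det := by
  simp only [Matrix.det_apply]
  exact Finset.measurable_fun_sum _ fun σ _ =>
    (Finset.measurable_fun_prod _ fun i _ => hM (σ i) i).const_smul _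

theorem measurable_inv_of_entries {Ω ι : Type*} [MeasurableSpace Ω] [Fintype ι] [DecidableEq ι]
    {M : Ω → Matrix ι ι ℝ} (hM : ∀ i j, Measurable fun ω => M ω i j) (i j : ι) :
    Measurable fun ω => (M ω)⁻¹ i j := by
  simp only [Matrix.inv_def, Matrix.smul_apply, smul_eq_mul, Ring.inverse_eq_inv,
    Matrix.adjugate_apply]
  refine (measurable_det_of_entries hM).inv.mul (measurable_det_of_entries fun a b => ?_)
  simp only [Matrix.updateRow_apply]
  split_ifs
  · exact measurable_const
  · exact hM a b

variable {V : Type*} [NormedAddCommGroup V] [InnerProductSpace ℝ V] {ι : Type*} [Fintype ι]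
  [DecidableEq ι]

/-- The dual family, in the span, of a linearly independent family. -/
noncomputable def dualFamily (g : ι → V) (i : ι) : V :=
  ∑ j, (Matrix.gram ℝ g)⁻¹ i j • g j

theorem inner_dualFamily {g : ι → V} (hg : (Matrix.gram ℝ g).det ≠ 0) (i k : ι) :
    inner ℝ (dualFamily g i) (g k) = if i = k then 1 else 0 := by
  have h := congrFun (congrFun (Matrix.nonsing_inv_mul _ (Ne.isUnit hg)) i) k
  rw [Matrix.mul_apply, Matrix.one_apply] at h
  rw [← h, dualFamily, sum_inner]
  simp only [real_inner_smul_left, Matrix.gram_apply]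

/-- The dual vector is orthogonal to every g j with j ≠ i and lies in the span of the family, so it
is a multiple of the component w of g i orthogonal to S. Its inner product with w is 1, hence its
norm is 1/‖w‖. -/
theorem norm_dualFamily_sq_le [FiniteDimensional ℝ V] (g : ι → V) (i : ι) (S : Submodule ℝ V)
    (hS : S = Submodule.span ℝ (g '' {j | j ≠ i})) :
    ENNReal.ofReal (‖dualFamily g i‖ ^ 2) ≤
      (ENNReal.ofReal (‖Sᗮ.orthogonalProjectionOnto (g i)‖ ^ 2))⁻¹ := by
  by_cases hg : (Matrix.gram ℝ g).det = 0
  · have h0 : dualFamily g i = 0 := by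
      simp [dualFamily, Matrix.inv_def, hg]
    simp [h0]
  have hgS : ∀ j, j ≠ i → g j ∈ S := fun j hj => by
    rw [hS]; exact Submodule.subset_span ⟨j, hj, rfl⟩
  set d := dualFamily g i with hd
  have hdS : d ∈ Sᗮ := by
    rw [Submodule.mem_orthogonal']
    intro x hx
    rw [hS] at hx
    induction hx using Submodule.span_induction with
    | mem x hx =>
      obtain ⟨j, hj, rfl⟩ := hx
      rw [inner_dualFamily hg, if_neg (Ne.symm hj)]
    | zero => simp
    | add x y _ _ hx hy => rw [inner_add_right, hx, hy, add_zero]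
    | smul a x _ hx => rw [real_inner_smul_right, hx, mul_zero]
  set w : V := (Sᗮ.orthogonalProjectionOnto (g i) : V) with hw
  set c := (Matrix.gram ℝ g)⁻¹ i i with hc
  have hwS : w ∈ Sᗮ := Submodule.coe_mem _
  have hgw : g i - w ∈ S := by
    have := Submodule.sub_starProjection_mem_orthogonal (K := Sᗮ) (g i)
    rwa [Submodule.orthogonal_orthogonal] at this
  have hdw : inner ℝ d w = 1 := by
    have h1 : inner ℝ d (g i - w) = 0 := (Submodule.mem_orthogonal' S d).mp hdS _ hgw
    rw [inner_sub_right, inner_dualFamily hg, if_pos rfl] at h1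
    linarith
  have hdc : d = c • w := by
    have h1 : d - c • w ∈ S := by
      have h2 : d - c • w = ∑ j ∈ Finset.univ.erase i, (Matrix.gram ℝ g)⁻¹ i j • g j
          + c • (g i - w) := by
        rw [hd, dualFamily, ← Finset.sum_erase_add _ _ (Finset.mem_univ i), smul_sub]
        abel
      rw [h2]
      exact S.add_mem (S.sum_mem fun j hj => S.smul_mem _ (hgS j (Finset.ne_of_mem_erase hj)))
        (S.smul_mem _ hgw)
    have h3 : d - c • w ∈ Sᗮ := Sᗮ.sub_mem hdS (Sᗮ.smul_mem _ hwS)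
    exact sub_eq_zero.mp (Submodule.disjoint_def.mp S.orthogonal_disjoint _ h1 h3)
  have hprod : ‖d‖ ^ 2 * ‖w‖ ^ 2 = 1 := by
    have h1 : inner ℝ d w = c * ‖w‖ ^ 2 := by
      conv_lhs => rw [hdc]
      rw [real_inner_smul_left, real_inner_self_eq_norm_sq]
    rw [hdw] at h1
    have h2 : ‖d‖ ^ 2 = c ^ 2 * ‖w‖ ^ 2 := by
      rw [hdc, norm_smul, mul_pow, Real.norm_eq_abs, sq_abs]
    rw [h2]
    calc c ^ 2 * ‖w‖ ^ 2 * ‖w‖ ^ 2 = (c * ‖w‖ ^ 2) ^ 2 := by ring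
      _ = 1 := by rw [← h1]; norm_num
  have hwpos : 0 < ‖w‖ ^ 2 := by
    rcases (sq_nonneg ‖w‖).eq_or_lt with h | h
    · rw [← h, mul_zero] at hprod; exact absurd hprod zero_ne_one
    · exact h
  have hnw : ‖Sᗮ.orthogonalProjectionOnto (g i)‖ = ‖w‖ := by rw [hw, Submodule.coe_norm]
  rw [hnw, ← ENNReal.ofReal_inv_of_pos hwpos, eq_inv_of_mul_eq_one_left hprod]

variable [FiniteDimensional ℝ V] [MeasurableSpace V] [BorelSpace V]

omit [Fintype ι] [DecidableEq ι] in
theorem measurable_gram_apply (i j : ι) :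
    Measurable fun g : ι → V => Matrix.gram ℝ g i j := by
  simp only [Matrix.gram_apply]
  exact (measurable_pi_apply i).inner (measurable_pi_apply j)

theorem measurable_dualFamily (i : ι) : Measurable fun g : ι → V => dualFamily g i := by
  unfold dualFamily
  exact Finset.measurable_fun_sum _ fun j _ =>
    (measurable_inv_of_entries measurable_gram_apply i j).smul (measurable_pi_apply j)

/-- Induction on the number of vectors: the added vector almost surely avoids the span of the
others, a proper subspace by dimension and therefore a null set. -/
theorem ae_det_gram_ne_zero {p : ℕ} (hp : p ≤ Module.finrank ℝ V) :
    ∀ᵐ g ∂(Measure.pi fun _ : Fin p => stdGaussian V), (Matrix.gram ℝ g).det ≠ 0 := by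
  induction p with
  | zero => simp
  | succ p ih =>
    have hmp := measurePreserving_piFinSuccAbove (fun _ : Fin (p + 1) => stdGaussian V) 0
    have hmeas : MeasurableSet {z : V × (Fin p → V) |
        (Matrix.gram ℝ (Fin.cons z.1 z.2 : Fin (p + 1) → V)).det ≠ 0} := by
      refine (measurableSet_eq_fun (measurable_det_of_entries ?_) measurable_const).compl
      intro i j
      have : ∀ k : Fin (p + 1), Measurable fun z : V × (Fin p → V) =>
          (Fin.cons z.1 z.2 : Fin (p + 1) → V) k := by
        intro k
        refine Fin.cases ?_ (fun k => ?_) k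
        · simpa using measurable_fst
        · exact (measurable_pi_apply k).comp measurable_snd
      exact (this i).inner (this j)
    have h : ∀ᵐ z ∂((stdGaussian V).prod (Measure.pi fun _ : Fin p => stdGaussian V)),
        (Matrix.gram ℝ (Fin.cons z.1 z.2 : Fin (p + 1) → V)).det ≠ 0 := by
      rw [Measure.ae_prod_iff_ae_ae hmeas, Measure.ae_ae_comm hmeas]
      filter_upwards [ih (by omega)] with g hg
      rw [Matrix.det_gram_ne_zero_iff_linearIndependent] at hg
      have hne : Submodule.span ℝ (Set.range g) ≠ ⊤ := by
        intro htop
        have h1 := finrank_range_le_card (R := ℝ) g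
        rw [Set.finrank, htop, finrank_top, Fintype.card_fin] at h1
        omega
      have h0 := stdGaussian_submodule_eq_zero hne
      filter_upwards [compl_mem_ae_iff.mpr h0] with x hx
      rw [Matrix.det_gram_ne_zero_iff_linearIndependent, linearIndependent_finCons]
      exact ⟨hg, hx⟩
    have h2 := hmp.quasiMeasurePreserving.ae h
    filter_upwards [h2] with g hg
    have e : (Fin.cons (g 0) (fun j => g (Fin.succ j)) : Fin (p + 1) → V) = g :=
      Fin.cons_self_tail g
    convert hg using 3
    exact e.symm

/-- Conditioned on the other p - 1 vectors, g i is still standard Gaussian and their span has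
dimension at most p - 1. The inverse squared distance has mean at most 1/(q-(p-1)-2) = 1/(q-p-1),
with q the dimension of V. -/
theorem lintegral_norm_dualFamily_sq_le {p : ℕ} (hp : p + 2 ≤ Module.finrank ℝ V) (i : Fin p) :
    ∫⁻ g, ENNReal.ofReal (‖dualFamily g i‖ ^ 2) ∂(Measure.pi fun _ : Fin p => stdGaussian V) ≤
      ENNReal.ofReal (1 / (Module.finrank ℝ V - p - 1)) := by
  obtain ⟨p, rfl⟩ : ∃ p', p = p' + 1 := ⟨p - 1, by have := i.pos; omega⟩
  have hmp := (measurePreserving_piFinSuccAbove (fun _ : Fin (p + 1) => stdGaussian V) i).symm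
  rw [← hmp.lintegral_comp_emb (MeasurableEquiv.measurableEmbedding _),
    lintegral_prod_symm' _ (by
      exact (((measurable_dualFamily i).comp hmp.measurable).norm.pow_const 2).ennreal_ofReal)]
  refine (lintegral_mono (g := fun _ => ENNReal.ofReal
    (1 / (Module.finrank ℝ V - (p + 1 : ℕ) - 1))) fun g => ?_).trans (by simp)
  set S := Submodule.span ℝ (Set.range g) with hS
  have hfin : Module.finrank ℝ S ≤ p := by
    have h1 := finrank_range_le_card (R := ℝ) g
    rwa [Set.finrank, Fintype.card_fin] at h1
  calc _ ≤ ∫⁻ x, (ENNReal.ofReal (‖Sᗮ.orthogonalProjectionOnto x‖ ^ 2))⁻¹ ∂(stdGaussian V) := by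
        refine lintegral_mono fun x => ?_
        have hins : (MeasurableEquiv.piFinSuccAbove (fun _ => V) i).symm (x, g) =
            i.insertNth x g := rfl
        have h := norm_dualFamily_sq_le ((MeasurableEquiv.piFinSuccAbove (fun _ => V) i).symm (x, g))
          i S (by
            rw [hS]
            congr 1
            ext y
            simp only [mem_range, mem_image, mem_ofPred_eq]
            constructor
            · rintro ⟨j, rfl⟩
              exact ⟨i.succAbove j, i.succAbove_ne j, by simp [hins]⟩
            · rintro ⟨j, hj, rfl⟩
              obtain ⟨j, rfl⟩ := Fin.exists_succAbove_eq hj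
              exact ⟨j, by simp [hins]⟩)
        have e : (MeasurableEquiv.piFinSuccAbove (fun _ => V) i).symm (x, g) i = x := by
          simp [hins]
        rw [e] at h
        exact h
    _ ≤ ENNReal.ofReal (1 / (Module.finrank ℝ V - Module.finrank ℝ S - 2)) :=
        lintegral_inv_dist_sq_le S (by omega)
    _ ≤ _ := by
        apply ENNReal.ofReal_le_ofReal
        have h1 : (Module.finrank ℝ S : ℝ) ≤ p := by exact_mod_cast hfin
        have h2 : (p : ℝ) + 3 ≤ Module.finrank ℝ V := by exact_mod_cast hp
        apply one_div_le_one_div_of_le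
        · push_cast; linarith
        · push_cast; linarith

/-- The mean square of the product of the pseudoinverse of a Gaussian matrix with an independent
Gaussian matrix. -/
theorem lintegral_sum_inner_dualFamily_sq_le {p : ℕ} (hp : p + 2 ≤ Module.finrank ℝ V)
    {κ β : Type*} [Fintype κ] [Fintype β] (c : β → κ → ℝ) :
    ∫⁻ z, ENNReal.ofReal (∑ i, ∑ b, inner ℝ (dualFamily z.1 i) (∑ k, c b k • z.2 k) ^ 2)
      ∂((Measure.pi fun _ : Fin p => stdGaussian V).prod
        (Measure.pi fun _ : κ => stdGaussian V)) ≤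
      ENNReal.ofReal (p / (Module.finrank ℝ V - p - 1) * ∑ b, ∑ k, c b k ^ 2) := by
  have hm : ∀ i b, Measurable fun z : (Fin p → V) × (κ → V) =>
      ENNReal.ofReal (inner ℝ (dualFamily z.1 i) (∑ k, c b k • z.2 k) ^ 2) := by
    intro i b
    refine (Measurable.pow_const (Measurable.inner ((measurable_dualFamily i).comp measurable_fst)
      ?_) 2).ennreal_ofReal
    exact Finset.measurable_fun_sum _ fun k _ =>
      ((measurable_pi_apply k).comp measurable_snd).const_smul _
  have hq : (0 : ℝ) < Module.finrank ℝ V - p - 1 := by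
    have : (p : ℝ) + 2 ≤ Module.finrank ℝ V := by exact_mod_cast hp
    linarith
  have hterm : ∀ i b, ∫⁻ z, ENNReal.ofReal (inner ℝ (dualFamily z.1 i) (∑ k, c b k • z.2 k) ^ 2)
      ∂((Measure.pi fun _ : Fin p => stdGaussian V).prod
        (Measure.pi fun _ : κ => stdGaussian V)) ≤
      ENNReal.ofReal (1 / (Module.finrank ℝ V - p - 1) * ∑ k, c b k ^ 2) := by
    intro i b
    -- With the first factor fixed, integrating the second gives ‖dualFamily g i‖² ∑ₖ c b k²; only
    -- the mean square of the dual vector remains.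
    rw [lintegral_prod _ (hm i b).aemeasurable]
    simp only [lintegral_inner_sum_smul_sq]
    have h0 : 0 ≤ ∑ k, c b k ^ 2 := Finset.sum_nonneg fun k _ => sq_nonneg _
    simp_rw [ENNReal.ofReal_mul' h0]
    rw [lintegral_mul_const' _ _ ENNReal.ofReal_ne_top]
    gcongr
    exact lintegral_norm_dualFamily_sq_le hp i
  have e : ∀ z : (Fin p → V) × (κ → V),
      ENNReal.ofReal (∑ i, ∑ b, inner ℝ (dualFamily z.1 i) (∑ k, c b k • z.2 k) ^ 2) =
      ∑ i, ∑ b, ENNReal.ofReal (inner ℝ (dualFamily z.1 i) (∑ k, c b k • z.2 k) ^ 2) := by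
    intro z
    rw [ENNReal.ofReal_sum_of_nonneg fun i _ => Finset.sum_nonneg fun b _ => sq_nonneg _]
    refine Finset.sum_congr rfl fun i _ => ?_
    rw [ENNReal.ofReal_sum_of_nonneg fun b _ => sq_nonneg _]
  simp_rw [e]
  rw [lintegral_finsetSum _ fun i _ => Finset.measurable_fun_sum _ fun b _ => hm i b]
  simp_rw [lintegral_finsetSum _ fun b _ => hm _ b]
  refine (Finset.sum_le_sum fun i _ => Finset.sum_le_sum fun b _ => hterm i b).trans ?_
  rw [← ENNReal.ofReal_sum_of_nonneg fun b _ => mul_nonneg (by positivity)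
    (Finset.sum_nonneg fun k _ => sq_nonneg _), ← ENNReal.ofReal_sum_of_nonneg fun i _ =>
    Finset.sum_nonneg fun b _ => mul_nonneg (by positivity)
    (Finset.sum_nonneg fun k _ => sq_nonneg _)]
  apply ENNReal.ofReal_le_ofReal
  rw [← Finset.mul_sum, Finset.sum_const, Finset.card_univ, Fintype.card_fin, nsmul_eq_mul]
  exact le_of_eq (by ring)

end DualFamily

/-! ### Sketching with a Gaussian matrix -/

section GaussianMatrix

open scoped ENNReal

variable {κ : Type*} {q N : ℕ}

/-- A matrix with given entries. -/
def matrixOf (e : Fin q × Fin N ≃ κ) (x : κ → ℝ) : Matrix (Fin q) (Fin N) ℝ :=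
  Matrix.of fun a j => x (e (a, j))

/-- The image of a vector under the matrix with given entries. -/
noncomputable def imageOf (e : Fin q × Fin N ≃ κ) (x : κ → ℝ) (w : EuclideanSpace ℝ (Fin N)) :
    EuclideanSpace ℝ (Fin q) :=
  WithLp.toLp 2 (matrixOf e x *ᵥ w.ofLp)

theorem imageOf_apply (e : Fin q × Fin N ≃ κ) (x : κ → ℝ) (w : EuclideanSpace ℝ (Fin N))
    (a : Fin q) : imageOf e x w a = ∑ j, x (e (a, j)) * w j := rfl

theorem imageOf_sum_smul (e : Fin q × Fin N ≃ κ) (x : κ → ℝ) {ι : Type*} [Fintype ι] (c : ι → ℝ)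
    (w : ι → EuclideanSpace ℝ (Fin N)) :
    imageOf e x (∑ i, c i • w i) = ∑ i, c i • imageOf e x (w i) := by
  ext a
  simp only [imageOf_apply, WithLp.ofLp_sum, WithLp.ofLp_smul, Finset.sum_apply, Pi.smul_apply,
    smul_eq_mul, Finset.mul_sum]
  rw [Finset.sum_comm]
  exact Finset.sum_congr rfl fun i _ => Finset.sum_congr rfl fun j _ => by ring

variable [Fintype κ] {ι : Type*} [Fintype ι]

omit [Fintype κ] in
theorem measurable_imageOf (e : Fin q × Fin N ≃ κ)
    (w : OrthonormalBasis ι ℝ (EuclideanSpace ℝ (Fin N))) :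
    Measurable fun (x : κ → ℝ) i => imageOf e x (w i) := by
  refine measurable_pi_lambda _ fun i => (WithLp.measurable_toLp 2 _).comp ?_
  refine measurable_pi_lambda _ fun a => ?_
  change Measurable fun x : κ → ℝ => ∑ j, x (e (a, j)) * w i j
  exact Finset.measurable_fun_sum _ fun j _ =>
    (measurable_pi_apply (X := fun _ : κ => ℝ) (e (a, j))).mul_const _

/-- The images of an orthonormal basis as a linear isometry. -/
noncomputable def imageIsometry (e : Fin q × Fin N ≃ κ)
    (w : OrthonormalBasis ι ℝ (EuclideanSpace ℝ (Fin N))) :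
    EuclideanSpace ℝ κ →ₗᵢ[ℝ] PiLp 2 fun _ : ι => EuclideanSpace ℝ (Fin q) where
  toFun x := WithLp.toLp 2 fun i => imageOf e x.ofLp (w i)
  map_add' x y := by
    ext i a
    simp [imageOf_apply, add_mul, Finset.sum_add_distrib]
  map_smul' c x := by
    ext i a
    simp [imageOf_apply, mul_assoc, Finset.mul_sum]
  norm_map' x := by
    refine (sq_eq_sq₀ (norm_nonneg _) (norm_nonneg _)).mp ?_
    change ‖(WithLp.toLp 2 fun i => imageOf e x.ofLp (w i) :
      PiLp 2 fun _ : ι => EuclideanSpace ℝ (Fin q))‖ ^ 2 = ‖x‖ ^ 2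
    rw [PiLp.norm_sq_eq_of_L2, EuclideanSpace.real_norm_sq_eq]
    simp only [EuclideanSpace.real_norm_sq_eq]
    rw [Finset.sum_comm, ← e.sum_comp, Fintype.sum_prod_type]
    refine Finset.sum_congr rfl fun a _ => ?_
    have h := w.sum_sq_norm_inner_left (WithLp.toLp 2 fun j => x (e (a, j)))
    rw [EuclideanSpace.real_norm_sq_eq] at h
    rw [← h]
    refine Finset.sum_congr rfl fun i _ => ?_
    rw [Real.norm_eq_abs, sq_abs, imageOf_apply, PiLp.inner_apply]
    simp [mul_comm]

/-- The images of an orthonormal basis under a Gaussian matrix are independent standard Gaussian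
vectors. -/
theorem map_imageOf_gaussian (e : Fin q × Fin N ≃ κ)
    (w : OrthonormalBasis ι ℝ (EuclideanSpace ℝ (Fin N))) :
    (Measure.pi fun _ : κ => gaussianReal 0 1).map (fun x i => imageOf e x (w i)) =
      Measure.pi fun _ : ι => stdGaussian (EuclideanSpace ℝ (Fin q)) := by
  have hcard : Fintype.card ι = N := by
    have := Module.finrank_eq_card_basis w.toBasis
    rw [finrank_euclideanSpace_fin] at this
    exact this.symm
  have hfin : Module.finrank ℝ (EuclideanSpace ℝ κ) =
      Module.finrank ℝ (PiLp 2 fun _ : ι => EuclideanSpace ℝ (Fin q)) := by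
    rw [finrank_euclideanSpace, ← Fintype.card_congr e,
      (WithLp.linearEquiv 2 ℝ (ι → EuclideanSpace ℝ (Fin q))).finrank_eq,
      Module.finrank_pi_fintype]
    simp [hcard, mul_comm]
  -- Equal dimensions make the isometry an equivalence, and a linear isometric equivalence preserves
  -- the standard Gaussian law.
  have h1 := stdGaussian_map ((imageIsometry e w).toLinearIsometryEquiv hfin)
  rw [← map_pi_eq_stdGaussian, ← map_toLp_pi_stdGaussian,
    Measure.map_map (LinearIsometryEquiv.continuous _).measurable (by fun_prop)] at h1
  have h2 := congrArg (Measure.map (WithLp.ofLp (p := 2))) h1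
  rw [Measure.map_map (by fun_prop) ((LinearIsometryEquiv.continuous _).measurable.comp
    (by fun_prop)), Measure.map_map (by fun_prop) (by fun_prop)] at h2
  have h3 : (WithLp.ofLp ∘ WithLp.toLp 2 : (ι → EuclideanSpace ℝ (Fin q)) → _) = id := rfl
  rw [h3, Measure.map_id] at h2
  exact h2

/-- The second moment of the product of the pseudoinverse of one part of a Gaussian matrix with an
orthogonal part. -/
theorem lintegral_norm_pinv_mul_sq_le {p b : ℕ} (e : Fin q × Fin N ≃ κ)
    {S : Matrix (Fin N) (Fin p) ℝ} (hS : Sᵀ * S = 1) {Z : Matrix (Fin N) (Fin b) ℝ}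
    (hZ : Sᵀ * Z = 0) (hp : p + 2 ≤ q) :
    (∀ᵐ x ∂(Measure.pi fun _ : κ => gaussianReal 0 1),
      ((matrixOf e x * S)ᵀ * (matrixOf e x * S)).det ≠ 0) ∧
    ∫⁻ x, ENNReal.ofReal (‖((matrixOf e x * S)ᵀ * (matrixOf e x * S))⁻¹ * (matrixOf e x * S)ᵀ *
        (matrixOf e x * Z)‖ ^ 2) ∂(Measure.pi fun _ : κ => gaussianReal 0 1) ≤
      ENNReal.ofReal (p / (q - p - 1) * ‖Z‖ ^ 2) := by
  set s : Fin p → EuclideanSpace ℝ (Fin N) := fun i => WithLp.toLp 2 fun j => S j i with hs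
  have hinner : ∀ {k : ℕ} (M : Matrix (Fin N) (Fin k) ℝ) i l,
      inner ℝ (s i) (WithLp.toLp 2 fun j => M j l) = (Sᵀ * M) i l := by
    intro k M i l
    rw [PiLp.inner_apply, Matrix.mul_apply]
    simp [hs, mul_comm]
  have hsort : Orthonormal ℝ s := by
    rw [orthonormal_iff_ite]
    intro i j
    rw [hinner S i j, hS, Matrix.one_apply]
  have hpN : p ≤ N := by
    have := hsort.linearIndependent.fintype_card_le_finrank
    simpa using this
  -- The columns of S are completed to an orthonormal basis, whose images under the Gaussian matrix
  -- are independent.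
  obtain ⟨w, hw⟩ : ∃ w : OrthonormalBasis (Fin p ⊕ Fin (N - p)) ℝ (EuclideanSpace ℝ (Fin N)),
      ∀ i, w (Sum.inl i) = s i := by
    have hv : Orthonormal ℝ ((range (Sum.inl : Fin p → Fin p ⊕ Fin (N - p))).domRestrict
        (Sum.elim s fun _ => 0)) := by
      rw [orthonormal_iff_ite]
      rintro ⟨_, i, rfl⟩ ⟨_, j, rfl⟩
      have := orthonormal_iff_ite.mp hsort i j
      simpa [Set.domRestrict, Subtype.ext_iff] using this
    obtain ⟨w, hw⟩ := hv.exists_orthonormalBasis_extension_of_card_eq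
      (by simp; omega)
    exact ⟨w, fun i => by simpa using hw (Sum.inl i) ⟨i, rfl⟩⟩
  set c : Fin b → Fin (N - p) → ℝ := fun l k =>
    inner ℝ (w (Sum.inr k)) (WithLp.toLp 2 fun j => Z j l) with hc
  set col : (κ → ℝ) → (Fin p → EuclideanSpace ℝ (Fin q)) × (Fin (N - p) → EuclideanSpace ℝ (Fin q))
    := fun x => (fun i => imageOf e x (w (Sum.inl i)), fun k => imageOf e x (w (Sum.inr k)))
    with hcol
  have hcolm : MeasurePreserving col (Measure.pi fun _ : κ => gaussianReal 0 1)
      ((Measure.pi fun _ : Fin p => stdGaussian (EuclideanSpace ℝ (Fin q))).prod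
        (Measure.pi fun _ : Fin (N - p) => stdGaussian (EuclideanSpace ℝ (Fin q)))) :=
    (measurePreserving_sumPiEquivProdPi
      fun _ : Fin p ⊕ Fin (N - p) => stdGaussian (EuclideanSpace ℝ (Fin q))).comp
      ⟨measurable_imageOf e w, map_imageOf_gaussian e w⟩
  have hgram : ∀ x, (matrixOf e x * S)ᵀ * (matrixOf e x * S) = Matrix.gram ℝ (col x).1 := by
    intro x
    ext i j
    rw [Matrix.gram_apply, Matrix.mul_apply, PiLp.inner_apply]
    refine Finset.sum_congr rfl fun a _ => ?_
    simp only [hcol, hw, imageOf_apply, hs, Matrix.transpose_apply, Matrix.mul_apply, matrixOf,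
      Matrix.of_apply]
    simp [mul_comm]
  -- The columns of Z are orthogonal to those of S, so their images involve only the complementary
  -- basis vectors and are independent of the images of S.
  have hZcol : ∀ x l, imageOf e x (WithLp.toLp 2 fun j => Z j l) = ∑ k, c l k • (col x).2 k := by
    intro x l
    have h1 := w.sum_repr' (WithLp.toLp 2 fun j => Z j l)
    rw [Fintype.sum_sum_type] at h1
    have h2 : ∀ i, inner ℝ (w (Sum.inl i)) (WithLp.toLp 2 fun j => Z j l) = 0 := by
      intro i
      rw [hw, hinner Z i l, hZ, Matrix.zero_apply]
    simp only [h2, zero_smul, Finset.sum_const_zero, zero_add] at h1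
    rw [← h1, imageOf_sum_smul]
  have hentry : ∀ x, ‖((matrixOf e x * S)ᵀ * (matrixOf e x * S))⁻¹ * (matrixOf e x * S)ᵀ *
      (matrixOf e x * Z)‖ ^ 2 =
      ∑ i, ∑ l, inner ℝ (dualFamily (col x).1 i) (∑ k, c l k • (col x).2 k) ^ 2 := by
    intro x
    rw [frobenius_norm_sq, hgram]
    refine Finset.sum_congr rfl fun i _ => Finset.sum_congr rfl fun l _ => ?_
    congr 1
    rw [← hZcol, Matrix.mul_assoc, Matrix.mul_apply, dualFamily, sum_inner]
    refine Finset.sum_congr rfl fun j _ => ?_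
    rw [real_inner_smul_left, Matrix.mul_apply, PiLp.inner_apply]
    congr 1
    refine Finset.sum_congr rfl fun a _ => ?_
    simp only [hcol, hw, imageOf_apply, hs, Matrix.transpose_apply, Matrix.mul_apply, matrixOf,
      Matrix.of_apply]
    simp [mul_comm]
  have hcsum : ∑ l, ∑ k, c l k ^ 2 = ‖Z‖ ^ 2 := by
    rw [frobenius_norm_sq]
    conv_rhs => rw [Finset.sum_comm]
    refine Finset.sum_congr rfl fun l _ => ?_
    have h := w.sum_sq_norm_inner_right (WithLp.toLp 2 fun j => Z j l)
    rw [EuclideanSpace.real_norm_sq_eq, Fintype.sum_sum_type] at h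
    have h2 : ∀ i, inner ℝ (w (Sum.inl i)) (WithLp.toLp 2 fun j => Z j l) = 0 := by
      intro i
      rw [hw, hinner Z i l, hZ, Matrix.zero_apply]
    simpa [h2, hc] using h
  have hfin : Module.finrank ℝ (EuclideanSpace ℝ (Fin q)) = q := finrank_euclideanSpace_fin
  constructor
  · simp only [hgram]
    have h1 := ae_det_gram_ne_zero (V := EuclideanSpace ℝ (Fin q)) (p := p) (by rw [hfin]; omega)
    exact hcolm.quasiMeasurePreserving.ae (Measure.quasiMeasurePreserving_fst.ae h1)
  · simp only [hentry]
    have h1 := lintegral_sum_inner_dualFamily_sq_le (V := EuclideanSpace ℝ (Fin q))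
      (by rw [hfin]; exact hp) c
    rw [hfin, hcsum] at h1
    refine le_trans (le_of_eq ?_) h1
    refine hcolm.lintegral_comp (f := fun z => ENNReal.ofReal
      (∑ i, ∑ l, inner ℝ (dualFamily z.1 i) (∑ k, c l k • z.2 k) ^ 2)) ?_
    refine (Finset.measurable_fun_sum _ fun i _ => Finset.measurable_fun_sum _ fun l _ =>
      (Measurable.inner ((measurable_dualFamily i).comp measurable_fst) ?_).pow_const 2).ennreal_ofReal
    exact Finset.measurable_fun_sum _ fun k _ =>
      ((measurable_pi_apply k).comp measurable_snd).const_smul (c l k)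

end GaussianMatrix

/-! ### Reconstruction from the sketch of a fixed matrix -/

section Reconstruction

open scoped ENNReal

variable {a b c m n r : ℕ}

theorem frobenius_norm_sq_eq_trace (Y : Matrix (Fin a) (Fin b) ℝ) : ‖Y‖ ^ 2 = (Yᵀ * Y).trace := by
  rw [frobenius_norm_sq, Finset.sum_comm]
  simp only [Matrix.trace, Matrix.diag_apply, Matrix.mul_apply, Matrix.transpose_apply, sq]

theorem norm_add_mul_sq {Q : Matrix (Fin a) (Fin c) ℝ} (hQ : Qᵀ * Q = 1)
    {Z : Matrix (Fin a) (Fin b) ℝ} (hZ : Qᵀ * Z = 0) (B : Matrix (Fin c) (Fin b) ℝ) :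
    ‖Z + Q * B‖ ^ 2 = ‖Z‖ ^ 2 + ‖B‖ ^ 2 := by
  have hZ' : Zᵀ * Q = 0 := by
    rw [← Matrix.transpose_transpose Q, ← Matrix.transpose_mul, hZ, Matrix.transpose_zero]
  have h : (Z + Q * B)ᵀ * (Z + Q * B) = Zᵀ * Z + Bᵀ * B := by
    calc (Z + Q * B)ᵀ * (Z + Q * B)
        = Zᵀ * Z + (Zᵀ * Q) * B + Bᵀ * (Qᵀ * Z) + Bᵀ * (Qᵀ * Q) * B := by
          simp only [Matrix.transpose_add, Matrix.transpose_mul, Matrix.add_mul, Matrix.mul_add,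
            Matrix.mul_assoc]
          abel
      _ = _ := by rw [hZ, hZ', hQ]; simp
  simp only [frobenius_norm_sq_eq_trace, h, Matrix.trace_add]

theorem norm_mul_of_orthonormal {Q : Matrix (Fin a) (Fin c) ℝ} (hQ : Qᵀ * Q = 1)
    (B : Matrix (Fin c) (Fin b) ℝ) : ‖Q * B‖ = ‖B‖ := by
  have h := norm_add_mul_sq hQ (Z := (0 : Matrix (Fin a) (Fin b) ℝ)) (Matrix.mul_zero _) B
  rw [zero_add, norm_zero, zero_pow two_ne_zero, zero_add] at h
  exact (sq_eq_sq₀ (norm_nonneg _) (norm_nonneg _)).mp h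

theorem transpose_mul_sub_proj {Q : Matrix (Fin a) (Fin c) ℝ} (hQ : Qᵀ * Q = 1)
    (Y : Matrix (Fin a) (Fin b) ℝ) : Qᵀ * (Y - Q * (Qᵀ * Y)) = 0 := by
  rw [Matrix.mul_sub, ← Matrix.mul_assoc, hQ, Matrix.one_mul, sub_self]

theorem norm_sq_eq_proj_add {Q : Matrix (Fin a) (Fin c) ℝ} (hQ : Qᵀ * Q = 1)
    (Y : Matrix (Fin a) (Fin b) ℝ) : ‖Y‖ ^ 2 = ‖Y - Q * (Qᵀ * Y)‖ ^ 2 + ‖Qᵀ * Y‖ ^ 2 := by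
  rw [← norm_add_mul_sq hQ (transpose_mul_sub_proj hQ Y), sub_add_cancel]

theorem norm_transpose_mul_le {Q : Matrix (Fin a) (Fin c) ℝ} (hQ : Qᵀ * Q = 1)
    (Y : Matrix (Fin a) (Fin b) ℝ) : ‖Qᵀ * Y‖ ≤ ‖Y‖ := by
  refine (sq_le_sq₀ (norm_nonneg _) (norm_nonneg _)).mp ?_
  rw [norm_sq_eq_proj_add hQ Y]
  linarith [sq_nonneg ‖Y - Q * (Qᵀ * Y)‖]

theorem norm_sub_proj_le {Q : Matrix (Fin a) (Fin c) ℝ} (hQ : Qᵀ * Q = 1)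
    (Y : Matrix (Fin a) (Fin b) ℝ) : ‖Y - Q * (Qᵀ * Y)‖ ≤ ‖Y‖ := by
  refine (sq_le_sq₀ (norm_nonneg _) (norm_nonneg _)).mp ?_
  rw [norm_sq_eq_proj_add hQ Y]
  linarith [sq_nonneg ‖Qᵀ * Y‖]

/-- The projection onto the range of `Q` is at least as good as any element of that range. -/
theorem norm_sub_proj_le_norm_sub_mul {Q : Matrix (Fin a) (Fin c) ℝ} (hQ : Qᵀ * Q = 1)
    (Y : Matrix (Fin a) (Fin b) ℝ) (B : Matrix (Fin c) (Fin b) ℝ) :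
    ‖Y - Q * (Qᵀ * Y)‖ ≤ ‖Y - Q * B‖ := by
  have h := norm_sub_proj_le hQ (Y - Q * B)
  have e : Y - Q * B - Q * (Qᵀ * (Y - Q * B)) = Y - Q * (Qᵀ * Y) := by
    rw [Matrix.mul_sub, ← Matrix.mul_assoc Qᵀ Q B, hQ, Matrix.one_mul, Matrix.mul_sub]
    abel
  rwa [e] at h

/-- The pseudoinverse of a matrix with linearly independent columns. -/
noncomputable def leftPinv (M : Matrix (Fin a) (Fin b) ℝ) : Matrix (Fin b) (Fin a) ℝ :=
  (Mᵀ * M)⁻¹ * Mᵀ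

theorem leftPinv_mul_self {M : Matrix (Fin a) (Fin b) ℝ} (hM : (Mᵀ * M).det ≠ 0) :
    leftPinv M * M = 1 := by
  rw [leftPinv, Matrix.mul_assoc, Matrix.nonsing_inv_mul _ (Ne.isUnit hM)]

/-- The Penrose conditions imply the normal equations MᵀMP = Mᵀ, which determine P when MᵀM is
invertible. -/
theorem IsPseudoinverse.eq_leftPinv {M : Matrix (Fin a) (Fin b) ℝ} {P : Matrix (Fin b) (Fin a) ℝ}
    (hP : IsPseudoinverse M P) (hM : (Mᵀ * M).det ≠ 0) : P = leftPinv M := by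
  obtain ⟨h1, -, h3, -⟩ := hP
  have hu := Ne.isUnit hM
  have h4 : Mᵀ * (M * P) = Mᵀ := by
    rw [← h3, ← Matrix.transpose_mul, h1]
  calc P = (Mᵀ * M)⁻¹ * (Mᵀ * M) * P := by rw [Matrix.nonsing_inv_mul _ hu, Matrix.one_mul]
    _ = (Mᵀ * M)⁻¹ * (Mᵀ * (M * P)) := by simp only [Matrix.mul_assoc]
    _ = leftPinv M := by rw [h4, leftPinv]

/-- The approximation of `X` from the sketch with test matrix `Φ`, before truncation. -/
noncomputable def sketchApprox (Q : Matrix (Fin m) (Fin c) ℝ) (Φ : Matrix (Fin a) (Fin m) ℝ)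
    (X : Matrix (Fin m) (Fin n) ℝ) : Matrix (Fin m) (Fin n) ℝ :=
  Q * (leftPinv (Φ * Q) * (Φ * X))

/-- The matrix QᵀXs has rank at most r and so competes with the best approximation B of B₀. Hence
‖QB - QB₀‖ ≤ ‖QB₀ - Xs‖, and the triangle inequality through QB₀ and through X gives both factors 2.
-/
theorem IsReconstruction.norm_sub_le {Q : Matrix (Fin m) (Fin c) ℝ} {Φ : Matrix (Fin a) (Fin m) ℝ}
    {X Xhat Xs : Matrix (Fin m) (Fin n) ℝ} (h : IsReconstruction r Q Φ (Φ * X) Xhat)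
    (hQ : Qᵀ * Q = 1) (hdet : ((Φ * Q)ᵀ * (Φ * Q)).det ≠ 0) (hXs : Xs.rank ≤ r) :
    ‖Xhat - Xs‖ ≤ 2 * ‖X - sketchApprox Q Φ X‖ + 2 * ‖X - Xs‖ := by
  obtain ⟨P, B, hP, ⟨-, hB⟩, rfl⟩ := h
  rw [hP.eq_leftPinv hdet] at hB
  set B₀ := leftPinv (Φ * Q) * (Φ * X) with hB₀
  have h1 : ‖Q * B - Q * B₀‖ ≤ ‖Q * B₀ - Xs‖ := by
    rw [← Matrix.mul_sub, norm_mul_of_orthonormal hQ, norm_sub_rev]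
    refine (hB (Qᵀ * Xs) ((Matrix.rank_mul_le_right _ _).trans hXs)).trans ?_
    have e : B₀ - Qᵀ * Xs = Qᵀ * (Q * B₀ - Xs) := by
      rw [Matrix.mul_sub, ← Matrix.mul_assoc, hQ, Matrix.one_mul]
    rw [e]
    exact norm_transpose_mul_le hQ _
  have h2 : ‖Q * B - Xs‖ ≤ ‖Q * B - Q * B₀‖ + ‖Q * B₀ - Xs‖ :=
    norm_sub_le_norm_sub_add_norm_sub _ _ _
  have h3 : ‖Q * B₀ - Xs‖ ≤ ‖X - Q * B₀‖ + ‖X - Xs‖ := by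
    rw [norm_sub_rev X]
    exact norm_sub_le_norm_sub_add_norm_sub _ _ _
  have h4 : sketchApprox Q Φ X = Q * B₀ := rfl
  rw [h4]
  linarith

/-- The left inverse reproduces the part of X in the range of Q exactly. Only the residual Z leaks
through Φ, and the leak stays in the range of Q, orthogonal to Z. -/
theorem norm_sub_sketchApprox_sq {Q : Matrix (Fin m) (Fin c) ℝ} {Φ : Matrix (Fin a) (Fin m) ℝ}
    (hQ : Qᵀ * Q = 1) (hdet : ((Φ * Q)ᵀ * (Φ * Q)).det ≠ 0) (X : Matrix (Fin m) (Fin n) ℝ) :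
    ‖X - sketchApprox Q Φ X‖ ^ 2 = ‖X - Q * (Qᵀ * X)‖ ^ 2 +
      ‖leftPinv (Φ * Q) * (Φ * (X - Q * (Qᵀ * X)))‖ ^ 2 := by
  set Z := X - Q * (Qᵀ * X) with hZ
  have hX : X = Z + Q * (Qᵀ * X) := by rw [hZ, sub_add_cancel]
  have h1 : leftPinv (Φ * Q) * (Φ * X) = leftPinv (Φ * Q) * (Φ * Z) + Qᵀ * X := by
    conv_lhs => rw [hX]
    rw [Matrix.mul_add, Matrix.mul_add, ← Matrix.mul_assoc Φ Q, ← Matrix.mul_assoc _ (Φ * Q),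
      leftPinv_mul_self hdet, Matrix.one_mul]
  have h2 : X - sketchApprox Q Φ X = Z + Q * (-(leftPinv (Φ * Q) * (Φ * Z))) := by
    rw [sketchApprox, h1, Matrix.mul_add, Matrix.mul_neg, hZ]
    abel
  rw [h2, norm_add_mul_sq hQ (transpose_mul_sub_proj hQ X), norm_neg]

/-- The error of the sketch for a fixed orthonormal `Q`. -/
theorem lintegral_norm_sub_sketchApprox_sq_le {Q : Matrix (Fin m) (Fin c) ℝ} (hQ : Qᵀ * Q = 1)
    (hc : c ≤ 2 * r + 1) (X : Matrix (Fin m) (Fin n) ℝ) :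
    (∀ᵐ φ ∂(Measure.pi fun _ : Fin (4 * r + 3) × Fin m => gaussianReal 0 1),
      ((matrixOf (Equiv.refl _) φ * Q)ᵀ * (matrixOf (Equiv.refl _) φ * Q)).det ≠ 0) ∧
    ∫⁻ φ, ENNReal.ofReal (‖X - sketchApprox Q (matrixOf (Equiv.refl _) φ) X‖ ^ 2)
      ∂(Measure.pi fun _ : Fin (4 * r + 3) × Fin m => gaussianReal 0 1) ≤
      ENNReal.ofReal (2 * ‖X - Q * (Qᵀ * X)‖ ^ 2) := by
  set Z := X - Q * (Qᵀ * X) with hZ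
  have h := lintegral_norm_pinv_mul_sq_le (q := 4 * r + 3) (Equiv.refl _) hQ
    (transpose_mul_sub_proj hQ X) (by omega)
  refine ⟨h.1, ?_⟩
  calc _ ≤ ∫⁻ φ, (ENNReal.ofReal (‖Z‖ ^ 2) + ENNReal.ofReal (‖leftPinv
          (matrixOf (Equiv.refl _) φ * Q) * (matrixOf (Equiv.refl _) φ * Z)‖ ^ 2))
        ∂(Measure.pi fun _ : Fin (4 * r + 3) × Fin m => gaussianReal 0 1) := by
        refine lintegral_mono_ae ?_
        filter_upwards [h.1] with φ hφ
        rw [norm_sub_sketchApprox_sq hQ hφ, ENNReal.ofReal_add (by positivity) (by positivity)]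
    _ ≤ ENNReal.ofReal (‖Z‖ ^ 2) + ENNReal.ofReal (‖Z‖ ^ 2) := by
        rw [lintegral_add_left measurable_const, lintegral_const, measure_univ, mul_one]
        refine add_le_add_right (h.2.trans (ENNReal.ofReal_le_ofReal ?_)) _
        -- The ratio is c/(4r+3-c-1), which is at most 1 for c ≤ 2r + 1 with equality at 2r + 1;
        -- this fixes the number of rows of Φ.
        refine mul_le_of_le_one_left (sq_nonneg _) ?_
        have hc' : (c : ℝ) ≤ 2 * r + 1 := by exact_mod_cast hc
        have hr : (0 : ℝ) ≤ r := r.cast_nonneg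
        push_cast
        rw [div_le_one (by linarith)]
        linarith
    _ = _ := by
        rw [← ENNReal.ofReal_add (by positivity) (by positivity), ← two_mul]

/-- An orthonormal basis of the row space. -/
theorem exists_orthonormal_rowSpace (Xs : Matrix (Fin m) (Fin n) ℝ) :
    ∃ V : Matrix (Fin n) (Fin Xs.rank) ℝ, Vᵀ * V = 1 ∧ V * (Vᵀ * Xsᵀ) = Xsᵀ := by
  set S := LinearMap.range (Matrix.toEuclideanLin Xsᵀ) with hS
  have hfin : Module.finrank ℝ S = Xs.rank := by
    rw [← Matrix.rank_transpose, Matrix.rank_eq_finrank_range_toLin Xsᵀ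
      (PiLp.basisFun 2 ℝ (Fin n)) (PiLp.basisFun 2 ℝ (Fin m)), ← Matrix.toLpLin_eq_toLin]
  set w := (stdOrthonormalBasis ℝ S).reindex (finCongr hfin) with hw
  have hV : ∀ j i, inner ℝ (w j : EuclideanSpace ℝ (Fin n)) (WithLp.toLp 2 fun k => Xs i k) =
      ∑ k, (w j : EuclideanSpace ℝ (Fin n)) k * Xs i k := by
    intro j i
    rw [PiLp.inner_apply]
    simp [mul_comm]
  refine ⟨Matrix.of fun k j => (w j : EuclideanSpace ℝ (Fin n)) k, ?_, ?_⟩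
  · ext i j
    have h := orthonormal_iff_ite.mp w.orthonormal i j
    rw [Submodule.coe_inner, PiLp.inner_apply] at h
    rw [Matrix.mul_apply, Matrix.one_apply]
    refine Eq.trans (Finset.sum_congr rfl fun k _ => ?_) h
    rw [Matrix.transpose_apply, Matrix.of_apply, Matrix.of_apply, mul_comm]
    rfl
  · ext k i
    have hmem : (WithLp.toLp 2 fun k => Xs i k : EuclideanSpace ℝ (Fin n)) ∈ S := by
      refine ⟨EuclideanSpace.single i 1, ?_⟩
      ext k
      simp [Matrix.toLpLin_apply]
    have h := w.sum_repr' ⟨_, hmem⟩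
    have h' := congrArg (fun y : S => (y : EuclideanSpace ℝ (Fin n)) k) h
    simp only [Submodule.coe_inner, hV, Submodule.coe_sum, Submodule.coe_smul, WithLp.ofLp_sum,
      WithLp.ofLp_smul, Finset.sum_apply, Pi.smul_apply, smul_eq_mul] at h'
    rw [Matrix.transpose_apply, ← h', Matrix.mul_apply]
    refine Finset.sum_congr rfl fun j _ => ?_
    rw [Matrix.mul_apply, mul_comm]
    rfl

/-- The error of the range finder. -/
theorem lintegral_norm_sub_rangeFinder_sq_le
    (X : Matrix (Fin m) (Fin n) ℝ) {Xs : Matrix (Fin m) (Fin n) ℝ} (hXs : Xs.rank ≤ r)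
    (Q : Matrix (Fin m) (Fin (2 * r + 1)) ℝ → Matrix (Fin m) (Fin c) ℝ)
    (hQ : ∀ Y, (Q Y)ᵀ * Q Y = 1 ∧ ∃ R : Matrix (Fin c) (Fin (2 * r + 1)) ℝ, Y = Q Y * R) :
    ∫⁻ ψ, ENNReal.ofReal (‖X - Q (X * (matrixOf (Equiv.prodComm _ _) ψ)ᵀ) *
        ((Q (X * (matrixOf (Equiv.prodComm _ _) ψ)ᵀ))ᵀ * X)‖ ^ 2)
      ∂(Measure.pi fun _ : Fin n × Fin (2 * r + 1) => gaussianReal 0 1) ≤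
      ENNReal.ofReal (2 * ‖X - Xs‖ ^ 2) := by
  -- For r = 0 the sketch has a single column, too few for the moment bound; but then Xs = 0 and any
  -- projection satisfies the claim.
  rcases Nat.eq_zero_or_pos r with hr | hr
  · have h0 : Xs = 0 := by
      obtain ⟨V, -, hV⟩ := exists_orthonormal_rowSpace Xs
      have : IsEmpty (Fin Xs.rank) := by
        rw [show Xs.rank = 0 by omega]; infer_instance
      rw [← Matrix.transpose_inj, ← hV, Matrix.transpose_zero]
      ext i j
      rw [Matrix.mul_apply, Finset.univ_eq_empty, Finset.sum_empty, Matrix.zero_apply]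
    refine (lintegral_mono (g := fun _ => ENNReal.ofReal (2 * ‖X - Xs‖ ^ 2)) fun ψ => ?_).trans
      (by simp)
    apply ENNReal.ofReal_le_ofReal
    have h1 := norm_sub_proj_le (hQ (X * (matrixOf (Equiv.prodComm _ _) ψ)ᵀ)).1 X
    have h2 := pow_le_pow_left₀ (norm_nonneg _) h1 2
    rw [h0, sub_zero]
    linarith [sq_nonneg ‖X‖]
  obtain ⟨V, hV, hVX⟩ := exists_orthonormal_rowSpace Xs
  set Z := Xᵀ - V * (Vᵀ * Xᵀ) with hZ
  have hVZ : Vᵀ * Z = 0 := transpose_mul_sub_proj hV Xᵀ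
  -- Projecting off the row space of Xs annihilates Xs, so no singular value decomposition of X is
  -- needed.
  have hZle : ‖Z‖ ≤ ‖X - Xs‖ := by
    have h1 := norm_sub_proj_le hV (Xᵀ - Xsᵀ)
    have e : Xᵀ - Xsᵀ - V * (Vᵀ * (Xᵀ - Xsᵀ)) = Z := by
      rw [Matrix.mul_sub, Matrix.mul_sub, hVX, hZ]; abel
    rwa [e, ← Matrix.transpose_sub, Matrix.frobenius_norm_transpose] at h1
  -- The argument acts on Xᵀ from the left with Gaussian matrix Ψᵀ, hence the swapped index pairs.
  have h := lintegral_norm_pinv_mul_sq_le (q := 2 * r + 1) (Equiv.prodComm _ _) hV hVZ (by omega)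
  have hpt : ∀ H : Matrix (Fin (2 * r + 1)) (Fin n) ℝ, ((H * V)ᵀ * (H * V)).det ≠ 0 →
      ‖X - Q (X * Hᵀ) * ((Q (X * Hᵀ))ᵀ * X)‖ ^ 2 ≤
        ‖Z‖ ^ 2 + ‖leftPinv (H * V) * (H * Z)‖ ^ 2 := by
    intro H hdet
    obtain ⟨hQ1, R, hR⟩ := hQ (X * Hᵀ)
    -- Projection onto the range of Q beats every matrix with columns in that range; the competitor
    -- is the sketch XHᵀ times (HV)†ᵀVᵀ, whose error is explicit.
    have h1 := norm_sub_proj_le_norm_sub_mul hQ1 X (R * ((leftPinv (H * V))ᵀ * Vᵀ))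
    have e0 : Q (X * Hᵀ) * (R * ((leftPinv (H * V))ᵀ * Vᵀ)) =
        X * Hᵀ * ((leftPinv (H * V))ᵀ * Vᵀ) := by
      rw [← Matrix.mul_assoc (Q (X * Hᵀ)) R, ← hR]
    rw [e0, ← Matrix.frobenius_norm_transpose (X - X * Hᵀ * ((leftPinv (H * V))ᵀ * Vᵀ))] at h1
    have e : (X - X * Hᵀ * ((leftPinv (H * V))ᵀ * Vᵀ))ᵀ =
        Z + V * (-(leftPinv (H * V) * (H * Z))) := by
      have e1 : Xᵀ = Z + V * (Vᵀ * Xᵀ) := by rw [hZ, sub_add_cancel]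
      have e2 : leftPinv (H * V) * (H * Xᵀ) = leftPinv (H * V) * (H * Z) + Vᵀ * Xᵀ := by
        conv_lhs => rw [e1]
        rw [Matrix.mul_add, Matrix.mul_add, ← Matrix.mul_assoc H V, ← Matrix.mul_assoc _ (H * V),
          leftPinv_mul_self hdet, Matrix.one_mul]
      simp only [Matrix.transpose_sub, Matrix.transpose_mul, Matrix.transpose_transpose,
        Matrix.mul_assoc]
      rw [e2, Matrix.mul_add, Matrix.mul_neg, hZ]
      abel
    rw [e] at h1
    rw [← norm_neg (leftPinv (H * V) * (H * Z)), ← norm_add_mul_sq hV hVZ]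
    exact pow_le_pow_left₀ (norm_nonneg _) h1 2
  calc _ ≤ ∫⁻ ψ, (ENNReal.ofReal (‖Z‖ ^ 2) + ENNReal.ofReal (‖leftPinv
          (matrixOf (Equiv.prodComm _ _) ψ * V) * (matrixOf (Equiv.prodComm _ _) ψ * Z)‖ ^ 2))
        ∂(Measure.pi fun _ : Fin n × Fin (2 * r + 1) => gaussianReal 0 1) := by
        refine lintegral_mono_ae ?_
        filter_upwards [h.1] with ψ hψ
        rw [← ENNReal.ofReal_add (by positivity) (by positivity)]
        exact ENNReal.ofReal_le_ofReal (hpt _ hψ)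
    _ ≤ ENNReal.ofReal (‖Z‖ ^ 2) + ENNReal.ofReal (‖Z‖ ^ 2) := by
        rw [lintegral_add_left measurable_const, lintegral_const, measure_univ, mul_one]
        refine add_le_add_right (h.2.trans (ENNReal.ofReal_le_ofReal ?_)) _
        -- The ratio is rank/(2r+1-rank-1), at most r/r = 1.
        refine mul_le_of_le_one_left (sq_nonneg _) ?_
        have hc' : (Xs.rank : ℝ) ≤ r := by exact_mod_cast hXs
        have hr' : (1 : ℝ) ≤ r := by exact_mod_cast hr
        push_cast
        rw [div_le_one (by linarith)]
        linarith
    _ ≤ _ := by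
        rw [← ENNReal.ofReal_add (by positivity) (by positivity), ← two_mul]
        gcongr

end Reconstruction

/-! ### Measurability of matrix expressions -/

section Measurability

variable {Ω : Type*} [MeasurableSpace Ω] {a b c : ℕ}

theorem measurable_mul_of_entries {M : Ω → Matrix (Fin a) (Fin b) ℝ}
    {N : Ω → Matrix (Fin b) (Fin c) ℝ} (hM : ∀ i j, Measurable fun ω => M ω i j)
    (hN : ∀ i j, Measurable fun ω => N ω i j) (i : Fin a) (j : Fin c) :
    Measurable fun ω => (M ω * N ω) i j := by
  simp only [Matrix.mul_apply]
  exact Finset.measurable_fun_sum _ fun k _ => (hM i k).mul (hN k j)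

theorem measurable_leftPinv_of_entries {M : Ω → Matrix (Fin a) (Fin b) ℝ}
    (hM : ∀ i j, Measurable fun ω => M ω i j) (i : Fin b) (j : Fin a) :
    Measurable fun ω => leftPinv (M ω) i j := by
  have hT : ∀ i j, Measurable fun ω => (M ω)ᵀ i j := fun i j => hM j i
  exact measurable_mul_of_entries
    (measurable_inv_of_entries (measurable_mul_of_entries hT hM)) hT i j

theorem measurable_norm_of_entries {M : Ω → Matrix (Fin a) (Fin b) ℝ}
    (hM : ∀ i j, Measurable fun ω => M ω i j) : Measurable fun ω => ‖M ω‖ := by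
  have e : (fun ω => ‖M ω‖) = fun ω => √(∑ i, ∑ j, M ω i j ^ 2) := by
    ext ω
    rw [← frobenius_norm_sq, Real.sqrt_sq (norm_nonneg _)]
  rw [e]
  exact (Finset.measurable_fun_sum _ fun i _ =>
    Finset.measurable_fun_sum _ fun j _ => (hM i j).pow_const 2).sqrt

theorem aemeasurable_norm_of_entries {μ : Measure Ω} {M : Ω → Matrix (Fin a) (Fin b) ℝ}
    (hM : ∀ i j, AEMeasurable (fun ω => M ω i j) μ) : AEMeasurable (fun ω => ‖M ω‖) μ := by
  have e : (fun ω => ‖M ω‖) = fun ω => √(∑ i, ∑ j, M ω i j ^ 2) := by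
    ext ω
    rw [← frobenius_norm_sq, Real.sqrt_sq (norm_nonneg _)]
  rw [e]
  exact Real.continuous_sqrt.measurable.comp_aemeasurable (Finset.aemeasurable_fun_sum _ fun i _ =>
    Finset.aemeasurable_fun_sum _ fun j _ => (hM i j).pow_const 2)

end Measurability

/-! ### The expected error of the reconstruction -/

section ExpectedError

open scoped ENNReal

variable {m n r : ℕ}
  {qr : (Fin m → Fin (2 * r + 1) → ℝ) → Matrix (Fin m) (Fin (min m (2 * r + 1))) ℝ}

/-- The orthonormal factor computed from the sketch of `X` with test matrix `Ψ`. -/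
def rangeBasis (qr : (Fin m → Fin (2 * r + 1) → ℝ) → Matrix (Fin m) (Fin (min m (2 * r + 1))) ℝ)
    (X : Matrix (Fin m) (Fin n) ℝ) (Ψ : Matrix (Fin n) (Fin (2 * r + 1)) ℝ) :
    Matrix (Fin m) (Fin (min m (2 * r + 1))) ℝ :=
  qr (X * Ψ : Matrix (Fin m) (Fin (2 * r + 1)) ℝ)

theorem IsQRRoutine.orthonormal (hqr : IsQRRoutine qr) (Y : Matrix (Fin m) (Fin (2 * r + 1)) ℝ) :
    (qr Y)ᵀ * qr Y = 1 ∧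
      ∃ R : Matrix (Fin (min m (2 * r + 1))) (Fin (2 * r + 1)) ℝ, Y = qr Y * R := by
  obtain ⟨R, h1, -, h2⟩ := hqr.2 Y
  exact ⟨h1, R, h2⟩

theorem IsQRRoutine.rangeBasis_orthonormal (hqr : IsQRRoutine qr) (X : Matrix (Fin m) (Fin n) ℝ)
    (Ψ : Matrix (Fin n) (Fin (2 * r + 1)) ℝ) :
    (rangeBasis qr X Ψ)ᵀ * rangeBasis qr X Ψ = 1 :=
  (hqr.orthonormal (X * Ψ)).1

/-- Standard normal matrices, through their entries. -/
noncomputable def gaussianPi (κ : Type*) [Fintype κ] : Measure (κ → ℝ) :=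
  Measure.pi fun _ : κ => gaussianReal 0 1

instance (κ : Type*) [Fintype κ] : IsProbabilityMeasure (gaussianPi κ) := by
  unfold gaussianPi; infer_instance

/-- The matrix with the given entries. -/
def ofEntries {a b : ℕ} (x : Fin a × Fin b → ℝ) : Matrix (Fin a) (Fin b) ℝ :=
  Matrix.of fun i j => x (i, j)

theorem ofEntries_eq_matrixOf {a b : ℕ} (x : Fin a × Fin b → ℝ) :
    ofEntries x = matrixOf (Equiv.refl _) x := rfl

theorem ofEntries_eq_transpose_matrixOf {a b : ℕ} (x : Fin a × Fin b → ℝ) :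
    ofEntries x = (matrixOf (Equiv.prodComm _ _) x)ᵀ := rfl

theorem lintegral_gaussianPi_sketchApprox_le {c : ℕ} {Q : Matrix (Fin m) (Fin c) ℝ}
    (hQ : Qᵀ * Q = 1) (hc : c ≤ 2 * r + 1) (X : Matrix (Fin m) (Fin n) ℝ) :
    (∀ᵐ φ ∂(gaussianPi (Fin (4 * r + 3) × Fin m)),
      ((ofEntries φ * Q)ᵀ * (ofEntries φ * Q)).det ≠ 0) ∧
    ∫⁻ φ, ENNReal.ofReal (‖X - sketchApprox Q (ofEntries φ) X‖ ^ 2)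
      ∂(gaussianPi (Fin (4 * r + 3) × Fin m)) ≤
      2 * ENNReal.ofReal (‖X - Q * (Qᵀ * X)‖ ^ 2) := by
  have h := lintegral_norm_sub_sketchApprox_sq_le (r := r) hQ hc X
  rw [ENNReal.ofReal_mul zero_le_two, ENNReal.ofReal_ofNat] at h
  simp only [ofEntries_eq_matrixOf, gaussianPi]
  exact h

theorem lintegral_gaussianPi_rangeBasis_le (hqr : IsQRRoutine qr)
    (X : Matrix (Fin m) (Fin n) ℝ) {Xs : Matrix (Fin m) (Fin n) ℝ} (hXs : Xs.rank ≤ r) :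
    ∫⁻ ψ, ENNReal.ofReal (‖X - rangeBasis qr X (ofEntries ψ) *
        ((rangeBasis qr X (ofEntries ψ))ᵀ * X)‖ ^ 2)
      ∂(gaussianPi (Fin n × Fin (2 * r + 1))) ≤ ENNReal.ofReal (2 * ‖X - Xs‖ ^ 2) := by
  have h := lintegral_norm_sub_rangeFinder_sq_le X hXs (fun Y => qr Y) hqr.orthonormal
  simp only [ofEntries_eq_transpose_matrixOf, gaussianPi, rangeBasis]
  exact h

section FromEntries

variable {Ω : Type*} [MeasurableSpace Ω]
  {X : Ω → Matrix (Fin m) (Fin n) ℝ} {Ψ : Ω → Matrix (Fin n) (Fin (2 * r + 1)) ℝ}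
  {Φ : Ω → Matrix (Fin (4 * r + 3)) (Fin m) ℝ}

theorem measurable_rangeBasis (hqr : IsQRRoutine qr) (hX : ∀ i j, Measurable fun ω => X ω i j)
    (hΨ : ∀ i j, Measurable fun ω => Ψ ω i j) (i : Fin m) (j : Fin (min m (2 * r + 1))) :
    Measurable fun ω => rangeBasis qr (X ω) (Ψ ω) i j :=
  (hqr.1 i j).comp (measurable_pi_lambda _ fun i => measurable_pi_lambda _ fun j =>
    measurable_mul_of_entries hX hΨ i j)

theorem measurable_det_sketch (hqr : IsQRRoutine qr) (hX : ∀ i j, Measurable fun ω => X ω i j)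
    (hΨ : ∀ i j, Measurable fun ω => Ψ ω i j) (hΦ : ∀ i j, Measurable fun ω => Φ ω i j) :
    Measurable fun ω => ((Φ ω * rangeBasis qr (X ω) (Ψ ω))ᵀ *
      (Φ ω * rangeBasis qr (X ω) (Ψ ω))).det := by
  have h := measurable_mul_of_entries hΦ (measurable_rangeBasis hqr hX hΨ)
  have hT : ∀ i j, Measurable fun ω => (Φ ω * rangeBasis qr (X ω) (Ψ ω))ᵀ i j := fun i j => h j i
  exact measurable_det_of_entries (measurable_mul_of_entries hT h)

theorem measurable_norm_sub_sketchApprox (hqr : IsQRRoutine qr)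
    (hX : ∀ i j, Measurable fun ω => X ω i j)
    (hΨ : ∀ i j, Measurable fun ω => Ψ ω i j) (hΦ : ∀ i j, Measurable fun ω => Φ ω i j) :
    Measurable fun ω => ‖X ω - sketchApprox (rangeBasis qr (X ω) (Ψ ω)) (Φ ω) (X ω)‖ := by
  have hQ := measurable_rangeBasis hqr hX hΨ
  have h := measurable_mul_of_entries hQ (measurable_mul_of_entries
    (measurable_leftPinv_of_entries (measurable_mul_of_entries hΦ hQ))
    (measurable_mul_of_entries hΦ hX))
  exact measurable_norm_of_entries fun i j => (hX i j).sub (h i j)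

end FromEntries

theorem lintegral_ofReal_le_of_lintegral_sq_le {Ω : Type*} [MeasurableSpace Ω] {μ : Measure Ω}
    [IsProbabilityMeasure μ] {f : Ω → ℝ} (hf : AEStronglyMeasurable f μ) (hf0 : 0 ≤ f) {b : ℝ}
    (hb : 0 ≤ b) (h : ∫⁻ ω, ENNReal.ofReal (f ω ^ 2) ∂μ ≤ ENNReal.ofReal (b ^ 2)) :
    ∫⁻ ω, ENNReal.ofReal (f ω) ∂μ ≤ ENNReal.ofReal b := by
  have h0 : 0 ≤ᵐ[μ] fun ω => f ω ^ 2 := Filter.Eventually.of_forall fun ω => sq_nonneg _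
  have hi : Integrable (fun ω => f ω ^ 2) μ :=
    ⟨hf.pow 2, (hasFiniteIntegral_iff_ofReal h0).mpr (h.trans_lt ENNReal.ofReal_lt_top)⟩
  have h1 : ∫ ω, f ω ^ 2 ∂μ ≤ b ^ 2 := by
    rw [integral_eq_lintegral_of_nonneg_ae h0 hi.1]
    exact ENNReal.toReal_le_of_le_ofReal (sq_nonneg b) h
  obtain ⟨h2, h3⟩ := integral_le_of_integral_sq_le hf hi hb h1
  rw [← ofReal_integral_eq_lintegral_ofReal h2 (Filter.Eventually.of_forall hf0)]
  exact ENNReal.ofReal_le_ofReal h3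

/-- Integrating over Φ with Q fixed and then over Ψ, the two factors 2 give a mean square of at most
(2‖X - Xs‖)²; Jensen's inequality finishes. -/
theorem lintegral_norm_sub_sketchApprox_le (hqr : IsQRRoutine qr) (X : Matrix (Fin m) (Fin n) ℝ)
    {Xs : Matrix (Fin m) (Fin n) ℝ} (hXs : Xs.rank ≤ r) :
    ∫⁻ p, ENNReal.ofReal ‖X - sketchApprox (rangeBasis qr X (ofEntries p.1)) (ofEntries p.2) X‖
      ∂((gaussianPi (Fin n × Fin (2 * r + 1))).prod (gaussianPi (Fin (4 * r + 3) × Fin m))) ≤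
      ENNReal.ofReal (2 * ‖X - Xs‖) := by
  have hmeas : Measurable fun p : (Fin n × Fin (2 * r + 1) → ℝ) × (Fin (4 * r + 3) × Fin m → ℝ) =>
      ‖X - sketchApprox (rangeBasis qr X (ofEntries p.1)) (ofEntries p.2) X‖ :=
    measurable_norm_sub_sketchApprox (X := fun _ => X) hqr (fun _ _ => measurable_const)
      (fun i j => (measurable_pi_apply (i, j)).comp measurable_fst)
      (fun i j => (measurable_pi_apply (i, j)).comp measurable_snd)
  refine lintegral_ofReal_le_of_lintegral_sq_le hmeas.aestronglyMeasurable
    (fun _ => norm_nonneg _) (by positivity) ?_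
  rw [lintegral_prod _ (hmeas.pow_const 2).ennreal_ofReal.aemeasurable]
  calc _ ≤ ∫⁻ ψ, 2 * ENNReal.ofReal (‖X - rangeBasis qr X (ofEntries ψ) *
          ((rangeBasis qr X (ofEntries ψ))ᵀ * X)‖ ^ 2)
        ∂(gaussianPi (Fin n × Fin (2 * r + 1))) := by
        refine lintegral_mono fun ψ => ?_
        exact (lintegral_gaussianPi_sketchApprox_le
          (hqr.rangeBasis_orthonormal X (ofEntries ψ)) (min_le_right _ _) X).2
    _ ≤ 2 * ENNReal.ofReal (2 * ‖X - Xs‖ ^ 2) := by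
        rw [lintegral_const_mul' _ _ (by simp)]
        gcongr
        exact lintegral_gaussianPi_rangeBasis_le hqr X hXs
    _ = _ := by
        rw [← ENNReal.ofReal_ofNat, ← ENNReal.ofReal_mul zero_le_two]
        congr 1
        ring

theorem ae_det_sketch_ne_zero (hqr : IsQRRoutine qr) (X : Matrix (Fin m) (Fin n) ℝ) :
    ∀ᵐ p ∂((gaussianPi (Fin n × Fin (2 * r + 1))).prod (gaussianPi (Fin (4 * r + 3) × Fin m))),
      (((ofEntries p.2 : Matrix (Fin (4 * r + 3)) (Fin m) ℝ) * rangeBasis qr X (ofEntries p.1))ᵀ *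
        ((ofEntries p.2 : Matrix (Fin (4 * r + 3)) (Fin m) ℝ) *
          rangeBasis qr X (ofEntries p.1))).det ≠ 0 := by
  have hmeas := measurable_det_sketch (X := fun _ => X)
    (Ω := (Fin n × Fin (2 * r + 1) → ℝ) × (Fin (4 * r + 3) × Fin m → ℝ))
    (Ψ := fun p => ofEntries p.1) (Φ := fun p => ofEntries p.2) hqr (fun _ _ => measurable_const)
    (fun i j => (measurable_pi_apply (i, j)).comp measurable_fst)
    (fun i j => (measurable_pi_apply (i, j)).comp measurable_snd)
  refine (Measure.ae_prod_iff_ae_ae (hmeas (measurableSet_singleton 0).compl)).mpr ?_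
  exact Filter.Eventually.of_forall fun ψ =>
    (lintegral_gaussianPi_sketchApprox_le
      (hqr.rangeBasis_orthonormal X (ofEntries ψ)) (min_le_right _ _) X).1

end ExpectedError

/-! ### The reconstruction error of a run -/

section RunError

open scoped ENNReal

variable {Ω : Type*} {m n l d : ℕ}
  [mΩ : MeasurableSpace Ω] {μ : Measure Ω} [IsProbabilityMeasure μ]
  {f : Fin d → EuclideanSpace ℝ (Fin l) → ℝ}
  {A : Matrix (Fin m) (Fin n) ℝ →ₗ[ℝ] EuclideanSpace ℝ (Fin l)} {α L δ : ℝ} {r T : ℕ}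
  {qr : (Fin m → Fin (2 * r + 1) → ℝ) → Matrix (Fin m) (Fin (min m (2 * r + 1))) ℝ}
  {X₀ : Ω → Matrix (Fin m) (Fin n) ℝ} {ξ : ℕ → ℕ → ℕ → Ω → Fin d}
  {u : ℕ → ℕ → Ω → EuclideanSpace ℝ (Fin m)} {v : ℕ → ℕ → Ω → EuclideanSpace ℝ (Fin n)}
  {Φ : Ω → Matrix (Fin (4 * r + 3)) (Fin m) ℝ} {Ψ : Ω → Matrix (Fin n) (Fin (2 * r + 1)) ℝ}
  {Xhat : ℕ → Ω → Matrix (Fin m) (Fin n) ℝ}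

/-- The entries of the two test matrices, as a pair of vectors. -/
def sketchPair (Φ : Ω → Matrix (Fin (4 * r + 3)) (Fin m) ℝ)
    (Ψ : Ω → Matrix (Fin n) (Fin (2 * r + 1)) ℝ) (ω : Ω) :
    (Fin n × Fin (2 * r + 1) → ℝ) × (Fin (4 * r + 3) × Fin m → ℝ) :=
  (fun p => Ψ ω p.1 p.2, fun p => Φ ω p.1 p.2)

theorem IsRun.measurePreserving_sketchPair
    (hrun : IsRun μ f A α L δ r T qr X₀ ξ u v Φ Ψ Xhat) :
    MeasurePreserving (sketchPair Φ Ψ) μ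
      ((gaussianPi (Fin n × Fin (2 * r + 1))).prod (gaussianPi (Fin (4 * r + 3) × Fin m))) := by
  have h := (iIndepFun_iff_map_fun_eq_pi_map
    (fun e => (hrun.measurable_sketch e).aemeasurable)).mp hrun.indep_sketch
  simp only [hrun.law_sketch] at h
  have h1 : MeasurePreserving (fun ω e => sketchEntry Φ Ψ e ω) μ
      (Measure.pi fun _ => gaussianReal 0 1) :=
    ⟨measurable_pi_lambda _ hrun.measurable_sketch, h⟩
  have h2 := measurePreserving_sumPiEquivProdPi
    (X := fun _ : (Fin (4 * r + 3) × Fin m) ⊕ (Fin n × Fin (2 * r + 1)) => ℝ)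
    (fun _ => gaussianReal 0 1)
  exact Measure.measurePreserving_swap.comp (h2.comp h1)

/-- The joint law is a product, so estimates for a fixed matrix can be integrated over the law of
any quantity determined by the run. -/
theorem IsRun.measurePreserving_prodMk_sketchPair {E : Type*} [MeasurableSpace E] {w : Ω → E}
    (hrun : IsRun μ f A α L δ r T qr X₀ ξ u v Φ Ψ Xhat)
    (hw : Measurable[sigmaRun T X₀ ξ u v univ] w) :
    MeasurePreserving (fun ω => (w ω, sketchPair Φ Ψ ω)) μ
      ((μ.map w).prod ((gaussianPi (Fin n × Fin (2 * r + 1))).prod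
        (gaussianPi (Fin (4 * r + 3) × Fin m)))) := by
  have hw' : Measurable w := hw.mono (hrun.sigmaRun_le _) le_rfl
  have hs := hrun.measurePreserving_sketchPair
  refine ⟨hw'.prodMk hs.measurable, ?_⟩
  rw [← hs.map_eq]
  refine (indepFun_iff_map_prod_eq_prod_map_map hw'.aemeasurable hs.measurable.aemeasurable).mp ?_
  rw [IndepFun_iff_Indep]
  refine indep_of_indep_of_le_left (indep_of_indep_of_le_right hrun.indep_sketch_run.symm ?_)
    hw.comap_le
  have he : ∀ e, Measurable[⨆ e, MeasurableSpace.comap (sketchEntry Φ Ψ e) inferInstance]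
      (sketchEntry Φ Ψ e) := fun e => measurable_iff_comap_le.mpr
    (le_iSup (fun e => MeasurableSpace.comap (sketchEntry Φ Ψ e) inferInstance) e)
  refine measurable_iff_comap_le.mp (Measurable.prodMk ?_ ?_)
  · exact @measurable_pi_lambda _ _ _ (_) _ _ fun p => he (Sum.inr p)
  · exact @measurable_pi_lambda _ _ _ (_) _ _ fun p => he (Sum.inl p)

omit [IsProbabilityMeasure μ] in
-- The accumulated sketches are XΨ and ΦX for the unseen primal iterate X, because multiplication by
-- a fixed matrix is linear.
theorem IsRun.isReconstruction (hrun : IsRun μ f A α L δ r T qr X₀ ξ u v Φ Ψ Xhat) {t : ℕ}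
    (ht : 1 ≤ t) (htT : t ≤ T) (ω : Ω) :
    IsReconstruction r (rangeBasis qr (primal α X₀ u v t (epochLen t) ω) (Ψ ω)) (Φ ω)
      (Φ ω * primal α X₀ u v t (epochLen t) ω) (Xhat t ω) := by
  have h := hrun.reconstruction t ht htT ω
  obtain ⟨t, rfl⟩ : ∃ s, t = s + 1 := ⟨t - 1, by omega⟩
  have hC := map_epochEnd (mulRightLinearMap (Fin m) ℝ (Ψ ω)) (X₀ ω)
    (fun t k => atom α (u t k ω) (v t k ω)) (t + 1)
  have hR := map_epochEnd (mulLeftLinearMap (Fin n) ℝ (Φ ω)) (X₀ ω)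
    (fun t k => atom α (u t k ω) (v t k ω)) (t + 1)
  simp only [mulRightLinearMap_apply, mulLeftLinearMap_apply] at hC hR
  simp only [← hC, ← hR] at h
  exact h

theorem IsRun.lintegral_norm_sub_le (hrun : IsRun μ f A α L δ r T qr X₀ ξ u v Φ Ψ Xhat)
    (hqr : IsQRRoutine qr) {Xs : Matrix (Fin m) (Fin n) ℝ} (hXs : Xs.rank ≤ r) {t : ℕ}
    (ht : 1 ≤ t) (htT : t ≤ T) :
    ∫⁻ ω, ENNReal.ofReal ‖Xhat t ω - Xs‖ ∂μ ≤
      6 * ∫⁻ ω, ENNReal.ofReal ‖primal α X₀ u v t (epochLen t) ω - Xs‖ ∂μ := by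
  set X := primal α X₀ u v t (epochLen t) with hX
  set w : Ω → Fin m × Fin n → ℝ := fun ω p => X ω p.1 p.2 with hw
  have hwX : ∀ ω, ofEntries (w ω) = X ω := fun ω => rfl
  have hwm : Measurable[sigmaRun T X₀ ξ u v univ] w :=
    @measurable_pi_lambda _ _ _ (_) _ _ fun p =>
      measurable_primal_sigmaRun ht htT le_rfl (fun _ _ _ => mem_univ _) p.1 p.2
  have hw' : Measurable w := hwm.mono (hrun.sigmaRun_le _) le_rfl
  have hmp := hrun.measurePreserving_prodMk_sketchPair hwm
  have e1 : ∀ i j, Measurable fun p : (Fin m × Fin n → ℝ) ×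
      ((Fin n × Fin (2 * r + 1) → ℝ) × (Fin (4 * r + 3) × Fin m → ℝ)) =>
        (ofEntries p.1 : Matrix (Fin m) (Fin n) ℝ) i j :=
    fun i j => (measurable_pi_apply (i, j)).comp measurable_fst
  have e2 : ∀ i j, Measurable fun p : (Fin m × Fin n → ℝ) ×
      ((Fin n × Fin (2 * r + 1) → ℝ) × (Fin (4 * r + 3) × Fin m → ℝ)) =>
        (ofEntries p.2.1 : Matrix (Fin n) (Fin (2 * r + 1)) ℝ) i j :=
    fun i j => (measurable_pi_apply (i, j)).comp (measurable_fst.comp measurable_snd)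
  have e3 : ∀ i j, Measurable fun p : (Fin m × Fin n → ℝ) ×
      ((Fin n × Fin (2 * r + 1) → ℝ) × (Fin (4 * r + 3) × Fin m → ℝ)) =>
        (ofEntries p.2.2 : Matrix (Fin (4 * r + 3)) (Fin m) ℝ) i j :=
    fun i j => (measurable_pi_apply (i, j)).comp (measurable_snd.comp measurable_snd)
  have hdet : ∀ᵐ ω ∂μ, ((Φ ω * rangeBasis qr (X ω) (Ψ ω))ᵀ *
      (Φ ω * rangeBasis qr (X ω) (Ψ ω))).det ≠ 0 :=
    hmp.quasiMeasurePreserving.ae ((Measure.ae_prod_iff_ae_ae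
      ((measurable_det_sketch hqr e1 e2 e3) (measurableSet_singleton 0).compl)).mpr
      (Filter.Eventually.of_forall fun x => ae_det_sketch_ne_zero hqr (ofEntries x)))
  have hM := (measurable_norm_sub_sketchApprox hqr e1 e2 e3).ennreal_ofReal
  have hbound : ∫⁻ ω, ENNReal.ofReal
      ‖X ω - sketchApprox (rangeBasis qr (X ω) (Ψ ω)) (Φ ω) (X ω)‖ ∂μ ≤
      2 * ∫⁻ ω, ENNReal.ofReal ‖X ω - Xs‖ ∂μ := by
    have h1 := hmp.lintegral_comp hM
    rw [lintegral_prod _ hM.aemeasurable] at h1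
    refine h1.le.trans ((lintegral_mono fun x =>
      lintegral_norm_sub_sketchApprox_le hqr (ofEntries x) hXs).trans_eq ?_)
    have hN : Measurable fun x : Fin m × Fin n → ℝ =>
        ENNReal.ofReal (2 * ‖(ofEntries x : Matrix (Fin m) (Fin n) ℝ) - Xs‖) :=
      ((measurable_norm_of_entries
        (M := fun x : Fin m × Fin n → ℝ => (ofEntries x : Matrix (Fin m) (Fin n) ℝ) - Xs)
        fun i j => (measurable_pi_apply (X := fun _ : Fin m × Fin n => ℝ) (i, j)).sub_const
          (Xs i j)).const_mul 2).ennreal_ofReal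
    rw [lintegral_map hN hw', ← lintegral_const_mul' _ _ (by simp)]
    refine lintegral_congr fun ω => ?_
    rw [hwX, ENNReal.ofReal_mul zero_le_two, ENNReal.ofReal_ofNat]
  have hXm : Measurable fun ω => ENNReal.ofReal ‖X ω - Xs‖ :=
    (measurable_norm_of_entries fun i j =>
      ((measurable_pi_apply (i, j)).comp hw').sub_const (Xs i j)).ennreal_ofReal
  calc _ ≤ ∫⁻ ω, (2 * ENNReal.ofReal
          ‖X ω - sketchApprox (rangeBasis qr (X ω) (Ψ ω)) (Φ ω) (X ω)‖ +
          2 * ENNReal.ofReal ‖X ω - Xs‖) ∂μ := by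
        refine lintegral_mono_ae ?_
        filter_upwards [hdet] with ω hω
        refine (ENNReal.ofReal_le_ofReal ((hrun.isReconstruction ht htT ω).norm_sub_le
          (hqr.rangeBasis_orthonormal _ _) hω hXs)).trans_eq ?_
        rw [ENNReal.ofReal_add (by positivity) (by positivity), ENNReal.ofReal_mul zero_le_two,
          ENNReal.ofReal_mul zero_le_two, ENNReal.ofReal_ofNat]
    -- One factor 2 comes from truncation, the inner one from the sketch, and the last term from
    -- comparing with Xs.
    _ ≤ 2 * (2 * ∫⁻ ω, ENNReal.ofReal ‖X ω - Xs‖ ∂μ) +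
          2 * ∫⁻ ω, ENNReal.ofReal ‖X ω - Xs‖ ∂μ := by
        rw [lintegral_add_right _ (hXm.const_mul 2), lintegral_const_mul' _ _ (by simp),
          lintegral_const_mul' _ _ (by simp)]
        gcongr
    _ = _ := by ring

/-- Jensen's inequality for s ↦ s^ν moves the exponent outside the expectation, where growth bounds
it by κ⁻¹ times the expected gap. -/
theorem IsRun.integral_norm_primal_sub_le (hrun : IsRun μ f A α L δ r T qr X₀ ξ u v Φ Ψ Xhat)
    (hd : 0 < d) (hα : 0 < α) (hδ : 0 < δ) {κ ν : ℝ} (hκ : 0 < κ) (hν : 1 ≤ ν)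
    (hconv : ∀ i, ConvexOn ℝ univ (f i)) (hdiff : ∀ i, Differentiable ℝ (f i))
    (hsmooth : ∀ i, IsLSmooth L fun X => f i (A X)) {Xs : Matrix (Fin m) (Fin n) ℝ}
    (hXs : nuclearNorm Xs ≤ α) (hmin : ∀ X, nuclearNorm X ≤ α → avg f (A Xs) ≤ avg f (A X))
    (hgrowth : ∀ X : Matrix (Fin m) (Fin n) ℝ, nuclearNorm X ≤ α →
      κ * ‖X - Xs‖ ^ ν ≤ avg f (A X) - avg f (A Xs)) {t : ℕ} (ht : 1 ≤ t) (htT : t ≤ T) :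
    Integrable (fun ω => ‖primal α X₀ u v t (epochLen t) ω - Xs‖) μ ∧
      ∫ ω, ‖primal α X₀ u v t (epochLen t) ω - Xs‖ ∂μ ≤
        (4 * κ⁻¹ * L * α ^ 2 * (1 + δ) / 2 ^ (t + 1)) ^ (1 / ν) := by
  set X := primal α X₀ u v t (epochLen t) with hX
  obtain ⟨hgi, hgap⟩ := hrun.integral_gap_le hd hα.le hδ.le hconv hdiff hsmooth hXs hmin ht htT
  have hfeas : ∀ ω, nuclearNorm (X ω) ≤ α := hrun.nuclearNorm_primal_le hα.le ht htT le_rfl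
  have hm : Measurable fun ω => ‖X ω - Xs‖ := measurable_norm_of_entries fun i j =>
    ((measurable_primal_sigmaRun (ξ := ξ) ht htT le_rfl (fun _ _ _ => mem_univ _) i j).mono
      (hrun.sigmaRun_le univ) le_rfl).sub_const (Xs i j)
  have hν0 : 0 < ν := zero_lt_one.trans_le hν
  have hb : ∀ ω, ‖X ω - Xs‖ ≤ 2 * α := fun ω => norm_sub_le_of_nuclearNorm_le (hfeas ω) hXs
  have hi : Integrable (fun ω => ‖X ω - Xs‖) μ :=
    Integrable.of_bound hm.aestronglyMeasurable (2 * α)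
      (Filter.Eventually.of_forall fun ω => by rw [norm_norm]; exact hb ω)
  have hip : Integrable (fun ω => ‖X ω - Xs‖ ^ ν) μ := by
    refine Integrable.of_bound (hm.pow_const ν).aestronglyMeasurable ((2 * α) ^ ν)
      (Filter.Eventually.of_forall fun ω => ?_)
    rw [Real.norm_of_nonneg (by positivity)]
    exact Real.rpow_le_rpow (norm_nonneg _) (hb ω) hν0.le
  refine ⟨hi, ?_⟩
  have hJ : (∫ ω, ‖X ω - Xs‖ ∂μ) ^ ν ≤ ∫ ω, ‖X ω - Xs‖ ^ ν ∂μ :=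
    (convexOn_rpow hν).map_integral_le (Real.continuous_rpow_const hν0.le).continuousOn isClosed_Ici
      (Filter.Eventually.of_forall fun ω => norm_nonneg _) hi hip
  have hG : ∫ ω, ‖X ω - Xs‖ ^ ν ∂μ ≤ κ⁻¹ * (L * (2 * α) ^ 2 * (1 + δ) / 2 ^ (t + 1)) := by
    rw [le_inv_mul_iff₀ hκ, ← integral_const_mul]
    exact (integral_mono (hip.const_mul κ) hgi fun ω => hgrowth _ (hfeas ω)).trans hgap
  have h0 : 0 ≤ ∫ ω, ‖X ω - Xs‖ ∂μ := integral_nonneg fun ω => norm_nonneg _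
  calc ∫ ω, ‖X ω - Xs‖ ∂μ = ((∫ ω, ‖X ω - Xs‖ ∂μ) ^ ν) ^ (1 / ν) := by
        rw [one_div, Real.rpow_rpow_inv h0 hν0.ne']
    _ ≤ _ := by
        refine Real.rpow_le_rpow (by positivity) (hJ.trans (hG.trans_eq ?_)) (by positivity)
        ring

end RunError

end SSVRF

theorem mainTheorem6 {Ω : Type*} [MeasurableSpace Ω] (μ : Measure Ω) [IsProbabilityMeasure μ]
    {m n l d : ℕ} (hd : 0 < d)
    (f : Fin d → EuclideanSpace ℝ (Fin l) → ℝ)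
    (A : Matrix (Fin m) (Fin n) ℝ →ₗ[ℝ] EuclideanSpace ℝ (Fin l))
    (α L δ κ ν : ℝ) (hα : 0 < α) (hδ : 0 < δ) (hκ : 0 < κ) (hν : 1 ≤ ν)
    (hconv : ∀ i, ConvexOn ℝ univ (f i)) (hdiff : ∀ i, ContDiff ℝ 1 (f i))
    (hsmooth : ∀ i, SSVRF.IsLSmooth L fun X => f i (A X))
    (r T : ℕ)
    (Xs : Matrix (Fin m) (Fin n) ℝ)
    (hXs : SSVRF.IsUniqueSolution (fun X => SSVRF.avg f (A X)) α Xs)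
    (hrank : Xs.rank ≤ r)
    (hgrowth : ∀ X : Matrix (Fin m) (Fin n) ℝ, SSVRF.nuclearNorm X ≤ α →
      κ * ‖X - Xs‖ ^ ν ≤ SSVRF.avg f (A X) - SSVRF.avg f (A Xs))
    (qr : (Fin m → Fin (2 * r + 1) → ℝ) → Matrix (Fin m) (Fin (min m (2 * r + 1))) ℝ)
    (hqr : SSVRF.IsQRRoutine qr)
    (X₀ : Ω → Matrix (Fin m) (Fin n) ℝ) (ξ : ℕ → ℕ → ℕ → Ω → Fin d)
    (u : ℕ → ℕ → Ω → EuclideanSpace ℝ (Fin m)) (v : ℕ → ℕ → Ω → EuclideanSpace ℝ (Fin n))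
    (Φ : Ω → Matrix (Fin (4 * r + 3)) (Fin m) ℝ) (Ψ : Ω → Matrix (Fin n) (Fin (2 * r + 1)) ℝ)
    (Xhat : ℕ → Ω → Matrix (Fin m) (Fin n) ℝ)
    (hrun : SSVRF.IsRun μ f A α L δ r T qr X₀ ξ u v Φ Ψ Xhat) :
    ∀ t, 1 ≤ t → t ≤ T →
      Integrable (fun ω => ‖Xhat t ω - Xs‖) μ ∧
        ∫ ω, ‖Xhat t ω - Xs‖ ∂μ ≤
          6 * (4 * κ⁻¹ * L * α ^ 2 * (1 + δ) / 2 ^ (t + 1)) ^ (1 / ν) := by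
  intro t ht htT
  obtain ⟨hfeas, hmin, -⟩ := hXs
  obtain ⟨hi, hle⟩ := hrun.integral_norm_primal_sub_le hd hα hδ hκ hν hconv
    (fun i => (hdiff i).differentiable one_ne_zero) hsmooth hfeas hmin hgrowth ht htT
  -- Kept in extended nonnegative form, this bound gives both the integrability of the
  -- reconstruction error and its estimate.
  have h6 := hrun.lintegral_norm_sub_le hqr hrank ht htT
  rw [← ofReal_integral_eq_lintegral_ofReal hi (Filter.Eventually.of_forall fun _ => norm_nonneg _),
    ← ENNReal.ofReal_ofNat, ← ENNReal.ofReal_mul (by norm_num)] at h6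
  have h0 : 0 ≤ᵐ[μ] fun ω => ‖Xhat t ω - Xs‖ := Filter.Eventually.of_forall fun _ => norm_nonneg _
  have hm : AEStronglyMeasurable (fun ω => ‖Xhat t ω - Xs‖) μ :=
    (SSVRF.aemeasurable_norm_of_entries fun i j =>
      (hrun.measurable_reconstruction t ht htT i j).sub_const (Xs i j)).aestronglyMeasurable
  refine ⟨⟨hm, (hasFiniteIntegral_iff_ofReal h0).mpr (h6.trans_lt ENNReal.ofReal_lt_top)⟩, ?_⟩
  rw [integral_eq_lintegral_of_nonneg_ae h0 hm]
  refine (ENNReal.toReal_le_of_le_ofReal ?_ h6).trans (by gcongr)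
  exact mul_nonneg (by norm_num) (integral_nonneg fun _ => norm_nonneg _)
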